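/- **Setting.** Fix constants $\hat\lambda,\nu>0$ and a real function $\rho\in\mathcal S(\mathbb R^2)$ that is radial, $\rho(x)=\gamma(|x|)$ with $\gamma\in\mathcal S(\mathbb R)$, with $\int\rho=1$ and with $\hat\rho$ supported in the ball of radius $1$, where $\hat f(p)=\int_{\mathbb R^2} f(x)e^{-\imath p\cdot x}dx$. For $\varepsilon>0$ let $\rho_\varepsilon=\varepsilon^{-2}\rho(\varepsilon^{-1}\cdot)$ and $V_\varepsilon=\rho_\varepsilon*\rho_\varepsilon$. For $n\ge 0$ let $H_n^\varepsilon=L^2_{sym}(\mathbb R^{2n},\mu_n^\varepsilon)$ be the space of symmetric square-integrable kernels for the measure $\mu_n^\varepsilon(dp_{1:n})=n!\prod_{i=1}^n\frac{\widehat V_\varepsilon(p_i)}{|p_i|^2}dp_{1:n}$, with inner product $\langle\psi,\varphi\rangle_\varepsilon=\int\overline{\psi}\,\varphi\,d\mu_n^\varepsilon$ and norm $\|\cdot\|_\varepsilon$ (this is the Fock space representation of the $n$-th homogeneous Wiener chaos of the curl of the two-dimensional Gaussian free field mollified by $\rho_\varepsilon$). For $0<\varepsilon<1$ define, for $\psi\in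 H_n^\varepsilon$, $$(-\mathcal L_0\psi)(p_{1:n})=\tfrac{\nu^2}{2}\Big|\sum_{i=1}^n p_i\Big|^2\psi(p_{1:n}),$$ $$(\mathcal A_+^\varepsilon\psi)(p_{1:n+1})=-\frac1{n+1}\frac{\hat\lambda}{\sqrt{\log\frac1\varepsilon}}\sum_{i=1}^{n+1}\Big(p_i\times\sum_{j=1}^{n+1}p_j\Big)\psi(p_{1:n+1\setminus i}),$$ where $a\times b=a_1b_2-a_2b_1$ and $p_{1:n+1\setminus i}$ is $p_{1:n+1}$ with $p_i$ removed. These are bounded operators $H_n^\varepsilon\to H_n^\varepsilon$ and $H_n^\varepsilon\to H_{n+1}^\varepsilon$, since $\widehat V_\varepsilon$ has compact support. Functions of $-\mathcal L_0$ are the multiplication operators by the same functions of $\frac{\nu^2}{2}|\sum_i p_i|^2$. For $\lambda>0$ let, on every $H_n^\varepsilon$, $$\mathcal H_1^\varepsilon=0,\qquad \mathcal H_{j+1}^\varepsilon=(\mathcal A_+^\varepsilon)^*(\lambda-\mathcal L_0+\mathcal H_j^\varepsilon)^{-1}\mathcal A_+^\varepsilon\quad(j\ge1),$$ and let $$L^\varepsilon(x)=\frac{\pi\hat\lambda^2}{|\log\varepsilon^2|}\log\Big(1+\frac1{\varepsilon^2x}\Big)\quad(x>0).$$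 Define $G_j$ on $[0,\infty)$ by $G_1=0$ and $G_j(x)=\int_0^x\frac{dy}{1+\frac4{\nu^4}G_{j-1}(y)}$ for $j\ge2$. **Proposition 3.1.** 1. For all $j\ge1$, $G_j$ is twice continuously differentiable on $[0,\infty)$, $G_j(0)=0$, and for all $x\ge0$: $G_j(x)\ge0$, $|G_j(x)|\le x$, $|G_j'(x)|\le1$, $|G_j''(x)|\le\frac4{\nu^4}$ (one-sided derivatives at $0$). 2. For all $\lambda>0$, $0<\varepsilon<\frac12$ and $n,j\ge1$, the operator $\lambda-\mathcal L_0+\mathcal H_j^\varepsilon$ is invertible on $H_n^\varepsilon$ with bounded inverse, so that the recursion above is meaningful. 3. There is a function $\varepsilon\mapsto\delta_\varepsilon$ with $\delta_\varepsilon\to0$ as $\varepsilon\to0$, not depending on $n,j,\lambda$, such that for every $\lambda>0$ and $n,j\ge1$ there is a constant $C=C(n,j,\lambda)$ with $$\Big|\Big\langle\varphi_1,\Big[\mathcal H_j^\varepsilon+\frac4{\nu^4}G_j(L^\varepsilon(\lambda-\mathcal L_0))\mathcal L_0\Big]\varphi_2\Big\rangle_\varepsilon\Big|\le C\,\delta_\varepsilon\,\|(-\mathcal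 L_0)^{1/2}\varphi_1\|_\varepsilon\,\|(-\mathcal L_0)^{1/2}\varphi_2\|_\varepsilon$$ for all $0<\varepsilon<\frac12$ and all $\varphi_1,\varphi_2\in H_n^\varepsilon$. (Both $\delta$ and $C$ may depend on the fixed data $\rho,\hat\lambda,\nu$.) -/

import Mathlib

open MeasureTheory Set Filter Topology
open scoped ENNReal SchwartzMap

noncomputable section

namespace WeakCoupling

/-- The plane `ℝ²` with its Euclidean norm. -/
abbrev Plane := EuclideanSpace ℝ (Fin 2)

/-- `a × b = |a||b| sin θ = a₁ b₂ - a₂ b₁`. -/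
def cross (a b : Plane) : ℝ := a 0 * b 1 - a 1 * b 0

/-- The Fourier transform `f̂(p) = ∫ f(x) e^{-i p·x} dx` of a real function on the plane. -/
def planeHat (f : Plane → ℝ) (p : Plane) : ℂ :=
  ∫ x, Complex.exp (-(Complex.I * ((inner ℝ p x : ℝ) : ℂ))) * (f x : ℂ)

/-- The mollifiers `ρ`: real Schwartz functions on the plane that are radial,
`ρ(x) = γ(|x|)` with `γ` Schwartz on the line, have integral one and have Fourier transform
supported in the ball of radius one. -/
structure Mollifier where
  /-- the underlying Schwartz function -/
  toSchwartz : 𝓢(Plane, ℝ)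
  radial : ∃ γ : 𝓢(ℝ, ℝ), ∀ x, toSchwartz x = γ ‖x‖
  integral_eq_one : ∫ x, toSchwartz x = 1
  hat_support : ∀ p, 1 < ‖p‖ → planeHat toSchwartz p = 0

/-- `ρ_ε(x) = ε⁻² ρ(ε⁻¹ x)`. -/
def rhoEps (ρ : Mollifier) (ε : ℝ) (x : Plane) : ℝ := ε⁻¹ ^ 2 * ρ.toSchwartz (ε⁻¹ • x)

/-- `V_ε = ρ_ε * ρ_ε`. -/
def VEps (ρ : Mollifier) (ε : ℝ) (x : Plane) : ℝ := ∫ y, rhoEps ρ ε (x - y) * rhoEps ρ ε y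

/-- The Fourier transform of `V_ε`; it is real (and non-negative) because `ρ` is even, so
that taking the real part only changes the type. -/
def VHat (ρ : Mollifier) (ε : ℝ) (p : Plane) : ℝ := (planeHat (VEps ρ ε) p).re

/-- The measure `V̂_ε(p) / |p|² dp` on the plane. -/
def momentumMeasure (ρ : Mollifier) (ε : ℝ) : Measure Plane :=
  volume.withDensity fun p => ENNReal.ofReal (VHat ρ ε p / ‖p‖ ^ 2)

instance (ρ : Mollifier) (ε : ℝ) : SigmaFinite (momentumMeasure ρ ε) := by
  unfold momentumMeasure; infer_instance

/-- The measure `μ_n^ε(dp_{1:n}) = n! ∏ V̂_ε(p_i)/|p_i|² dp_{1:n}` on `(ℝ²)ⁿ`. -/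
def fockMeasure (ρ : Mollifier) (ε : ℝ) (n : ℕ) : Measure (Fin n → Plane) :=
  (n.factorial : ℝ≥0∞) • Measure.pi fun _ => momentumMeasure ρ ε

/-! ### Facts on the Fourier transform of the covariance -/

section Aux

theorem planeHat_bound (f : Plane → ℝ) (p : Plane) : ‖planeHat f p‖ ≤ ∫ x, ‖f x‖ := by
  refine (norm_integral_le_integral_norm _).trans_eq ?_
  congr 1; ext x
  rw [norm_mul, Complex.norm_exp]
  simp

theorem planeHat_continuous {f : Plane → ℝ} (hf : Integrable f) : Continuous (planeHat f) := by
  unfold planeHat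
  refine continuous_of_dominated (bound := fun x => ‖f x‖) ?_ ?_ hf.norm ?_
  · intro p
    refine AEStronglyMeasurable.mul (Continuous.aestronglyMeasurable (by fun_prop)) ?_
    exact Complex.continuous_ofReal.comp_aestronglyMeasurable hf.1
  · intro p
    refine Eventually.of_forall fun x => ?_
    rw [norm_mul, Complex.norm_exp]
    simp
  · exact Eventually.of_forall fun x => by fun_prop

theorem rhoEps_zero (ρ : Mollifier) : rhoEps ρ 0 = 0 := by
  ext x; simp [rhoEps]

theorem rhoEps_integrable (ρ : Mollifier) (ε : ℝ) : Integrable (rhoEps ρ ε) := by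
  rcases eq_or_ne ε 0 with rfl | hε
  · rw [rhoEps_zero]; exact integrable_zero _ _ _
  · unfold rhoEps
    exact (Integrable.comp_smul ρ.toSchwartz.integrable (inv_ne_zero hε)).const_mul _

theorem planeHat_rhoEps (ρ : Mollifier) {ε : ℝ} (hε : ε ≠ 0) (p : Plane) :
    planeHat (rhoEps ρ ε) p = planeHat ρ.toSchwartz (ε • p) := by
  have h := Measure.integral_comp_inv_smul (volume : Measure Plane)
    (fun x => Complex.exp (-(Complex.I * ((inner ℝ (ε • p) x : ℝ) : ℂ))) *
      (ρ.toSchwartz x : ℂ)) ε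
  simp only [finrank_euclideanSpace, Fintype.card_fin] at h
  unfold planeHat
  have h2 : ∀ x : Plane, Complex.exp (-(Complex.I * ((inner ℝ p x : ℝ) : ℂ))) *
      (rhoEps ρ ε x : ℂ) = ((ε⁻¹ ^ 2 : ℝ) : ℂ) *
      (Complex.exp (-(Complex.I * ((inner ℝ (ε • p) (ε⁻¹ • x) : ℝ) : ℂ))) *
      (ρ.toSchwartz (ε⁻¹ • x) : ℂ)) := by
    intro x
    have : (inner ℝ (ε • p) (ε⁻¹ • x) : ℝ) = inner ℝ p x := by
      rw [real_inner_smul_left, real_inner_smul_right]; field_simp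
    rw [this, rhoEps]; push_cast; ring
  simp_rw [h2]
  rw [integral_const_mul, h, abs_of_nonneg (by positivity), Complex.real_smul, ← mul_assoc,
    ← Complex.ofReal_mul]
  have : ε⁻¹ ^ 2 * ε ^ 2 = 1 := by field_simp
  rw [this]; simp

theorem planeHat_rhoEps_eq_zero (ρ : Mollifier) (ε : ℝ) (p : Plane) (hp : |ε|⁻¹ < ‖p‖) :
    planeHat (rhoEps ρ ε) p = 0 := by
  rcases eq_or_ne ε 0 with rfl | hε
  · rw [rhoEps_zero]; simp [planeHat]
  · rw [planeHat_rhoEps ρ hε]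
    apply ρ.hat_support
    rw [norm_smul, Real.norm_eq_abs]
    exact (inv_lt_iff_one_lt_mul₀' (abs_pos.2 hε)).1 hp

theorem VEps_integrable (ρ : Mollifier) (ε : ℝ) : Integrable (VEps ρ ε) := by
  have h := (rhoEps_integrable ρ ε).integrable_convolution (ContinuousLinearMap.mul ℝ ℝ)
    (rhoEps_integrable ρ ε)
  convert h using 1
  ext x
  simp [VEps, convolution, mul_comm]

theorem planeHat_VEps (ρ : Mollifier) (ε : ℝ) (p : Plane) :
    planeHat (VEps ρ ε) p = planeHat (rhoEps ρ ε) p ^ 2 := by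
  have hF : ∀ f : Plane → ℝ, planeHat f p =
      FourierTransform.fourier (fun x => (f x : ℂ)) ((2 * Real.pi)⁻¹ • p) := by
    intro f
    rw [Real.fourier_eq']
    unfold planeHat
    congr 1; ext x
    rw [smul_eq_mul, real_inner_smul_right, real_inner_comm x p]
    congr 2
    have hpi : (Real.pi : ℂ) ≠ 0 := by exact_mod_cast Real.pi_ne_zero
    push_cast
    field_simp
  have hi : Integrable (fun x => (rhoEps ρ ε x : ℂ)) := (rhoEps_integrable ρ ε).ofReal
  rw [hF, hF, sq, ← Real.fourier_mul_convolution_eq hi hi]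
  refine congrArg (fun F : Plane → ℂ => (FourierTransform.fourier F : Plane → ℂ)
    ((2 * Real.pi)⁻¹ • p)) (funext fun x => ?_)
  simp only [convolution, VEps, ContinuousLinearMap.mul_apply']
  rw [← integral_complex_ofReal]
  congr 1; ext y; push_cast; ring

theorem VHat_eq_zero (ρ : Mollifier) (ε : ℝ) (p : Plane) (hp : |ε|⁻¹ < ‖p‖) :
    VHat ρ ε p = 0 := by
  simp [VHat, planeHat_VEps, planeHat_rhoEps_eq_zero ρ ε p hp]

theorem VHat_continuous (ρ : Mollifier) (ε : ℝ) : Continuous (VHat ρ ε) :=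
  Complex.continuous_re.comp (planeHat_continuous (VEps_integrable ρ ε))

theorem density_measurable (ρ : Mollifier) (ε : ℝ) :
    Measurable fun p => ENNReal.ofReal (VHat ρ ε p / ‖p‖ ^ 2) :=
  ENNReal.measurable_ofReal.comp
    ((VHat_continuous ρ ε).measurable.div (by fun_prop))

theorem momentum_ae_norm_le (ρ : Mollifier) (ε : ℝ) :
    ∀ᵐ p ∂(momentumMeasure ρ ε), ‖p‖ ≤ |ε|⁻¹ := by
  unfold momentumMeasure
  rw [ae_withDensity_iff (density_measurable ρ ε)]
  refine Eventually.of_forall fun p hp => ?_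
  by_contra h
  exact hp (by simp [VHat_eq_zero ρ ε p (not_le.1 h)])

theorem momentum_second_moment_lt_top (ρ : Mollifier) (ε : ℝ) :
    ∫⁻ p, ENNReal.ofReal (‖p‖ ^ 2) ∂(momentumMeasure ρ ε) < ∞ := by
  unfold momentumMeasure
  rw [lintegral_withDensity_eq_lintegral_mul _ (density_measurable ρ ε) (by fun_prop)]
  set M := ∫ x, ‖VEps ρ ε x‖ with hM
  have hle : ∀ p, ((fun p : Plane => ENNReal.ofReal (VHat ρ ε p / ‖p‖ ^ 2)) *
      (fun p : Plane => ENNReal.ofReal (‖p‖ ^ 2)) : Plane → ℝ≥0∞) p ≤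
      (Metric.closedBall (0 : Plane) |ε|⁻¹).indicator (fun _ => ENNReal.ofReal M) p := by
    intro p
    simp only [Pi.mul_apply]
    by_cases hp : p ∈ Metric.closedBall (0 : Plane) |ε|⁻¹
    · rw [indicator_of_mem hp, ← ENNReal.ofReal_mul' (by positivity)]
      apply ENNReal.ofReal_le_ofReal
      have hM0 : 0 ≤ M := integral_nonneg fun _ => norm_nonneg _
      rcases eq_or_ne p 0 with rfl | h0
      · simpa using hM0
      · rw [div_mul_cancel₀ _ (by simpa using h0)]
        exact (Complex.re_le_norm _).trans (planeHat_bound _ _)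
    · rw [indicator_of_notMem hp]
      have : |ε|⁻¹ < ‖p‖ := by simpa using hp
      simp [VHat_eq_zero ρ ε p this]
  refine (lintegral_mono hle).trans_lt ?_
  rw [lintegral_indicator_const Metric.isClosed_closedBall.measurableSet]
  exact ENNReal.mul_lt_top ENNReal.ofReal_lt_top measure_closedBall_lt_top

theorem pi_ae_norm_le (ρ : Mollifier) (ε : ℝ) (n : ℕ) :
    ∀ᵐ p ∂(Measure.pi fun _ : Fin n => momentumMeasure ρ ε), ‖∑ i, p i‖ ≤ n * |ε|⁻¹ := by
  have h : ∀ᵐ p ∂(Measure.pi fun _ : Fin n => momentumMeasure ρ ε), ∀ i, ‖p i‖ ≤ |ε|⁻¹ :=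
    ae_all_iff.2 fun i => (Measure.tendsto_eval_ae_ae
      (μ := fun _ : Fin n => momentumMeasure ρ ε) (i := i)).eventually (momentum_ae_norm_le ρ ε)
  refine h.mono fun p hp => ?_
  refine (norm_sum_le Finset.univ p).trans ((Finset.sum_le_sum fun i _ => hp i).trans_eq ?_)
  simp

theorem fock_ae_norm_le (ρ : Mollifier) (ε : ℝ) (n : ℕ) :
    ∀ᵐ p ∂(fockMeasure ρ ε n), ‖∑ i, p i‖ ≤ n * |ε|⁻¹ :=
  Measure.ae_smul_measure (pi_ae_norm_le ρ ε n) _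

theorem cross_add_self_left (a b : Plane) : cross a (a + b) = cross a b := by
  simp [cross]; ring

theorem cross_sq_le (a b : Plane) : cross a b ^ 2 ≤ ‖a‖ ^ 2 * ‖b‖ ^ 2 := by
  simp only [EuclideanSpace.norm_sq_eq, Fin.sum_univ_two, Real.norm_eq_abs, sq_abs, cross]
  nlinarith [sq_nonneg (a 0 * b 0 + a 1 * b 1)]

end Aux

/-! ### Weighted composition operators between `L²` spaces -/

section Pull

variable {α β : Type*} [MeasurableSpace α] [MeasurableSpace β] {μ : Measure α} {μ' : Measure β}

theorem pull_eLpNorm_le {T : α → β} {m : α → ℂ}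
    {C : NNReal}
    (hC : ∀ g : β → ℝ≥0∞, Measurable g →
      ∫⁻ a, ‖m a‖ₑ ^ 2 * g (T a) ∂μ ≤ C * ∫⁻ b, g b ∂μ') (f : Lp ℂ 2 μ') :
    eLpNorm (fun a => m a * f (T a)) 2 μ ≤ (C : ℝ≥0∞) ^ (1 / 2 : ℝ) * eLpNorm f 2 μ' := by
  rw [eLpNorm_eq_lintegral_rpow_enorm_toReal (by norm_num) (by norm_num),
    eLpNorm_eq_lintegral_rpow_enorm_toReal (by norm_num) (by norm_num)]
  simp only [ENNReal.toReal_ofNat, enorm_mul]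
  rw [← ENNReal.mul_rpow_of_nonneg _ _ (by norm_num)]
  refine ENNReal.rpow_le_rpow ?_ (by norm_num)
  have hmeas : Measurable fun b => ‖f b‖ₑ ^ 2 := (Lp.stronglyMeasurable f).enorm.pow_const 2
  simpa [mul_pow] using hC _ hmeas

theorem pull_memLp {T : α → β} (hT : Measure.QuasiMeasurePreserving T μ μ') {m : α → ℂ}
    (hm : AEStronglyMeasurable m μ)
    (hC : ∃ C : NNReal, ∀ g : β → ℝ≥0∞, Measurable g →
      ∫⁻ a, ‖m a‖ₑ ^ 2 * g (T a) ∂μ ≤ C * ∫⁻ b, g b ∂μ') (f : Lp ℂ 2 μ') :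
    MemLp (fun a => m a * f (T a)) 2 μ :=
  ⟨hm.mul ((Lp.aestronglyMeasurable f).comp_quasiMeasurePreserving hT),
    (pull_eLpNorm_le hC.choose_spec f).trans_lt
      (ENNReal.mul_lt_top (ENNReal.rpow_lt_top_of_nonneg (by norm_num) ENNReal.coe_ne_top)
        (Lp.eLpNorm_lt_top f))⟩

/-- The bounded operator `f ↦ (a ↦ m(a) f(T a))` between `L²` spaces. -/
def pullMul (T : α → β) (hT : Measure.QuasiMeasurePreserving T μ μ') (m : α → ℂ)
    (hm : AEStronglyMeasurable m μ)
    (hC : ∃ C : NNReal, ∀ g : β → ℝ≥0∞, Measurable g →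
      ∫⁻ a, ‖m a‖ₑ ^ 2 * g (T a) ∂μ ≤ C * ∫⁻ b, g b ∂μ') : Lp ℂ 2 μ' →L[ℂ] Lp ℂ 2 μ :=
  LinearMap.mkContinuous
    { toFun := fun f => (pull_memLp hT hm hC f).toLp (fun a => m a * f (T a))
      map_add' := fun f g => by
        rw [← MemLp.toLp_add (pull_memLp hT hm hC f) (pull_memLp hT hm hC g)]
        refine MemLp.toLp_congr _ _ ?_
        filter_upwards [hT.ae (Lp.coeFn_add f g)] with a ha
        simp only [Pi.add_apply] at ha ⊢
        rw [ha]; ring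
      map_smul' := fun c f => by
        rw [RingHom.id_apply, ← MemLp.toLp_const_smul c (pull_memLp hT hm hC f)]
        refine MemLp.toLp_congr _ _ ?_
        filter_upwards [hT.ae (Lp.coeFn_smul c f)] with a ha
        simp only [Pi.smul_apply, smul_eq_mul] at ha ⊢
        rw [ha]; ring }
    ((hC.choose : ℝ≥0∞) ^ (1 / 2 : ℝ)).toReal
    (fun f => by
      change ‖(pull_memLp hT hm hC f).toLp (fun a => m a * f (T a))‖ ≤ _
      rw [Lp.norm_toLp, Lp.norm_def, ← ENNReal.toReal_mul]
      exact ENNReal.toReal_mono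
        (ENNReal.mul_lt_top (ENNReal.rpow_lt_top_of_nonneg (by norm_num) ENNReal.coe_ne_top)
          (Lp.eLpNorm_lt_top f)).ne (pull_eLpNorm_le hC.choose_spec f))

theorem coeFn_pullMul (T : α → β) (hT : Measure.QuasiMeasurePreserving T μ μ') (m : α → ℂ)
    (hm : AEStronglyMeasurable m μ)
    (hC : ∃ C : NNReal, ∀ g : β → ℝ≥0∞, Measurable g →
      ∫⁻ a, ‖m a‖ₑ ^ 2 * g (T a) ∂μ ≤ C * ∫⁻ b, g b ∂μ') (f : Lp ℂ 2 μ') :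
    pullMul T hT m hm hC f =ᵐ[μ] fun a => m a * f (T a) :=
  MemLp.coeFn_toLp (pull_memLp hT hm hC f)

end Pull

/-! ### The Fock space -/

theorem perm_measurePreserving (ρ : Mollifier) (ε : ℝ) (n : ℕ) (σ : Equiv.Perm (Fin n)) :
    MeasurePreserving (fun p : Fin n → Plane => p ∘ σ) (fockMeasure ρ ε n)
      (fockMeasure ρ ε n) := by
  refine MeasurePreserving.smul_measure ?_ _
  have h := measurePreserving_piCongrLeft (fun _ : Fin n => momentumMeasure ρ ε) σ.symm
  convert h using 1
  ext p i
  have := MeasurableEquiv.piCongrLeft_apply_apply (β := fun _ : Fin n => Plane) σ.symm p (σ i)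
  simp only [Equiv.symm_apply_apply] at this
  simp [this]

/-- The `n`-th component of the Fock space, `L²_sym((ℝ²)ⁿ, μ_n^ε)`: the kernels (in Fourier
variables) of the elements of the `n`-th homogeneous chaos.  Its norm and inner product
`⟪ψ, φ⟫ = n! ∫ ∏ V̂_ε(p_i)/|p_i|² conj(ψ) φ` are those of `Lp`. -/
def Fock (ρ : Mollifier) (ε : ℝ) (n : ℕ) : Submodule ℂ (Lp ℂ 2 (fockMeasure ρ ε n)) where
  carrier := {f | ∀ σ : Equiv.Perm (Fin n),
    (fun p : Fin n → Plane => f (p ∘ σ)) =ᵐ[fockMeasure ρ ε n] f}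
  zero_mem' := fun σ => by
    have h0 := Lp.coeFn_zero ℂ 2 (fockMeasure ρ ε n)
    filter_upwards [h0, (perm_measurePreserving ρ ε n σ).quasiMeasurePreserving.ae h0]
      with p h1 h2
    exact h2.trans h1.symm
  add_mem' := fun {f g} hf hg σ => by
    have h0 := Lp.coeFn_add f g
    filter_upwards [h0, (perm_measurePreserving ρ ε n σ).quasiMeasurePreserving.ae h0,
      hf σ, hg σ] with p h1 h2 h3 h4
    refine h2.trans (Eq.trans ?_ h1.symm)
    simp [h3, h4]
  smul_mem' := fun c f hf σ => by
    have h0 := Lp.coeFn_smul c f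
    filter_upwards [h0, (perm_measurePreserving ρ ε n σ).quasiMeasurePreserving.ae h0,
      hf σ] with p h1 h2 h3
    refine h2.trans (Eq.trans ?_ h1.symm)
    simp [h3]

theorem Fock_isClosed (ρ : Mollifier) (ε : ℝ) (n : ℕ) :
    IsClosed (Fock ρ ε n : Set (Lp ℂ 2 (fockMeasure ρ ε n))) := by
  have h : (Fock ρ ε n : Set (Lp ℂ 2 (fockMeasure ρ ε n))) = ⋂ σ : Equiv.Perm (Fin n),
      {f | Lp.compMeasurePreserving _ (perm_measurePreserving ρ ε n σ) f = f} := by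
    ext f
    simp only [mem_iInter, mem_ofPred_eq, SetLike.mem_coe]
    refine forall_congr' fun σ => ?_
    rw [Lp.ext_iff]
    have := Lp.coeFn_compMeasurePreserving f (perm_measurePreserving ρ ε n σ)
    exact ⟨fun h => this.trans h, fun h => this.symm.trans h⟩
  rw [h]
  exact isClosed_iInter fun σ => isClosed_eq
    (Lp.isometry_compMeasurePreserving (perm_measurePreserving ρ ε n σ)).continuous continuous_id

instance (ρ : Mollifier) (ε : ℝ) (n : ℕ) : CompleteSpace (Fock ρ ε n) :=
  (Fock_isClosed ρ ε n).completeSpace_coe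

/-! ### Diagonal operators -/

/-- The symbol `(ν²/2) |p₁ + ⋯ + p_n|²` of `-L₀`. -/
def kinetic (ν : ℝ) {n : ℕ} (p : Fin n → Plane) : ℝ := ν ^ 2 / 2 * ‖∑ i, p i‖ ^ 2

theorem kinetic_nonneg (ν : ℝ) {n : ℕ} (p : Fin n → Plane) : 0 ≤ kinetic ν p := by
  unfold kinetic; positivity

theorem diag_measurable (ν : ℝ) (n : ℕ) {F : ℝ → ℝ} (hF : ContinuousOn F (Ici 0)) :
    Continuous fun p : Fin n → Plane => ((F (kinetic ν p) : ℝ) : ℂ) := by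
  refine Complex.continuous_ofReal.comp ?_
  refine hF.comp_continuous ?_ fun p => kinetic_nonneg ν p
  unfold kinetic; fun_prop

theorem diag_bound (ρ : Mollifier) (ε ν : ℝ) (n : ℕ) {F : ℝ → ℝ}
    (hF : ContinuousOn F (Ici 0)) :
    ∃ C : NNReal, ∀ g : (Fin n → Plane) → ℝ≥0∞, Measurable g →
      ∫⁻ p, ‖((F (kinetic ν p) : ℝ) : ℂ)‖ₑ ^ 2 * g (id p) ∂(fockMeasure ρ ε n) ≤
        C * ∫⁻ p, g p ∂(fockMeasure ρ ε n) := by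
  obtain ⟨B, hB⟩ := (isCompact_Icc (a := (0 : ℝ)) (b := ν ^ 2 / 2 * (n * |ε|⁻¹) ^ 2)
    ).exists_bound_of_continuousOn (hF.mono fun x hx => hx.1)
  refine ⟨B.toNNReal ^ 2, fun g hg => ?_⟩
  rw [← lintegral_const_mul _ hg]
  refine lintegral_mono_ae ?_
  filter_upwards [fock_ae_norm_le ρ ε n] with p hp
  have hk : kinetic ν p ∈ Icc 0 (ν ^ 2 / 2 * (n * |ε|⁻¹) ^ 2) :=
    ⟨kinetic_nonneg ν p, by unfold kinetic; gcongr⟩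
  have h1 := hB _ hk
  simp only [id]
  gcongr
  push_cast
  gcongr
  rw [← ofReal_norm, Complex.norm_real]
  exact ENNReal.ofReal_le_ofReal h1

theorem kinetic_perm (ν : ℝ) {n : ℕ} (p : Fin n → Plane) (σ : Equiv.Perm (Fin n)) :
    kinetic ν (p ∘ σ) = kinetic ν p := by
  unfold kinetic
  rw [← Equiv.sum_comp σ p]; rfl

/-- The diagonal operator `F(-L₀)` on the `n`-th component of the Fock space: multiplication of
the kernel `φ(p_{1:n})` by `F((ν²/2)|p₁ + ⋯ + p_n|²)`.  It is bounded, because `V̂_ε` has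
compact support. -/
def diagOp (ρ : Mollifier) (ε ν : ℝ) (n : ℕ) (F : ℝ → ℝ) (hF : ContinuousOn F (Ici 0)) :
    Fock ρ ε n →L[ℂ] Fock ρ ε n :=
  ((pullMul id (Measure.QuasiMeasurePreserving.id _)
      (fun p : Fin n → Plane => ((F (kinetic ν p) : ℝ) : ℂ))
      (diag_measurable ν n hF).aestronglyMeasurable (diag_bound ρ ε ν n hF)).comp
    (Fock ρ ε n).subtypeL).codRestrict (Fock ρ ε n) fun φ σ => by
      have h0 := coeFn_pullMul id (Measure.QuasiMeasurePreserving.id _)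
        (fun p : Fin n → Plane => ((F (kinetic ν p) : ℝ) : ℂ))
        (diag_measurable ν n hF).aestronglyMeasurable (diag_bound ρ ε ν n hF)
        (φ : Lp ℂ 2 (fockMeasure ρ ε n))
      filter_upwards [h0, (perm_measurePreserving ρ ε n σ).quasiMeasurePreserving.ae h0,
        φ.2 σ] with p h1 h2 h3
      refine h2.trans (Eq.trans ?_ h1.symm)
      simp only [id, kinetic_perm, h3]

theorem coeFn_diagOp (ρ : Mollifier) (ε ν : ℝ) (n : ℕ) (F : ℝ → ℝ)
    (hF : ContinuousOn F (Ici 0)) (φ : Fock ρ ε n) :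
    (diagOp ρ ε ν n F hF φ : Lp ℂ 2 (fockMeasure ρ ε n)) =ᵐ[fockMeasure ρ ε n]
      fun p => ((F (ν ^ 2 / 2 * ‖∑ i, p i‖ ^ 2) : ℝ) : ℂ) *
        (φ : Lp ℂ 2 (fockMeasure ρ ε n)) p :=
  coeFn_pullMul id (Measure.QuasiMeasurePreserving.id _)
    (fun p : Fin n → Plane => ((F (kinetic ν p) : ℝ) : ℂ))
    (diag_measurable ν n hF).aestronglyMeasurable (diag_bound ρ ε ν n hF)
    (φ : Lp ℂ 2 (fockMeasure ρ ε n))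

/-- `-L₀`, with symbol `(ν²/2)|p₁ + ⋯ + p_n|²`. -/
def negL0 (ρ : Mollifier) (ε ν : ℝ) (n : ℕ) : Fock ρ ε n →L[ℂ] Fock ρ ε n :=
  diagOp ρ ε ν n id continuousOn_id

/-- `L₀`. -/
def opL0 (ρ : Mollifier) (ε ν : ℝ) (n : ℕ) : Fock ρ ε n →L[ℂ] Fock ρ ε n := -negL0 ρ ε ν n

/-- `(-L₀)^{1/2}`. -/
def sqrtNegL0 (ρ : Mollifier) (ε ν : ℝ) (n : ℕ) : Fock ρ ε n →L[ℂ] Fock ρ ε n :=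
  diagOp ρ ε ν n Real.sqrt Real.continuous_sqrt.continuousOn

/-! ### The creation part of the generator -/

theorem removeNth_quasi (ρ : Mollifier) (ε : ℝ) (n : ℕ) (i : Fin (n + 1)) :
    Measure.QuasiMeasurePreserving (fun p : Fin (n + 1) → Plane => i.removeNth p)
      (fockMeasure ρ ε (n + 1)) (fockMeasure ρ ε n) := by
  have h := (Measure.quasiMeasurePreserving_snd (μ := momentumMeasure ρ ε)
    (ν := Measure.pi fun _ : Fin n => momentumMeasure ρ ε)).comp
    (measurePreserving_piFinSuccAbove
      (fun _ : Fin (n + 1) => momentumMeasure ρ ε) i).quasiMeasurePreserving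
  refine h.mono ?_ ?_
  · exact Measure.smul_absolutelyContinuous
  · exact Measure.absolutelyContinuous_smul (by exact_mod_cast n.factorial_ne_zero)

theorem cross_measurable (n : ℕ) (i : Fin (n + 1)) :
    Continuous fun p : Fin (n + 1) → Plane => ((cross (p i) (∑ j, p j) : ℝ) : ℂ) := by
  unfold cross
  fun_prop

theorem cross_bound (ρ : Mollifier) (ε : ℝ) (n : ℕ) (i : Fin (n + 1)) :
    ∃ C : NNReal, ∀ g : (Fin n → Plane) → ℝ≥0∞, Measurable g →
      ∫⁻ p, ‖((cross (p i) (∑ j, p j) : ℝ) : ℂ)‖ₑ ^ 2 * g (i.removeNth p)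
        ∂(fockMeasure ρ ε (n + 1)) ≤ C * ∫⁻ p, g p ∂(fockMeasure ρ ε n) := by
  set K := ∫⁻ p, ENNReal.ofReal (‖p‖ ^ 2) ∂(momentumMeasure ρ ε) with hK
  have hKt : K ≠ ∞ := (momentum_second_moment_lt_top ρ ε).ne
  set P := Measure.pi fun _ : Fin n => momentumMeasure ρ ε with hP
  set R := (n : ℝ) * |ε|⁻¹ with hR
  refine ⟨(n + 1 : NNReal) * K.toNNReal * (R ^ 2).toNNReal, fun g hg => ?_⟩
  have hae : ∀ᵐ r ∂P, ‖∑ j, r j‖ ≤ R := pi_ae_norm_le ρ ε n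
  have hmp := measurePreserving_piFinSuccAbove (fun _ : Fin (n + 1) => momentumMeasure ρ ε) i
  have hbase : ∫⁻ p, ‖((cross (p i) (∑ j, p j) : ℝ) : ℂ)‖ₑ ^ 2 * g (i.removeNth p)
      ∂(Measure.pi fun _ : Fin (n + 1) => momentumMeasure ρ ε) ≤
      K * (ENNReal.ofReal (R ^ 2) * ∫⁻ r, g r ∂P) := by
    calc ∫⁻ p, ‖((cross (p i) (∑ j, p j) : ℝ) : ℂ)‖ₑ ^ 2 * g (i.removeNth p)
          ∂(Measure.pi fun _ : Fin (n + 1) => momentumMeasure ρ ε)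
        ≤ ∫⁻ p, (fun z : Plane × (Fin n → Plane) => ENNReal.ofReal (‖z.1‖ ^ 2) *
            (ENNReal.ofReal (‖∑ j, z.2 j‖ ^ 2) * g z.2))
            (MeasurableEquiv.piFinSuccAbove (fun _ => Plane) i p)
          ∂(Measure.pi fun _ : Fin (n + 1) => momentumMeasure ρ ε) := by
          refine lintegral_mono fun p => ?_
          change _ ≤ ENNReal.ofReal (‖p i‖ ^ 2) *
            (ENNReal.ofReal (‖∑ j, i.removeNth p j‖ ^ 2) * g (i.removeNth p))
          rw [← mul_assoc]
          gcongr
          rw [← ENNReal.ofReal_mul (by positivity), ← ofReal_norm,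
            ← ENNReal.ofReal_pow (norm_nonneg _)]
          refine ENNReal.ofReal_le_ofReal ?_
          rw [Complex.norm_real, Real.norm_eq_abs, sq_abs, Fin.sum_univ_succAbove _ i,
            cross_add_self_left]
          exact cross_sq_le _ _
      _ = ∫⁻ z, ENNReal.ofReal (‖z.1‖ ^ 2) * (ENNReal.ofReal (‖∑ j, z.2 j‖ ^ 2) * g z.2)
            ∂((momentumMeasure ρ ε).prod P) := by
          exact hmp.lintegral_comp (f := fun z : Plane × (Fin n → Plane) =>
            ENNReal.ofReal (‖z.1‖ ^ 2) * (ENNReal.ofReal (‖∑ j, z.2 j‖ ^ 2) * g z.2))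
            (by fun_prop)
      _ = K * ∫⁻ r, ENNReal.ofReal (‖∑ j, r j‖ ^ 2) * g r ∂P := by
          rw [lintegral_prod_mul (f := fun q : Plane => ENNReal.ofReal (‖q‖ ^ 2))
            (g := fun r : Fin n → Plane => ENNReal.ofReal (‖∑ j, r j‖ ^ 2) * g r)
            (by fun_prop) (by fun_prop)]
      _ ≤ _ := by
          rw [← lintegral_const_mul _ hg]
          refine mul_le_mul' le_rfl (lintegral_mono_ae ?_)
          filter_upwards [hae] with r hr
          gcongr
  unfold fockMeasure
  rw [lintegral_smul_measure, lintegral_smul_measure]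
  refine (mul_le_mul_right hbase _).trans_eq ?_
  rw [Nat.factorial_succ]
  simp only [smul_eq_mul]
  push_cast
  rw [ENNReal.coe_toNNReal hKt]
  simp only [ENNReal.ofReal]
  ring

/-- The operator sending the kernel `f(p_{1:n})` to `(p_i × ∑_j p_j) f(p_{1:n+1 \ i})`. -/
def insertOp (ρ : Mollifier) (ε : ℝ) (n : ℕ) (i : Fin (n + 1)) :
    Lp ℂ 2 (fockMeasure ρ ε n) →L[ℂ] Lp ℂ 2 (fockMeasure ρ ε (n + 1)) :=
  pullMul (fun p : Fin (n + 1) → Plane => i.removeNth p) (removeNth_quasi ρ ε n i)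
    (fun p => ((cross (p i) (∑ j, p j) : ℝ) : ℂ))
    (cross_measurable n i).aestronglyMeasurable (cross_bound ρ ε n i)

/-- The formula of `A₊^ε` on `L²`, before restriction to symmetric kernels. -/
def aPlusFull (ρ : Mollifier) (lhat ε : ℝ) (n : ℕ) :
    Lp ℂ 2 (fockMeasure ρ ε n) →L[ℂ] Lp ℂ 2 (fockMeasure ρ ε (n + 1)) :=
  ((-(1 / (n + 1) * (lhat / √(Real.log (1 / ε)))) : ℝ) : ℂ) • ∑ i, insertOp ρ ε n i

theorem coeFn_aPlusFull (ρ : Mollifier) (lhat ε : ℝ) (n : ℕ)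
    (f : Lp ℂ 2 (fockMeasure ρ ε n)) :
    aPlusFull ρ lhat ε n f =ᵐ[fockMeasure ρ ε (n + 1)] fun p =>
      ((-(1 / (n + 1) * (lhat / √(Real.log (1 / ε)))) : ℝ) : ℂ) *
        ∑ i, ((cross (p i) (∑ j, p j) : ℝ) : ℂ) * f (i.removeNth p) := by
  unfold aPlusFull
  have h1 := Lp.coeFn_smul ((-(1 / (n + 1) * (lhat / √(Real.log (1 / ε)))) : ℝ) : ℂ)
    (∑ i, insertOp ρ ε n i f)
  have h2 := Lp.coeFn_finsetSum Finset.univ fun i => insertOp ρ ε n i f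
  have h3 : ∀ᵐ p ∂(fockMeasure ρ ε (n + 1)), ∀ i, insertOp ρ ε n i f p =
      ((cross (p i) (∑ j, p j) : ℝ) : ℂ) * f (i.removeNth p) :=
    ae_all_iff.2 fun i => coeFn_pullMul _ _ _ _ _ _
  simp only [smul_apply, sum_apply]
  filter_upwards [h1, h2, h3] with p h1 h2 h3
  rw [h1, Pi.smul_apply, h2, smul_eq_mul, Finset.sum_apply]
  simp only [h3]

theorem removeNth_perm {n : ℕ} (σ : Equiv.Perm (Fin (n + 1))) (i : Fin (n + 1)) :
    ∃ τ : Equiv.Perm (Fin n), ∀ p : Fin (n + 1) → Plane,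
      i.removeNth (p ∘ σ) = (σ i).removeNth p ∘ τ := by
  have hne : ∀ k : Fin n, σ (i.succAbove k) ≠ σ i := fun k h =>
    Fin.succAbove_ne i k (σ.injective h)
  choose t ht using fun k => Fin.exists_succAbove_eq (hne k)
  have hinj : Function.Injective t := fun a b hab => by
    have := (ht a).symm.trans ((congrArg _ hab).trans (ht b))
    exact Fin.succAbove_right_injective (σ.injective this)
  refine ⟨Equiv.ofBijective t (Finite.injective_iff_bijective.1 hinj), fun p => ?_⟩
  ext1 k
  simp [Fin.removeNth, ht]

/-- The operator `A₊^ε` from the `n`-th to the `(n+1)`-st component of the Fock space,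
`(A₊^ε f)(p_{1:n+1}) = -(1/(n+1)) (λ̂/√(log(1/ε))) ∑_i (p_i × ∑_j p_j) f(p_{1:n+1 \ i})`. -/
def aPlus (ρ : Mollifier) (lhat ε : ℝ) (n : ℕ) : Fock ρ ε n →L[ℂ] Fock ρ ε (n + 1) :=
  ((aPlusFull ρ lhat ε n).comp (Fock ρ ε n).subtypeL).codRestrict (Fock ρ ε (n + 1))
    fun φ σ => by
      have h0 := coeFn_aPlusFull ρ lhat ε n (φ : Lp ℂ 2 (fockMeasure ρ ε n))
      have h4 : ∀ᵐ p ∂(fockMeasure ρ ε (n + 1)), ∀ (i : Fin (n + 1)) (τ : Equiv.Perm (Fin n)),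
          (φ : Lp ℂ 2 (fockMeasure ρ ε n)) (i.removeNth p ∘ τ) =
            (φ : Lp ℂ 2 (fockMeasure ρ ε n)) (i.removeNth p) :=
        ae_all_iff.2 fun i => ae_all_iff.2 fun τ =>
          (removeNth_quasi ρ ε n i).ae (φ.2 τ)
      filter_upwards [h0, (perm_measurePreserving ρ ε (n + 1) σ).quasiMeasurePreserving.ae h0,
        h4] with p h1 h2 h3
      refine h2.trans (Eq.trans ?_ h1.symm)
      congr 1
      rw [← Equiv.sum_comp σ fun i => ((cross (p i) (∑ j, p j) : ℝ) : ℂ) *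
        (φ : Lp ℂ 2 (fockMeasure ρ ε n)) (i.removeNth p)]
      refine Finset.sum_congr rfl fun i _ => ?_
      obtain ⟨τ, hτ⟩ := removeNth_perm σ i
      rw [hτ, h3, Function.comp_apply, ← Equiv.sum_comp σ p]
      rfl

theorem coeFn_aPlus (ρ : Mollifier) (lhat ε : ℝ) (n : ℕ) (φ : Fock ρ ε n) :
    (aPlus ρ lhat ε n φ : Lp ℂ 2 (fockMeasure ρ ε (n + 1))) =ᵐ[fockMeasure ρ ε (n + 1)]
      fun p => ((-(1 / (n + 1) * (lhat / √(Real.log (1 / ε)))) : ℝ) : ℂ) *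
        ∑ i, ((cross (p i) (∑ j, p j) : ℝ) : ℂ) *
          (φ : Lp ℂ 2 (fockMeasure ρ ε n)) (i.removeNth p) :=
  coeFn_aPlusFull ρ lhat ε n _

/-! ### The recursively defined operators and their approximation -/

/-- The operators `H_1 = 0`, `H_{j+1} = (A₊)* (λ - L₀ + H_j)⁻¹ A₊`, each of them acting on every
component of the Fock space.  (The index `0` is not used.)  `Ring.inverse` is the inverse in the
algebra of bounded operators. -/
def opH (ρ : Mollifier) (lhat ν lam ε : ℝ) : ℕ → (n : ℕ) → (Fock ρ ε n →L[ℂ] Fock ρ ε n)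
  | 0, _ => 0
  | 1, _ => 0
  | j + 2, n =>
    (ContinuousLinearMap.adjoint (aPlus ρ lhat ε n)).comp
      ((Ring.inverse ((lam : ℂ) • ContinuousLinearMap.id ℂ (Fock ρ ε (n + 1)) -
        opL0 ρ ε ν (n + 1) + opH ρ lhat ν lam ε (j + 1) (n + 1))).comp (aPlus ρ lhat ε n))

/-- The functions `G_1 = 0`, `G_{j+1}(x) = ∫_0^x (1 + (4/ν⁴) G_j(y))⁻¹ dy`, used for `x ≥ 0`.
(The index `0` is not used.) -/
def funG (ν : ℝ) : ℕ → ℝ → ℝ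
  | 0, _ => 0
  | 1, _ => 0
  | j + 2, x => ∫ y in (0 : ℝ)..x, 1 / (1 + 4 / ν ^ 4 * funG ν (j + 1) y)

/-- `L^ε(x) = (π λ̂² / |log ε²|) log(1 + 1/(ε² x))`, for `x > 0`. -/
def funL (lhat ε x : ℝ) : ℝ :=
  Real.pi * lhat ^ 2 / |Real.log (ε ^ 2)| * Real.log (1 + 1 / (ε ^ 2 * x))

theorem funG_nonneg_continuousOn (ν : ℝ) (j : ℕ) :
    (∀ x, 0 ≤ x → 0 ≤ funG ν j x) ∧ ContinuousOn (funG ν j) (Ici 0) := by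
  induction j using Nat.strong_induction_on with
  | _ j ih =>
    match j, ih with
    | 0, _ => exact ⟨fun x _ => le_rfl, continuousOn_const⟩
    | 1, _ => exact ⟨fun x _ => le_rfl, continuousOn_const⟩
    | j + 2, ih =>
      obtain ⟨h1, h2⟩ := ih (j + 1) (by omega)
      have hpos : ∀ y, 0 ≤ y → 0 < 1 + 4 / ν ^ 4 * funG ν (j + 1) y := fun y hy => by
        have := h1 y hy; positivity
      have hc : ContinuousOn (fun y => 1 / (1 + 4 / ν ^ 4 * funG ν (j + 1) y)) (Ici 0) :=
        continuousOn_const.div (continuousOn_const.add (continuousOn_const.mul h2))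
          fun y hy => (hpos y hy).ne'
      refine ⟨fun x hx => ?_, fun x hx => ?_⟩
      · exact intervalIntegral.integral_nonneg hx fun y hy =>
          one_div_nonneg.2 (hpos y hy.1).le
      · have hx0 : (0 : ℝ) ≤ x := hx
        have hint : IntervalIntegrable (fun y => 1 / (1 + 4 / ν ^ 4 * funG ν (j + 1) y))
            volume 0 (x + 1) :=
          (hc.mono (by rw [uIcc_of_le (by linarith)]; exact fun y hy => hy.1)).intervalIntegrable
        have hon := intervalIntegral.continuousOn_primitive_interval' hint left_mem_uIcc
        rw [uIcc_of_le (by linarith)] at hon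
        refine (hon x ⟨hx0, by linarith⟩).mono_of_mem_nhdsWithin ?_
        rw [← Ici_inter_Iic]
        exact inter_mem_nhdsWithin _ (Iic_mem_nhds (by linarith))

theorem funG_funL_continuousOn (ν lhat ε : ℝ) {lam : ℝ} (hlam : 0 < lam) (j : ℕ) :
    ContinuousOn (fun t => funG ν j (funL lhat ε (lam + t))) (Ici 0) := by
  refine (funG_nonneg_continuousOn ν j).2.comp ?_ ?_
  · rcases eq_or_ne ε 0 with rfl | hε
    · simp only [funL]; simp; exact continuousOn_const
    · have hp : ∀ t ∈ Ici (0 : ℝ), 0 < ε ^ 2 * (lam + t) := fun t ht => by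
        have : (0 : ℝ) ≤ t := ht
        positivity
      unfold funL
      refine continuousOn_const.mul (ContinuousOn.log ?_ fun t ht => ?_)
      · exact continuousOn_const.add (continuousOn_const.div (by fun_prop)
          fun t ht => (hp t ht).ne')
      · have := one_div_pos.2 (hp t ht)
        positivity
  · intro t ht
    have h0 : (0 : ℝ) ≤ t := ht
    have : 0 ≤ Real.log (1 + 1 / (ε ^ 2 * (lam + t))) := by
      apply Real.log_nonneg
      have : 0 ≤ 1 / (ε ^ 2 * (lam + t)) := by positivity
      linarith
    simp only [funL, mem_Ici]
    positivity

/-- The diagonal operator `G_j(L^ε(λ - L₀))`. -/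
def opG (ρ : Mollifier) (lhat ν : ℝ) {lam : ℝ} (hlam : 0 < lam) (ε : ℝ) (j n : ℕ) :
    Fock ρ ε n →L[ℂ] Fock ρ ε n :=
  diagOp ρ ε ν n (fun t => funG ν j (funL lhat ε (lam + t)))
    (funG_funL_continuousOn ν lhat ε hlam j)

end WeakCoupling

end

open WeakCoupling

noncomputable section

namespace WeakCoupling

/-! ### The functions `G_j` -/

section FunG

/-! Write T_j = λ - L₀ + H_j and E_j = H_j + (4/ν⁴) G_j(L^ε(λ - L₀)) L₀, and let S_j be the diagonal
operator with symbol `resolventSymbol`, so that T_j S_j = 1 + E_j S_j. The resolvent identity gives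
⟨φ₁, H_{j+1} φ₂⟩ = ⟨A₊φ₁, S_j A₊φ₂⟩ - ⟨T_j⁻¹ A₊φ₁, E_j S_j A₊φ₂⟩. The last term is estimated by
induction on j, one chaos higher. Since H_j ≥ 0, the (-L₀)^{1/2}-seminorms of T_j⁻¹ A₊φ and S_j A₊φ
are at most the norm of (λ - L₀)^{-1/2} A₊φ, which `exists_norm_inv_sqrt_aPlus_le` bounds by that of
(-L₀)^{1/2} φ uniformly in ε.

There remains an explicit form: A₊* S_j A₊ equals -(4/ν⁴) G_{j+1}(L^ε(λ - L₀)) L₀ up to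
O(1/log(1/ε)) relative to -L₀ (`exists_form_bound`). Expanding both A₊ gives a double sum over the
inserted momenta.

Equal indices give multiplication by λ̂²/log(1/ε) times `diagonalSymbol` at the total momentum p.
With x the argument of L^ε, three replacements make its integrand computable: the resolvent by
u_j(x)/x, then |q+p|² by |q|² + |p|², then the cutoff by 1/(1+ε²x). Each error integrates to
O(|p|²), so it is small after the prefactor (`exists_diagonalSymbol_bound`). What is left is exact
(`radial_integral`): (q×p)²/|q|² averages to |p|²/2 over angles, and the radial integrand is a
constant times the derivative of G_{j+1}(L^ε), because L^ε has derivative -const/(x(1+ε²x)). This is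
where the recursion for G_j comes from.

Distinct indices produce no logarithm: a Schur test bounds them by -L₀ uniformly in ε
(`offDiagonal_le`, `lintegral_schurWeight_le`), so the prefactor makes them small as well. -/

theorem funG_succ (ν : ℝ) {j : ℕ} (hj : 1 ≤ j) (x : ℝ) :
    funG ν (j + 1) x = ∫ y in (0 : ℝ)..x, 1 / (1 + 4 / ν ^ 4 * funG ν j y) := by
  obtain ⟨k, rfl⟩ : ∃ k, j = k + 1 := ⟨j - 1, by omega⟩
  rfl

theorem funG_nonneg (ν : ℝ) (j : ℕ) {x : ℝ} (hx : 0 ≤ x) : 0 ≤ funG ν j x :=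
  (funG_nonneg_continuousOn ν j).1 x hx

theorem one_le_one_add_funG (ν : ℝ) (j : ℕ) {x : ℝ} (hx : 0 ≤ x) :
    1 ≤ 1 + 4 / ν ^ 4 * funG ν j x := by
  have := funG_nonneg ν j hx
  have : 0 ≤ 4 / ν ^ 4 * funG ν j x := by positivity
  linarith

theorem funG_zero_right (ν : ℝ) : ∀ j, funG ν j 0 = 0
  | 0 => rfl
  | 1 => rfl
  | j + 2 => by rw [funG_succ ν (by omega)]; simp

theorem hasDerivWithinAt_funG (ν : ℝ) {j : ℕ} (hj : 1 ≤ j) {x : ℝ} (hx : 0 ≤ x) :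
    HasDerivWithinAt (funG ν (j + 1)) (1 / (1 + 4 / ν ^ 4 * funG ν j x)) (Ici 0) x := by
  -- Freezing the integrand at its value at 0 for negative arguments makes it continuous on ℝ, so
  -- the two-sided fundamental theorem of calculus applies even at x = 0.
  set f : ℝ → ℝ := fun y => 1 / (1 + 4 / ν ^ 4 * funG ν j (max y 0)) with hf
  have hc : Continuous f := by
    have h1 : Continuous fun y : ℝ => funG ν j (max y 0) :=
      (funG_nonneg_continuousOn ν j).2.comp_continuous (by fun_prop) fun y => mem_Ici.2 (le_max_right _ _)
    refine continuous_const.div (by fun_prop) fun y => ?_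
    have := one_le_one_add_funG ν j (le_max_right y 0)
    positivity
  have hd := (intervalIntegral.integral_hasDerivAt_right (hc.intervalIntegrable 0 x)
    hc.stronglyMeasurable.stronglyMeasurableAtFilter hc.continuousAt).hasDerivWithinAt
    (s := Ici (0 : ℝ))
  have hfx : f x = 1 / (1 + 4 / ν ^ 4 * funG ν j x) := by simp only [hf, max_eq_left hx]
  rw [hfx] at hd
  have hE : ∀ y ∈ Ici (0 : ℝ), funG ν (j + 1) y = ∫ z in (0 : ℝ)..y, f z := by
    intro y hy
    rw [funG_succ ν hj]
    refine intervalIntegral.integral_congr fun z hz => ?_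
    rw [uIcc_of_le hy] at hz
    simp only [hf, max_eq_left hz.1]
  exact hd.congr hE (hE x hx)

theorem derivWithin_funG (ν : ℝ) {j : ℕ} (hj : 1 ≤ j) {x : ℝ} (hx : 0 ≤ x) :
    derivWithin (funG ν (j + 1)) (Ici 0) x = 1 / (1 + 4 / ν ^ 4 * funG ν j x) :=
  (hasDerivWithinAt_funG ν hj hx).derivWithin (uniqueDiffOn_Ici 0 x hx)

theorem funG_one (ν : ℝ) : funG ν 1 = fun _ => 0 := rfl

theorem contDiffOn_funG (ν : ℝ) {j : ℕ} (hj : 1 ≤ j) : ContDiffOn ℝ 2 (funG ν j) (Ici 0) := by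
  induction j, hj using Nat.le_induction with
  | base => rw [funG_one]; exact contDiffOn_const
  | succ j hj ih =>
    rw [show (2 : WithTop ℕ∞) = 1 + 1 by norm_num,
      contDiffOn_succ_iff_derivWithin (uniqueDiffOn_Ici 0)]
    refine ⟨fun x hx => (hasDerivWithinAt_funG ν hj hx).differentiableWithinAt, by simp, ?_⟩
    have h1 : ContDiffOn ℝ 1 (fun x => 1 / (1 + 4 / ν ^ 4 * funG ν j x)) (Ici 0) := by
      refine contDiffOn_const.div (contDiffOn_const.add (contDiffOn_const.mul
        (ih.of_le (by norm_num)))) fun x hx => ?_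
      have := one_le_one_add_funG ν j hx
      positivity
    exact h1.congr fun x hx => derivWithin_funG ν hj hx

theorem abs_derivWithin_funG_le (ν : ℝ) {j : ℕ} (hj : 1 ≤ j) {x : ℝ} (hx : 0 ≤ x) :
    |derivWithin (funG ν j) (Ici 0) x| ≤ 1 := by
  obtain ⟨k, rfl⟩ : ∃ k, j = k + 1 := ⟨j - 1, by omega⟩
  rcases Nat.eq_zero_or_pos k with rfl | hk
  · rw [funG_one]; simp
  · rw [derivWithin_funG ν hk hx]
    have := one_le_one_add_funG ν k hx
    rw [abs_of_nonneg (by positivity)]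
    exact (div_le_one (by linarith)).2 this

theorem abs_funG_sub_le (ν : ℝ) {j : ℕ} (hj : 1 ≤ j) {x y : ℝ} (hx : 0 ≤ x) (hy : 0 ≤ y) :
    |funG ν j x - funG ν j y| ≤ |x - y| := by
  have := (convex_Ici (0 : ℝ)).norm_image_sub_le_of_norm_derivWithin_le (f := funG ν j) (C := 1)
    ((contDiffOn_funG ν hj).differentiableOn (by norm_num))
    (fun z hz => abs_derivWithin_funG_le ν hj hz) hy hx
  simpa using this

theorem abs_funG_le (ν : ℝ) {j : ℕ} (hj : 1 ≤ j) {x : ℝ} (hx : 0 ≤ x) : |funG ν j x| ≤ x := by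
  have := abs_funG_sub_le ν hj hx le_rfl
  simpa [funG_zero_right, abs_of_nonneg hx] using this

/-- G_{k+1}'' = -(4/ν⁴) G_k' / (1 + (4/ν⁴) G_k)², with |G_k'| ≤ 1 and a denominator at least 1. -/
theorem abs_iteratedDerivWithin_funG_le (ν : ℝ) {j : ℕ} (hj : 1 ≤ j) {x : ℝ} (hx : 0 ≤ x) :
    |iteratedDerivWithin 2 (funG ν j) (Ici 0) x| ≤ 4 / ν ^ 4 := by
  have h2 : iteratedDerivWithin 2 (funG ν j) (Ici 0) x =
      derivWithin (derivWithin (funG ν j) (Ici 0)) (Ici 0) x := by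
    rw [show 2 = 1 + 1 by norm_num, iteratedDerivWithin_succ, iteratedDerivWithin_one]
  rw [h2]
  obtain ⟨k, rfl⟩ : ∃ k, j = k + 1 := ⟨j - 1, by omega⟩
  rcases Nat.eq_zero_or_pos k with rfl | hk
  · rw [funG_one]; simp; positivity
  · rw [derivWithin_congr (f := fun y => 1 / (1 + 4 / ν ^ 4 * funG ν k y))
      (fun y (hy : y ∈ Ici 0) => derivWithin_funG ν hk hy) (derivWithin_funG ν hk hx)]
    have h1 := one_le_one_add_funG ν k hx
    have hd : HasDerivWithinAt (funG ν k) (derivWithin (funG ν k) (Ici 0) x) (Ici 0) x :=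
      ((contDiffOn_funG ν hk).differentiableOn (by norm_num) x hx).hasDerivWithinAt
    have hd2 := ((hd.const_mul (4 / ν ^ 4)).const_add 1).fun_inv (by positivity)
    simp only [one_div]
    rw [hd2.derivWithin (uniqueDiffOn_Ici 0 x hx), abs_div, abs_neg, abs_mul,
      abs_of_nonneg (by positivity : 0 ≤ 4 / ν ^ 4),
      abs_sq]
    refine div_le_of_le_mul₀ (by positivity) (by positivity) ?_
    have h3 := abs_derivWithin_funG_le ν hk hx
    have h4 : 1 ≤ (1 + 4 / ν ^ 4 * funG ν k x) ^ 2 := one_le_pow₀ h1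
    have h5 : 0 ≤ 4 / ν ^ 4 := by positivity
    gcongr
    linarith

end FunG

/-! ### The symbols -/

section Symbols

/-- `u_j(x) = 1 / (1 + (4/ν⁴) G_j(L^ε(x)))`. -/
def damping (lhat ν ε : ℝ) (j : ℕ) (x : ℝ) : ℝ :=
  1 / (1 + 4 / ν ^ 4 * funG ν j (funL lhat ε x))

theorem funL_nonneg (lhat ε : ℝ) {x : ℝ} (hx : 0 < x) : 0 ≤ funL lhat ε x := by
  have : 0 ≤ Real.log (1 + 1 / (ε ^ 2 * x)) := by
    apply Real.log_nonneg
    have : 0 ≤ 1 / (ε ^ 2 * x) := by positivity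
    linarith
  unfold funL
  positivity

theorem damping_pos (lhat ν ε : ℝ) (j : ℕ) {x : ℝ} (hx : 0 < x) : 0 < damping lhat ν ε j x := by
  have := one_le_one_add_funG ν j (funL_nonneg lhat ε hx)
  unfold damping; positivity

theorem damping_le_one (lhat ν ε : ℝ) (j : ℕ) {x : ℝ} (hx : 0 < x) :
    damping lhat ν ε j x ≤ 1 := by
  have := one_le_one_add_funG ν j (funL_nonneg lhat ε hx)
  unfold damping
  exact (div_le_one (by linarith)).2 this

theorem abs_log_sq {ε : ℝ} (h0 : 0 < ε) (h1 : ε < 1) :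
    |Real.log (ε ^ 2)| = 2 * Real.log (1 / ε) := by
  have := Real.log_neg h0 h1
  rw [Real.log_pow, one_div, Real.log_inv, abs_of_nonpos]
  · push_cast; ring
  · push_cast; linarith

theorem log_two_le_log_inv {ε : ℝ} (h0 : 0 < ε) (h1 : ε < 1 / 2) :
    Real.log 2 ≤ Real.log (1 / ε) := by
  apply Real.log_le_log (by norm_num)
  rw [le_div_iff₀ h0]; linarith

/-- The factor 1/(1+ε²x) in this derivative later plays the role of the ultraviolet cutoff in the
exactly solvable radial integral. -/
theorem hasDerivAt_funL (lhat : ℝ) {ε x : ℝ} (hε : 0 < ε) (hx : 0 < x) :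
    HasDerivAt (funL lhat ε)
      (-(Real.pi * lhat ^ 2 / |Real.log (ε ^ 2)| * (1 / (x * (1 + ε ^ 2 * x))))) x := by
  have h1 : HasDerivAt (fun x => 1 + 1 / (ε ^ 2 * x)) (-(ε ^ 2) / (ε ^ 2 * x) ^ 2) x := by
    have := (((hasDerivAt_id x).const_mul (ε ^ 2)).inv (by simpa using ⟨hε.ne', hx.ne'⟩)).const_add 1
    simpa [one_div] using this
  have h2 := (h1.log (by positivity)).const_mul (Real.pi * lhat ^ 2 / |Real.log (ε ^ 2)|)
  refine h2.congr_deriv ?_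
  rw [← mul_neg]
  congr 1
  field_simp
  ring

/-- This is log r ≤ r - 1. The right side is kept as (1/x - 1/y) y so that division by y leaves a
multiple of 1/x - 1/y. -/
theorem abs_funL_sub_le (lhat : ℝ) {ε x y : ℝ} (hε : 0 < ε) (hx : 0 < x) (hxy : x ≤ y) :
    |funL lhat ε x - funL lhat ε y| ≤
      Real.pi * lhat ^ 2 / |Real.log (ε ^ 2)| * ((1 / x - 1 / y) * y) := by
  have hy : 0 < y := hx.trans_le hxy
  unfold funL
  rw [← mul_sub, abs_mul, abs_of_nonneg (by positivity :
    0 ≤ Real.pi * lhat ^ 2 / |Real.log (ε ^ 2)|)]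
  gcongr
  have hle : 1 / (ε ^ 2 * y) ≤ 1 / (ε ^ 2 * x) := by gcongr
  rw [← Real.log_div (by positivity) (by positivity), abs_of_nonneg]
  · refine (Real.log_le_sub_one_of_pos (by positivity)).trans ?_
    rw [div_sub_one (by positivity), div_le_iff₀ (by positivity)]
    have h3 : 0 ≤ 1 / x - 1 / y := sub_nonneg.2 (by gcongr)
    have h4 : (1 / x - 1 / y) * y * (1 + 1 / (ε ^ 2 * y)) - (1 + 1 / (ε ^ 2 * x) -
      (1 + 1 / (ε ^ 2 * y))) = (1 / x - 1 / y) * y := by field_simp; ring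
    have h5 := mul_nonneg h3 hy.le
    linarith
  · apply Real.log_nonneg
    rw [le_div_iff₀ (by positivity)]
    linarith

/-- The Lipschitz constant of `1/x ↦ u_j(x)/x`, uniform in `ε < 1/2`. -/
def lipConst (lhat ν : ℝ) : ℝ := 1 + 4 / ν ^ 4 * (Real.pi * lhat ^ 2 / (2 * Real.log 2))

theorem one_le_lipConst (lhat ν : ℝ) : 1 ≤ lipConst lhat ν := by
  have := Real.log_pos (by norm_num : (1 : ℝ) < 2)
  have : 0 ≤ 4 / ν ^ 4 * (Real.pi * lhat ^ 2 / (2 * Real.log 2)) := by positivity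
  unfold lipConst; linarith

/-- Reduces a change of argument in u_j(x)/x to the undamped case 1/x. Uniformity in ε holds because
log(1/ε) ≥ log 2 bounds the constant in front of the logarithm in L^ε. -/
theorem abs_damping_div_sub_le_of_le (lhat ν : ℝ) {ε : ℝ} (h0 : 0 < ε) (h1 : ε < 1 / 2) {j : ℕ}
    (hj : 1 ≤ j) {x y : ℝ} (hx : 0 < x) (hxy : x ≤ y) :
    |damping lhat ν ε j x / x - damping lhat ν ε j y / y| ≤
      lipConst lhat ν * |1 / x - 1 / y| := by
  have hy : 0 < y := hx.trans_le hxy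
  have hl2 := Real.log_pos (by norm_num : (1 : ℝ) < 2)
  have h3 : 0 ≤ 1 / x - 1 / y := sub_nonneg.2 (by gcongr)
  set u := damping lhat ν ε j x with hu
  set w := damping lhat ν ε j y with hw
  have hu0 := damping_pos lhat ν ε j hx
  have hu1 := damping_le_one lhat ν ε j hx
  have hgx := one_le_one_add_funG ν j (funL_nonneg lhat ε hx)
  have hgy := one_le_one_add_funG ν j (funL_nonneg lhat ε hy)
  have hdiff : |u - w| ≤ 4 / ν ^ 4 * |funL lhat ε x - funL lhat ε y| := by
    have hg := abs_funG_sub_le ν hj (funL_nonneg lhat ε hx) (funL_nonneg lhat ε hy)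
    rw [hu, hw]
    unfold damping
    rw [div_sub_div _ _ (by positivity) (by positivity), abs_div,
      abs_of_pos (by positivity : 0 < (1 + 4 / ν ^ 4 * funG ν j (funL lhat ε x)) *
        (1 + 4 / ν ^ 4 * funG ν j (funL lhat ε y)))]
    refine div_le_of_le_mul₀ (by positivity) (by positivity) ?_
    have e : 1 * (1 + 4 / ν ^ 4 * funG ν j (funL lhat ε y)) -
        (1 + 4 / ν ^ 4 * funG ν j (funL lhat ε x)) * 1 =
        -(4 / ν ^ 4 * (funG ν j (funL lhat ε x) - funG ν j (funL lhat ε y))) := by ring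
    rw [e, abs_neg, abs_mul, abs_of_nonneg (by positivity : 0 ≤ 4 / ν ^ 4)]
    calc _ ≤ 4 / ν ^ 4 * |funL lhat ε x - funL lhat ε y| * 1 := by rw [mul_one]; gcongr
      _ ≤ _ := mul_le_mul_of_nonneg_left (one_le_mul_of_one_le_of_one_le hgx hgy)
          (by positivity)
  have hL := abs_funL_sub_le lhat h0 hx hxy
  rw [abs_log_sq h0 (by linarith)] at hL
  have hlog := log_two_le_log_inv h0 h1
  have hL2 : |funL lhat ε x - funL lhat ε y| ≤
      Real.pi * lhat ^ 2 / (2 * Real.log 2) * ((1 / x - 1 / y) * y) := by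
    refine hL.trans ?_
    have := mul_nonneg h3 hy.le
    gcongr
  -- The first summand uses u ≤ 1; in the second, |u - w| is controlled by the Lipschitz bounds for
  -- G_j and L^ε.
  have e : u / x - w / y = (1 / x - 1 / y) * u + (u - w) / y := by field_simp; ring
  rw [e]
  refine (abs_add_le _ _).trans ?_
  rw [abs_mul, abs_of_pos hu0, abs_div, abs_of_pos hy, abs_of_nonneg h3]
  have h5 : |u - w| / y ≤ 4 / ν ^ 4 * (Real.pi * lhat ^ 2 / (2 * Real.log 2)) *
      (1 / x - 1 / y) := by
    rw [div_le_iff₀ hy]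
    refine hdiff.trans ?_
    calc _ ≤ 4 / ν ^ 4 * (Real.pi * lhat ^ 2 / (2 * Real.log 2) * ((1 / x - 1 / y) * y)) := by
          gcongr
      _ = _ := by ring
  have h6 := mul_le_mul_of_nonneg_left hu1 h3
  unfold lipConst
  linarith

theorem abs_damping_div_sub_le (lhat ν : ℝ) {ε : ℝ} (h0 : 0 < ε) (h1 : ε < 1 / 2) {j : ℕ}
    (hj : 1 ≤ j) {x y : ℝ} (hx : 0 < x) (hy : 0 < y) :
    |damping lhat ν ε j x / x - damping lhat ν ε j y / y| ≤
      lipConst lhat ν * |1 / x - 1 / y| := by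
  rcases le_total x y with h | h
  · exact abs_damping_div_sub_le_of_le lhat ν h0 h1 hj hx h
  · rw [abs_sub_comm, abs_sub_comm (1 / x)]
    exact abs_damping_div_sub_le_of_le lhat ν h0 h1 hj hy h

/-- The symbol of `(λ - L₀ + (4/ν⁴) G_j(L^ε(λ - L₀)) (-L₀))⁻¹`. -/
def resolventSymbol (lhat ν lam ε : ℝ) (j : ℕ) (t : ℝ) : ℝ :=
  1 / (lam + t * (1 + 4 / ν ^ 4 * funG ν j (funL lhat ε (lam + t))))

theorem resolventSymbol_nonneg (lhat ν ε : ℝ) {lam : ℝ} (hlam : 0 < lam) (j : ℕ) {t : ℝ}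
    (ht : 0 ≤ t) : 0 ≤ resolventSymbol lhat ν lam ε j t := by
  have := one_le_one_add_funG ν j (funL_nonneg lhat ε (by linarith : 0 < lam + t))
  unfold resolventSymbol; positivity

theorem resolventSymbol_le (lhat ν ε : ℝ) {lam : ℝ} (hlam : 0 < lam) (j : ℕ) {t : ℝ}
    (ht : 0 ≤ t) : resolventSymbol lhat ν lam ε j t ≤ 1 / (lam + t) := by
  have := one_le_one_add_funG ν j (funL_nonneg lhat ε (by linarith : 0 < lam + t))
  unfold resolventSymbol
  gcongr
  nlinarith

/-- With b = 1 + (4/ν⁴) G_j, this moves λ inside the damping, from λ + tb to (λ + t)b. The error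
λ/(λ+t)² with t proportional to |q|² has a planar integral bounded uniformly in λ. -/
theorem abs_resolventSymbol_sub_le (lhat ν ε : ℝ) {lam : ℝ} (hlam : 0 < lam) (j : ℕ) {t : ℝ}
    (ht : 0 ≤ t) :
    |resolventSymbol lhat ν lam ε j t - damping lhat ν ε j (lam + t) / (lam + t)| ≤
      lam / (lam + t) ^ 2 := by
  have h1 := one_le_one_add_funG ν j (funL_nonneg lhat ε (by linarith : 0 < lam + t))
  unfold resolventSymbol damping
  set b := 1 + 4 / ν ^ 4 * funG ν j (funL lhat ε (lam + t))
  have hb : 0 < b := by linarith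
  have hx : 0 < lam + t := by linarith
  have hz : lam + t ≤ lam + t * b := by nlinarith
  have hz0 : 0 < lam + t * b := by linarith
  have e : 1 / (lam + t * b) - 1 / b / (lam + t) =
      lam * ((b - 1) / b) / ((lam + t * b) * (lam + t)) := by field_simp; ring
  have hb1 : 0 ≤ (b - 1) / b := div_nonneg (by linarith) hb.le
  have hb2 : (b - 1) / b ≤ 1 := (div_le_one hb).2 (by linarith)
  rw [e, abs_of_nonneg (by positivity), sq]
  gcongr
  nlinarith

theorem continuousOn_resolventSymbol (lhat ν ε : ℝ) {lam : ℝ} (hlam : 0 < lam) (j : ℕ) :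
    ContinuousOn (resolventSymbol lhat ν lam ε j) (Ici 0) := by
  unfold resolventSymbol
  refine continuousOn_const.div (continuousOn_const.add (continuousOn_id.mul
    (continuousOn_const.add (continuousOn_const.mul
      (funG_funL_continuousOn ν lhat ε hlam j))))) fun t ht => ?_
  have ht0 : (0 : ℝ) ≤ t := ht
  have h1 := one_le_one_add_funG ν j (funL_nonneg lhat ε (by linarith : 0 < lam + t))
  have : 0 ≤ t * (1 + 4 / ν ^ 4 * funG ν j (funL lhat ε (lam + t))) := by positivity
  linarith

/-- log(1 + 1/(ε²x)) is at most log(1 + 1/λ) + 2 log(1/ε), and L^ε divides by 2 log(1/ε) ≥ 2 log 2.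
The bound is therefore uniform in ε. -/
theorem funL_le (lhat : ℝ) {ε lam x : ℝ} (h0 : 0 < ε) (h1 : ε < 1 / 2) (hlam : 0 < lam)
    (hx : lam ≤ x) :
    funL lhat ε x ≤ Real.pi * lhat ^ 2 * (Real.log (1 + 1 / lam) / (2 * Real.log 2) + 1) := by
  have hl2 := Real.log_pos (by norm_num : (1 : ℝ) < 2)
  have hlog := log_two_le_log_inv h0 h1
  have hx0 : 0 < x := hlam.trans_le hx
  have hle : Real.log (1 + 1 / (ε ^ 2 * x)) ≤ Real.log (1 + 1 / lam) + 2 * Real.log (1 / ε) := by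
    rw [show 2 * Real.log (1 / ε) = Real.log ((1 / ε) ^ 2) by rw [Real.log_pow]; simp,
      ← Real.log_mul (by positivity) (by positivity)]
    apply Real.log_le_log (by positivity)
    have e1 : 1 ≤ (1 / ε) ^ 2 := one_le_pow₀ ((one_le_div h0).2 (by linarith))
    have e2 : 1 / (ε ^ 2 * x) ≤ 1 / lam * (1 / ε) ^ 2 := by
      calc 1 / (ε ^ 2 * x) ≤ 1 / (ε ^ 2 * lam) := by gcongr
        _ = _ := by field_simp
    linarith
  have hl0 : 0 ≤ Real.log (1 + 1 / lam) := Real.log_nonneg (by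
    have : 0 ≤ 1 / lam := by positivity
    linarith)
  unfold funL
  rw [abs_log_sq h0 (by linarith), div_mul_eq_mul_div, mul_div_assoc]
  gcongr
  calc _ ≤ (Real.log (1 + 1 / lam) + 2 * Real.log (1 / ε)) / (2 * Real.log (1 / ε)) := by
        gcongr; linarith
    _ = Real.log (1 + 1 / lam) / (2 * Real.log (1 / ε)) + 1 := by
        rw [add_div, div_self (by linarith)]
    _ ≤ _ := by gcongr

end Symbols

/-! ### An integral kernel on the plane -/

section Kernel

/-- The kernel `t / (s max(s,t)²)`. -/
def schurKernel (s t : ℝ) : ℝ := t / (s * max s t ^ 2)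

theorem schurKernel_nonneg {s t : ℝ} (hs : 0 ≤ s) (ht : 0 ≤ t) : 0 ≤ schurKernel s t := by
  unfold schurKernel; positivity

theorem integral_norm_plane (f : ℝ → ℝ) :
    ∫ q : Plane, f ‖q‖ = 2 * Real.pi * ∫ y in Ioi (0 : ℝ), y * f y := by
  have hb : (volume : Measure Plane).real (Metric.ball 0 1) = Real.pi := by
    simp [Measure.real, Real.pi_nonneg]
  rw [integral_fun_norm_addHaar, hb]
  simp [mul_assoc]

theorem integrable_norm_plane_iff {f : ℝ → ℝ} :
    Integrable (fun q : Plane => f ‖q‖) ↔ IntegrableOn (fun y => y * f y) (Ioi 0) := by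
  rw [integrable_fun_norm_addHaar]
  simp

/-- After multiplication by y the kernel is 1/t on (0, t] and t/y² beyond, and each piece integrates
to 1. The total does not depend on t, which is what makes one kernel serve the scales √λ, |p| and
1/ε. -/
theorem schurKernel_radial {t : ℝ} (ht : 0 < t) :
    IntegrableOn (fun y => y * schurKernel y t) (Ioi 0) ∧
      ∫ y in Ioi (0 : ℝ), y * schurKernel y t = 2 := by
  have e1 : EqOn (fun y => y * schurKernel y t) (fun _ => 1 / t) (Ioc 0 t) := by
    intro y hy
    have := hy.1
    simp only [schurKernel, max_eq_right hy.2]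
    field_simp
  have e2 : EqOn (fun y => y * schurKernel y t) (fun y => t * y ^ (-2 : ℝ)) (Ioi t) := by
    intro y hy
    have hy' : t < y := hy
    have : 0 < y := ht.trans hy
    simp only [schurKernel, max_eq_left hy'.le]
    rw [Real.rpow_neg this.le, show ((2 : ℝ)) = ((2 : ℕ) : ℝ) by norm_num, Real.rpow_natCast]
    field_simp
  have i1 : IntegrableOn (fun y => y * schurKernel y t) (Ioc 0 t) :=
    (integrableOn_congr_fun e1 measurableSet_Ioc).2 (integrableOn_const (by simp))
  have i2 : IntegrableOn (fun y => y * schurKernel y t) (Ioi t) :=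
    (integrableOn_congr_fun e2 measurableSet_Ioi).2
      ((integrableOn_Ioi_rpow_of_lt (by norm_num) ht).const_mul _)
  rw [← Ioc_union_Ioi_eq_Ioi ht.le]
  refine ⟨i1.union i2, ?_⟩
  rw [setIntegral_union (Ioc_disjoint_Ioi le_rfl) measurableSet_Ioi i1 i2,
    setIntegral_congr_fun measurableSet_Ioc e1, setIntegral_congr_fun measurableSet_Ioi e2,
    integral_const_mul, integral_Ioi_rpow_of_lt (by norm_num) ht]
  norm_num [Real.rpow_neg ht.le, ht.ne', ht.le]

theorem integrable_schurKernel {t : ℝ} (ht : 0 ≤ t) (z : Plane) :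
    Integrable fun q : Plane => schurKernel ‖q + z‖ t := by
  rcases ht.eq_or_lt with rfl | ht
  · simp [schurKernel]
  · exact (integrable_norm_plane_iff.2 (schurKernel_radial ht).1).comp_add_right z

theorem integral_schurKernel_le {t : ℝ} (ht : 0 ≤ t) (z : Plane) :
    ∫ q : Plane, schurKernel ‖q + z‖ t ≤ 4 * Real.pi := by
  rcases ht.eq_or_lt with rfl | ht
  · simp [schurKernel]; positivity
  · rw [integral_add_right_eq_self (fun q : Plane => schurKernel ‖q‖ t),
      integral_norm_plane fun s => schurKernel s t, (schurKernel_radial ht).2]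
    linarith

theorem lintegral_schurKernel_le {t : ℝ} (ht : 0 ≤ t) (z : Plane) :
    ∫⁻ q : Plane, ENNReal.ofReal (schurKernel ‖q + z‖ t) ≤ ENNReal.ofReal (4 * Real.pi) := by
  rw [← ofReal_integral_eq_lintegral_ofReal (integrable_schurKernel ht z)
    (Eventually.of_forall fun q => schurKernel_nonneg (norm_nonneg _) ht)]
  exact ENNReal.ofReal_le_ofReal (integral_schurKernel_le ht z)

end Kernel

/-! ### Angular averages -/

section Rotation

/-- The rotation of the plane by a right angle. -/
def quarterTurn : Plane ≃ₗᵢ[ℝ] Plane where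
  toFun q := !₂[-q 1, q 0]
  invFun q := !₂[q 1, -q 0]
  map_add' a b := by ext i; fin_cases i <;> simp; ring
  map_smul' c a := by ext i; fin_cases i <;> simp
  left_inv a := by ext i; fin_cases i <;> simp
  right_inv a := by ext i; fin_cases i <;> simp
  norm_map' a := by
    simp [EuclideanSpace.norm_eq, Fin.sum_univ_two, add_comm]

theorem cross_sq_add_cross_quarterTurn_sq (q p : Plane) :
    cross q p ^ 2 + cross (quarterTurn q) p ^ 2 = ‖q‖ ^ 2 * ‖p‖ ^ 2 := by
  have h0 : quarterTurn q 0 = -q 1 := rfl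
  have h1 : quarterTurn q 1 = q 0 := rfl
  simp only [EuclideanSpace.norm_sq_eq, Fin.sum_univ_two, Real.norm_eq_abs, sq_abs, cross, h0, h1]
  ring

theorem cross_sq_div_le (q p : Plane) : cross q p ^ 2 / ‖q‖ ^ 2 ≤ ‖p‖ ^ 2 := by
  refine div_le_of_le_mul₀ (by positivity) (by positivity) ?_
  rw [mul_comm]
  exact cross_sq_le q p

theorem integrable_cross_sq_div_mul {f : ℝ → ℝ} (hf : Integrable fun q : Plane => f ‖q‖)
    (p : Plane) : Integrable fun q : Plane => cross q p ^ 2 / ‖q‖ ^ 2 * f ‖q‖ := by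
  refine hf.bdd_mul (c := ‖p‖ ^ 2) ?_ (Eventually.of_forall fun q => ?_)
  · refine Measurable.aestronglyMeasurable ?_
    unfold cross; fun_prop
  · rw [Real.norm_eq_abs, abs_of_nonneg (by positivity)]
    exact cross_sq_div_le q p

/-- A radial weight is invariant under `quarterTurn`, and the squared cross products of q and of its
quarter turn with p add up to |q|²|p|². Averaging the two integrals gives the factor 1/2 without
polar angles. -/
theorem integral_cross_sq_div_mul {f : ℝ → ℝ} (hf : Integrable fun q : Plane => f ‖q‖)
    (p : Plane) :
    ∫ q : Plane, cross q p ^ 2 / ‖q‖ ^ 2 * f ‖q‖ = ‖p‖ ^ 2 / 2 * ∫ q : Plane, f ‖q‖ := by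
  have hi := integrable_cross_sq_div_mul hf p
  have hmp := quarterTurn.measurePreserving
  have hme : MeasurableEmbedding quarterTurn := quarterTurn.toHomeomorph.measurableEmbedding
  have hrot := hmp.integral_comp hme fun q : Plane => cross q p ^ 2 / ‖q‖ ^ 2 * f ‖q‖
  have hi2 : Integrable fun q : Plane =>
      cross (quarterTurn q) p ^ 2 / ‖quarterTurn q‖ ^ 2 * f ‖quarterTurn q‖ :=
    (hmp.integrable_comp_emb hme).2 hi
  have hsum : ∫ q : Plane, (cross q p ^ 2 / ‖q‖ ^ 2 * f ‖q‖ +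
      cross (quarterTurn q) p ^ 2 / ‖quarterTurn q‖ ^ 2 * f ‖quarterTurn q‖) =
      ∫ q : Plane, ‖p‖ ^ 2 * f ‖q‖ := by
    refine integral_congr_ae ?_
    filter_upwards [compl_mem_ae_iff.2 (measure_singleton (μ := volume) (0 : Plane))] with q hq
    have hq0 : ‖q‖ ≠ 0 := norm_ne_zero_iff.2 hq
    simp only [LinearIsometryEquiv.norm_map]
    rw [← add_mul, ← add_div, cross_sq_add_cross_quarterTurn_sq]
    field_simp
  rw [integral_add hi hi2, hrot, integral_const_mul] at hsum
  linarith

end Rotation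

/-! ### The exact radial integral -/

section Radial

theorem tendsto_funL_atTop (lhat : ℝ) {ε : ℝ} (hε : 0 < ε) :
    Tendsto (funL lhat ε) atTop (𝓝 0) := by
  have h1 : Tendsto (fun x : ℝ => 1 + 1 / (ε ^ 2 * x)) atTop (𝓝 (1 + 0)) := by
    refine tendsto_const_nhds.add ?_
    simp only [one_div]
    exact (tendsto_id.const_mul_atTop (by positivity : 0 < ε ^ 2)).inv_tendsto_atTop
  have h2 := ((Real.continuousAt_log (by norm_num : (1 : ℝ) + 0 ≠ 0)).tendsto.comp h1).const_mul
    (Real.pi * lhat ^ 2 / |Real.log (ε ^ 2)|)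
  rw [add_zero, Real.log_one, mul_zero] at h2
  exact h2

/-- In the radial variable y, the function G_{j+1}(L^ε(x₀ + ν²y²/2)) has derivative -Kν² y f(y),
with f the integrand, and vanishes at infinity. Its value at y = 0 thus evaluates the integral; the
one sign of the derivative also yields integrability. -/
theorem radial_integral (lhat ν : ℝ) {ε x₀ : ℝ} (hlhat : 0 < lhat) (hν : 0 < ν) (h0 : 0 < ε)
    (h1 : ε < 1 / 2) {j : ℕ} (hj : 1 ≤ j) (hx₀ : 0 < x₀) :
    Integrable (fun q : Plane => damping lhat ν ε j (x₀ + ν ^ 2 / 2 * ‖q‖ ^ 2) /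
      (x₀ + ν ^ 2 / 2 * ‖q‖ ^ 2) / (1 + ε ^ 2 * (x₀ + ν ^ 2 / 2 * ‖q‖ ^ 2))) ∧
    lhat ^ 2 / Real.log (1 / ε) *
      ∫ q : Plane, damping lhat ν ε j (x₀ + ν ^ 2 / 2 * ‖q‖ ^ 2) /
        (x₀ + ν ^ 2 / 2 * ‖q‖ ^ 2) / (1 + ε ^ 2 * (x₀ + ν ^ 2 / 2 * ‖q‖ ^ 2)) =
      4 / ν ^ 2 * funG ν (j + 1) (funL lhat ε x₀) := by
  have hlog : 0 < Real.log (1 / ε) :=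
    (Real.log_pos (by norm_num : (1 : ℝ) < 2)).trans_le (log_two_le_log_inv h0 h1)
  set K := Real.pi * lhat ^ 2 / |Real.log (ε ^ 2)| with hK
  have hKe : K = Real.pi * lhat ^ 2 / (2 * Real.log (1 / ε)) := by
    rw [hK, abs_log_sq h0 (by linarith)]
  have hK0 : 0 < K := by rw [hKe]; positivity
  set f : ℝ → ℝ := fun y => damping lhat ν ε j (x₀ + ν ^ 2 / 2 * y ^ 2) /
    (x₀ + ν ^ 2 / 2 * y ^ 2) / (1 + ε ^ 2 * (x₀ + ν ^ 2 / 2 * y ^ 2)) with hf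
  have hxp : ∀ y : ℝ, 0 < x₀ + ν ^ 2 / 2 * y ^ 2 := fun y => by positivity
  have hL0 : ∀ {x : ℝ}, 0 < x → 0 < funL lhat ε x := fun {x} hx => by
    have : 0 < Real.log (1 + 1 / (ε ^ 2 * x)) := by
      apply Real.log_pos
      have : 0 < 1 / (ε ^ 2 * x) := by positivity
      linarith
    exact mul_pos hK0 this
  have hder : ∀ y : ℝ, HasDerivAt
      (fun y => funG ν (j + 1) (funL lhat ε (x₀ + ν ^ 2 / 2 * y ^ 2)))
      (-(K * ν ^ 2) * (y * f y)) y := by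
    intro y
    have hx := hxp y
    have d1 : HasDerivAt (fun y : ℝ => x₀ + ν ^ 2 / 2 * y ^ 2) (ν ^ 2 * y) y := by
      refine (((hasDerivAt_pow 2 y).const_mul (ν ^ 2 / 2)).const_add x₀).congr_deriv ?_
      simp; ring
    have d2 := (hasDerivAt_funL lhat h0 hx).comp y d1
    have d3 := (hasDerivWithinAt_funG ν hj (hL0 hx).le).hasDerivAt (Ici_mem_nhds (hL0 hx))
    refine (d3.comp y d2).congr_deriv ?_
    simp only [hf, damping, ← hK]
    field_simp
  have hlim : Tendsto (fun y => funG ν (j + 1) (funL lhat ε (x₀ + ν ^ 2 / 2 * y ^ 2))) atTop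
      (𝓝 0) := by
    have t1 : Tendsto (fun y : ℝ => x₀ + ν ^ 2 / 2 * y ^ 2) atTop atTop :=
      tendsto_atTop_add_const_left _ _
        ((tendsto_pow_atTop (by norm_num)).const_mul_atTop (by positivity))
    have t2 := (tendsto_funL_atTop lhat h0).comp t1
    refine squeeze_zero (fun y => funG_nonneg ν _ (hL0 (hxp y)).le) (fun y => ?_) t2
    exact (le_abs_self _).trans (abs_funG_le ν (by omega) (hL0 (hxp y)).le)
  have hf0 : ∀ y, 0 ≤ f y := fun y => by
    have := damping_pos lhat ν ε j (hxp y)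
    have := hxp y
    simp only [hf]; positivity
  have hneg : ∀ y ∈ Ioi (0 : ℝ), -(K * ν ^ 2) * (y * f y) ≤ 0 := fun y hy => by
    have : 0 ≤ y * f y := mul_nonneg (le_of_lt hy) (hf0 y)
    have : 0 ≤ K * ν ^ 2 * (y * f y) := by positivity
    linarith
  have hint := integrableOn_Ioi_deriv_of_nonpos' (fun y _ => hder y) hneg hlim
  have hval := integral_Ioi_of_hasDerivAt_of_nonpos' (fun y _ => hder y) hneg hlim
  have hne : -(K * ν ^ 2) ≠ 0 := by simp; exact ⟨hK0.ne', hν.ne'⟩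
  refine ⟨integrable_norm_plane_iff.2 ((integrable_const_mul_iff (IsUnit.mk0 _ hne) _).1 hint), ?_⟩
  rw [integral_norm_plane f]
  rw [integral_const_mul] at hval
  simp only [ne_eq, OfNat.ofNat_ne_zero, not_false_eq_true, zero_pow, mul_zero, add_zero] at hval
  have hG : funG ν (j + 1) (funL lhat ε x₀) = K * ν ^ 2 * ∫ y in Ioi (0 : ℝ), y * f y := by
    linarith
  rw [hG, hKe]
  field_simp
  ring

end Radial

/-! ### The Fourier transform of the covariance near the origin -/

section Cutoff

/-- V̂_ε(q) is the real part of ρ̂(εq)². The L¹ norm M of ρ bounds ρ̂, and its first absolute moment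
N is a Lipschitz constant for ρ̂ at 0, where ρ̂ = 1. -/
theorem exists_VHat_bound (ρ : Mollifier) : ∃ B : ℝ, 1 ≤ B ∧ ∀ ε : ℝ, 0 < ε → ∀ q : Plane,
    VHat ρ ε q ≤ B ∧ |VHat ρ ε q - 1| ≤ B * (ε * ‖q‖) := by
  set M := ∫ x, ‖ρ.toSchwartz x‖ with hM
  set N := ∫ x, ‖x‖ * ‖ρ.toSchwartz x‖ with hN
  have hM0 : 0 ≤ M := integral_nonneg fun _ => norm_nonneg _
  have hN0 : 0 ≤ N := integral_nonneg fun _ => by positivity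
  have hNi : Integrable fun x => ‖x‖ * ‖ρ.toSchwartz x‖ := by
    simpa using ρ.toSchwartz.integrable_pow_mul volume 1
  have hz : ∀ k : Plane, ‖planeHat ρ.toSchwartz k‖ ≤ M := planeHat_bound _
  have hz1 : ∀ k : Plane, ‖planeHat ρ.toSchwartz k - 1‖ ≤ N * ‖k‖ := by
    intro k
    have hi : Integrable fun x => (ρ.toSchwartz x : ℂ) := ρ.toSchwartz.integrable.ofReal
    have h1 : (1 : ℂ) = ∫ x, (ρ.toSchwartz x : ℂ) := by
      rw [integral_complex_ofReal, ρ.integral_eq_one]; simp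
    have hi2 : Integrable fun x => Complex.exp (-(Complex.I * ((inner ℝ k x : ℝ) : ℂ))) *
        (ρ.toSchwartz x : ℂ) := by
      refine hi.bdd_mul (c := 1) (Continuous.aestronglyMeasurable (by fun_prop))
        (Eventually.of_forall fun x => ?_)
      rw [Complex.norm_exp]; simp
    rw [h1]
    unfold planeHat
    rw [← integral_sub hi2 hi, hN, ← integral_mul_const]
    refine norm_integral_le_of_norm_le (hNi.mul_const _) (Eventually.of_forall fun x => ?_)
    rw [← sub_one_mul, norm_mul, Complex.norm_real, mul_assoc, mul_comm ‖x‖, mul_assoc,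
      mul_comm ‖ρ.toSchwartz x‖]
    gcongr
    have h2 := Real.norm_exp_I_mul_ofReal_sub_one_le (x := -(inner ℝ k x : ℝ))
    rw [Complex.ofReal_neg, mul_neg, norm_neg] at h2
    exact h2.trans (abs_real_inner_le_norm k x)
  refine ⟨1 + M ^ 2 + N * (M + 1), by nlinarith, fun ε hε q => ?_⟩
  have hV : VHat ρ ε q = (planeHat ρ.toSchwartz (ε • q) ^ 2).re := by
    rw [VHat, planeHat_VEps, planeHat_rhoEps ρ hε.ne']
  set z := planeHat ρ.toSchwartz (ε • q)
  have hzM : ‖z‖ ≤ M := hz _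
  have hz2 : ‖z - 1‖ ≤ N * (ε * ‖q‖) := by
    have := hz1 (ε • q)
    rwa [norm_smul, Real.norm_eq_abs, abs_of_pos hε] at this
  rw [hV]
  constructor
  · refine (Complex.re_le_norm _).trans ?_
    rw [norm_pow]
    have : ‖z‖ ^ 2 ≤ M ^ 2 := by gcongr
    have : 0 ≤ N * (M + 1) := by positivity
    linarith
  · have e : (z ^ 2).re - 1 = (z ^ 2 - 1).re := by simp
    rw [e]
    refine (Complex.abs_re_le_norm _).trans ?_
    rw [show z ^ 2 - 1 = (z - 1) * (z + 1) by ring, norm_mul]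
    have h3 : ‖z + 1‖ ≤ M + 1 := (norm_add_le _ _).trans (by simpa using hzM)
    calc ‖z - 1‖ * ‖z + 1‖ ≤ N * (ε * ‖q‖) * (M + 1) := by gcongr
      _ = N * (M + 1) * (ε * ‖q‖) := by ring
      _ ≤ _ := by
          gcongr
          have := sq_nonneg M
          linarith

end Cutoff

/-! ### The diagonal part of `A₊* F(-L₀) A₊` -/

section DiagonalSymbol

/-- With r = √λ, the left side is at most 1/r² for s ≤ r and at most (4/ν⁴) r²/s⁴ for s ≥ r; both
are dominated by the kernel at scale r. -/
theorem lam_div_sq_le (ν : ℝ) (hν : 0 < ν) {lam s : ℝ} (hlam : 0 < lam) (hs : 0 < s) :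
    lam / (lam + ν ^ 2 / 2 * s ^ 2) ^ 2 ≤ (1 + 4 / ν ^ 4) * schurKernel s √lam := by
  have hr : 0 < √lam := Real.sqrt_pos.2 hlam
  have hlr : lam = √lam ^ 2 := (Real.sq_sqrt hlam.le).symm
  set r := √lam
  rw [hlr]
  have hk := schurKernel_nonneg hs.le hr.le
  rcases le_total s r with h | h
  · have h1 : r ^ 2 / (r ^ 2 + ν ^ 2 / 2 * s ^ 2) ^ 2 ≤ schurKernel s r := by
      unfold schurKernel
      rw [max_eq_right h]
      calc r ^ 2 / (r ^ 2 + ν ^ 2 / 2 * s ^ 2) ^ 2 ≤ r ^ 2 / (r ^ 2) ^ 2 := by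
            gcongr
            have : 0 ≤ ν ^ 2 / 2 * s ^ 2 := by positivity
            linarith
        _ = r / (r * r ^ 2) := by field_simp
        _ ≤ r / (s * r ^ 2) := by gcongr
    have : 0 ≤ 4 / ν ^ 4 * schurKernel s r := by positivity
    linarith
  · have h1 : r ^ 2 / (r ^ 2 + ν ^ 2 / 2 * s ^ 2) ^ 2 ≤ 4 / ν ^ 4 * schurKernel s r := by
      unfold schurKernel
      rw [max_eq_left h]
      calc r ^ 2 / (r ^ 2 + ν ^ 2 / 2 * s ^ 2) ^ 2 ≤ r ^ 2 / (ν ^ 2 / 2 * s ^ 2) ^ 2 := by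
            gcongr
            have : 0 ≤ r ^ 2 := by positivity
            linarith
        _ = 4 / ν ^ 4 * (r * r / (s * s * s ^ 2)) := by field_simp; norm_num
        _ ≤ 4 / ν ^ 4 * (r * s / (s * s * s ^ 2)) := by gcongr
        _ = _ := by field_simp
    linarith

/-- Since q×p = (q+p)×p, one factor can be bounded through |q| and the other through |q+p|. This
splits the smallness between the two singular points q = 0 and q = -p. -/
theorem cross_sq_le_norm_add (q p : Plane) :
    cross q p ^ 2 ≤ ‖q‖ * ‖p‖ * (‖q + p‖ * ‖p‖) := by
  have e : cross (q + p) p = cross q p := by simp [cross]; ring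
  have h1 : |cross q p| ≤ ‖q‖ * ‖p‖ :=
    abs_le_of_sq_le_sq ((cross_sq_le q p).trans_eq (by ring)) (by positivity)
  have h2 : |cross q p| ≤ ‖q + p‖ * ‖p‖ := by
    rw [← e]
    exact abs_le_of_sq_le_sq ((cross_sq_le (q + p) p).trans_eq (by ring)) (by positivity)
  rw [← sq_abs, sq]
  gcongr

/-- Dropping the inner product from |q+p|² is what makes the denominator radial in q. The
denominators differ by ν²⟨q,p⟩, and the resulting factor |q||p| cancels the 1/|q| left over from
`cross_sq_le_norm_add`. -/
theorem cross_sq_div_mul_inv_sub_le (ν : ℝ) (hν : 0 < ν) {lam : ℝ} (hlam : 0 < lam) {q p : Plane}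
    (hq : q ≠ 0) (hqp : q + p ≠ 0) :
    cross q p ^ 2 / ‖q‖ ^ 2 * |1 / (lam + ν ^ 2 / 2 * ‖q + p‖ ^ 2) -
      1 / (lam + ν ^ 2 / 2 * (‖q‖ ^ 2 + ‖p‖ ^ 2))| ≤
      8 / ν ^ 2 * ‖p‖ ^ 2 * schurKernel ‖q + p‖ ‖p‖ := by
  have hq0 : 0 < ‖q‖ := norm_pos_iff.2 hq
  have hk0 : 0 < ‖q + p‖ := norm_pos_iff.2 hqp
  have hs0 : 0 ≤ ‖p‖ := norm_nonneg p
  have hexp := norm_add_sq_real q p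
  have hip := abs_real_inner_le_norm q p
  have hc := cross_sq_le_norm_add q p
  have htri := norm_add_le q p
  set a := ‖q‖
  set s := ‖p‖
  set k := ‖q + p‖
  set z : ℝ := inner ℝ q p
  set x := lam + ν ^ 2 / 2 * k ^ 2 with hx
  set y := lam + ν ^ 2 / 2 * (a ^ 2 + s ^ 2) with hy
  have hx1 : ν ^ 2 / 2 * k ^ 2 ≤ x := by linarith
  have hmax : max k s ^ 2 ≤ 2 * (a ^ 2 + s ^ 2) := by
    rcases max_cases k s with ⟨h, _⟩ | ⟨h, _⟩ <;> rw [h]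
    · nlinarith [sq_nonneg (a - s)]
    · nlinarith
  have hm0 : 0 < max k s := lt_max_of_lt_left hk0
  have hy1 : ν ^ 2 / 4 * max k s ^ 2 ≤ y := by
    have := mul_le_mul_of_nonneg_left hmax (by positivity : 0 ≤ ν ^ 2 / 4)
    linarith
  have hx0 : 0 < x := by positivity
  have hy0 : 0 < y := by positivity
  have hdiff : |1 / x - 1 / y| ≤ ν ^ 2 * (a * s) / (x * y) := by
    rw [div_sub_div _ _ hx0.ne' hy0.ne', abs_div, abs_of_pos (mul_pos hx0 hy0)]
    gcongr
    have : 1 * y - x * 1 = -(ν ^ 2 * z) := by rw [hx, hy, hexp]; ring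
    rw [this, abs_neg, abs_mul, abs_of_nonneg (by positivity : 0 ≤ ν ^ 2)]
    gcongr
  calc cross q p ^ 2 / a ^ 2 * |1 / x - 1 / y|
      ≤ a * s * (k * s) / a ^ 2 * (ν ^ 2 * (a * s) / (x * y)) := by gcongr
    _ ≤ a * s * (k * s) / a ^ 2 * (ν ^ 2 * (a * s) /
          ((ν ^ 2 / 2 * k ^ 2) * (ν ^ 2 / 4 * max k s ^ 2))) := by gcongr
    _ = _ := by
          unfold schurKernel
          field_simp
          ring

/-- Below 1/ε both cutoffs are 1 + O(ε a) or better relative to x, so the error is of order ε/a.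
Above 1/ε, V vanishes and 1/(1+ε²x) supplies the decay. Both cases match the kernel at scale 1/ε. -/
theorem cutoff_error_le (ν : ℝ) (hν : 0 < ν) {B V ε a x : ℝ} (hB : 0 ≤ B) (hε : 0 < ε)
    (ha : 0 < a) (hx : ν ^ 2 / 2 * a ^ 2 ≤ x) (hV : |V - 1| ≤ B * (ε * a))
    (hV0 : ε⁻¹ < a → V = 0) :
    |V - 1 / (1 + ε ^ 2 * x)| / x ≤
      (2 * B / ν ^ 2 + 1 + 4 / ν ^ 4) * schurKernel a ε⁻¹ := by
  have hx0 : 0 < x := lt_of_lt_of_le (by positivity) hx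
  have hk := schurKernel_nonneg ha.le (inv_pos.2 hε).le
  rcases le_or_gt a ε⁻¹ with h | h
  · have hea : ε * a ≤ 1 := by
      have := mul_le_mul_of_nonneg_left h hε.le
      rwa [mul_inv_cancel₀ hε.ne'] at this
    have e1 : schurKernel a ε⁻¹ = ε / a := by
      unfold schurKernel; rw [max_eq_right h]; field_simp
    have h1 : |V - 1| / x ≤ 2 * B / ν ^ 2 * (ε / a) := by
      calc |V - 1| / x ≤ B * (ε * a) / (ν ^ 2 / 2 * a ^ 2) := by gcongr
        _ = _ := by field_simp
    have h2 : |1 - 1 / (1 + ε ^ 2 * x)| / x ≤ ε / a := by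
      have e : 1 - 1 / (1 + ε ^ 2 * x) = ε ^ 2 * x / (1 + ε ^ 2 * x) := by field_simp; ring
      rw [e, abs_of_nonneg (by positivity), div_div, div_le_div_iff₀ (by positivity) ha]
      have : 0 < ε * x := by positivity
      have h3 : ε * x * (ε * a) ≤ ε * x * 1 := by gcongr
      have : 0 ≤ ε * (ε ^ 2 * x * x) := by positivity
      nlinarith
    have h3 : |V - 1 / (1 + ε ^ 2 * x)| ≤ |V - 1| + |1 - 1 / (1 + ε ^ 2 * x)| :=
      abs_sub_le _ _ _
    have h4 : |V - 1 / (1 + ε ^ 2 * x)| / x ≤ |V - 1| / x + |1 - 1 / (1 + ε ^ 2 * x)| / x := by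
      rw [← add_div]; gcongr
    rw [e1]
    have : 0 ≤ 4 / ν ^ 4 * (ε / a) := by positivity
    linarith
  · rw [hV0 h, zero_sub, abs_neg, abs_of_nonneg (by positivity)]
    have hea : 1 ≤ ε * a := by
      have := mul_le_mul_of_nonneg_left h.le hε.le
      rwa [mul_inv_cancel₀ hε.ne'] at this
    have h1 : 1 / (1 + ε ^ 2 * x) / x ≤ 4 / ν ^ 4 * schurKernel a ε⁻¹ := by
      unfold schurKernel
      rw [max_eq_left h.le]
      calc 1 / (1 + ε ^ 2 * x) / x ≤ 1 / (ε ^ 2 * (ν ^ 2 / 2 * a ^ 2)) / (ν ^ 2 / 2 * a ^ 2) := by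
            gcongr
            have : ε ^ 2 * (ν ^ 2 / 2 * a ^ 2) ≤ ε ^ 2 * x := by gcongr
            linarith
        _ = 4 / ν ^ 4 * (1 / (ε * (ε * a) * (a * a ^ 2))) := by field_simp; norm_num
        _ ≤ 4 / ν ^ 4 * (1 / (ε * 1 * (a * a ^ 2))) := by gcongr
        _ = _ := by field_simp
    have : 0 ≤ (2 * B / ν ^ 2 + 1) * schurKernel a ε⁻¹ := by positivity
    linarith

theorem diagonal_integrand_le (lhat ν : ℝ) (hν : 0 < ν) {B V ε lam : ℝ} (hB : 1 ≤ B) (h0 : 0 < ε)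
    (h1 : ε < 1 / 2) (hlam : 0 < lam) {j : ℕ} (hj : 1 ≤ j) {q p : Plane} (hq : q ≠ 0)
    (hqp : q + p ≠ 0) (hVB : V ≤ B) (hVn : 0 ≤ V) (hV : |V - 1| ≤ B * (ε * ‖q‖))
    (hV0 : ε⁻¹ < ‖q‖ → V = 0) :
    |V * (cross q p ^ 2 / ‖q‖ ^ 2) * resolventSymbol lhat ν lam ε j (ν ^ 2 / 2 * ‖q + p‖ ^ 2) -
      cross q p ^ 2 / ‖q‖ ^ 2 *
        (damping lhat ν ε j (lam + ν ^ 2 / 2 * (‖q‖ ^ 2 + ‖p‖ ^ 2)) /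
          (lam + ν ^ 2 / 2 * (‖q‖ ^ 2 + ‖p‖ ^ 2)) /
            (1 + ε ^ 2 * (lam + ν ^ 2 / 2 * (‖q‖ ^ 2 + ‖p‖ ^ 2))))| ≤
      (B * (1 + 4 / ν ^ 4) * schurKernel ‖q + p‖ √lam +
        B * lipConst lhat ν * (8 / ν ^ 2) * schurKernel ‖q + p‖ ‖p‖ +
        (2 * B / ν ^ 2 + 1 + 4 / ν ^ 4) * schurKernel ‖q‖ ε⁻¹) * ‖p‖ ^ 2 := by
  have hB0 : 0 ≤ B := by linarith
  set W := cross q p ^ 2 / ‖q‖ ^ 2 with hW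
  have hW0 : 0 ≤ W := by positivity
  have hWle : W ≤ ‖p‖ ^ 2 := cross_sq_div_le q p
  set t := ν ^ 2 / 2 * ‖q + p‖ ^ 2 with ht
  have ht0 : 0 ≤ t := by positivity
  set y := lam + ν ^ 2 / 2 * (‖q‖ ^ 2 + ‖p‖ ^ 2) with hy
  have hy0 : 0 < y := by positivity
  set F := resolventSymbol lhat ν lam ε j t
  set u := damping lhat ν ε j (lam + t)
  set w := damping lhat ν ε j y with hw
  have hw0 : 0 < w := damping_pos lhat ν ε j hy0
  have hw1 : w ≤ 1 := damping_le_one lhat ν ε j hy0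
  have a1 : |F - u / (lam + t)| ≤ (1 + 4 / ν ^ 4) * schurKernel ‖q + p‖ √lam :=
    (abs_resolventSymbol_sub_le lhat ν ε hlam j ht0).trans
      (lam_div_sq_le ν hν hlam (norm_pos_iff.2 hqp))
  have a2 : |u / (lam + t) - w / y| ≤ lipConst lhat ν * |1 / (lam + t) - 1 / y| :=
    abs_damping_div_sub_le lhat ν h0 h1 hj (by linarith) hy0
  have a3 := cross_sq_div_mul_inv_sub_le ν hν hlam hq hqp
  have hxy : ν ^ 2 / 2 * ‖q‖ ^ 2 ≤ y := by
    have : 0 ≤ ν ^ 2 / 2 * ‖p‖ ^ 2 := by positivity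
    rw [hy, mul_add]; linarith
  have a4 := cutoff_error_le ν hν hB0 h0 (norm_pos_iff.2 hq) hxy hV hV0
  have hlip := one_le_lipConst lhat ν
  -- Telescoping through the three replacements: resolvent to damped inverse, |q+p|² to |q|² + |p|²,
  -- and V to 1/(1+ε²y).
  have e : V * W * F - W * (w / y / (1 + ε ^ 2 * y)) =
      V * W * (F - u / (lam + t)) + V * (W * (u / (lam + t) - w / y)) +
      W * (w * ((V - 1 / (1 + ε ^ 2 * y)) / y)) := by ring
  rw [e]
  have b1 : |V * W * (F - u / (lam + t))| ≤
      B * (1 + 4 / ν ^ 4) * schurKernel ‖q + p‖ √lam * ‖p‖ ^ 2 := by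
    rw [abs_mul, abs_of_nonneg (by positivity)]
    calc _ ≤ B * ‖p‖ ^ 2 * ((1 + 4 / ν ^ 4) * schurKernel ‖q + p‖ √lam) := by gcongr
      _ = _ := by ring
  have b2 : |V * (W * (u / (lam + t) - w / y))| ≤
      B * lipConst lhat ν * (8 / ν ^ 2) * schurKernel ‖q + p‖ ‖p‖ * ‖p‖ ^ 2 := by
    rw [abs_mul, abs_of_nonneg hVn, abs_mul, abs_of_nonneg hW0]
    calc _ ≤ B * (W * (lipConst lhat ν * |1 / (lam + t) - 1 / y|)) := by gcongr
      _ = B * lipConst lhat ν * (W * |1 / (lam + t) - 1 / y|) := by ring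
      _ ≤ B * lipConst lhat ν * (8 / ν ^ 2 * ‖p‖ ^ 2 * schurKernel ‖q + p‖ ‖p‖) := by gcongr
      _ = _ := by ring
  have b3 : |W * (w * ((V - 1 / (1 + ε ^ 2 * y)) / y))| ≤
      (2 * B / ν ^ 2 + 1 + 4 / ν ^ 4) * schurKernel ‖q‖ ε⁻¹ * ‖p‖ ^ 2 := by
    rw [abs_mul, abs_of_nonneg hW0, abs_mul, abs_of_pos hw0, abs_div, abs_of_pos hy0]
    calc _ ≤ ‖p‖ ^ 2 * (1 * ((2 * B / ν ^ 2 + 1 + 4 / ν ^ 4) * schurKernel ‖q‖ ε⁻¹)) := by gcongr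
      _ = _ := by ring
  have := abs_add_le (V * W * (F - u / (lam + t)) + V * (W * (u / (lam + t) - w / y)))
    (W * (w * ((V - 1 / (1 + ε ^ 2 * y)) / y)))
  have := abs_add_le (V * W * (F - u / (lam + t))) (V * (W * (u / (lam + t) - w / y)))
  linarith

/-- `D(p) = ∫ (q × p)² F((ν²/2)|q + p|²) V̂_ε(q)/|q|² dq`. -/
def diagonalSymbol (ρ : Mollifier) (ν ε : ℝ) (F : ℝ → ℝ) (p : Plane) : ℝ :=
  ∫ q, cross q p ^ 2 * F (ν ^ 2 / 2 * ‖q + p‖ ^ 2) ∂(momentumMeasure ρ ε)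

theorem continuous_resolventSymbol_norm (lhat ν ε : ℝ) {lam : ℝ} (hlam : 0 < lam) (j : ℕ)
    (p : Plane) :
    Continuous fun q : Plane => resolventSymbol lhat ν lam ε j (ν ^ 2 / 2 * ‖q + p‖ ^ 2) :=
  (continuousOn_resolventSymbol lhat ν ε hlam j).comp_continuous (by fun_prop)
    fun q => by rw [mem_Ici]; positivity

/-- The three errors are kernels at the scales √λ, |p| and 1/ε, each of planar integral at most 4π.
Hence C depends on neither λ, ε, j nor p. -/
theorem exists_diagonalSymbol_bound (ρ : Mollifier) (lhat ν : ℝ) (hlhat : 0 < lhat)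
    (hν : 0 < ν) : ∃ C : ℝ, 0 ≤ C ∧ ∀ lam : ℝ, 0 < lam → ∀ ε : ℝ, 0 < ε → ε < 1 / 2 →
      ∀ j : ℕ, 1 ≤ j → ∀ p : Plane,
      |lhat ^ 2 / Real.log (1 / ε) * diagonalSymbol ρ ν ε (resolventSymbol lhat ν lam ε j) p -
        2 / ν ^ 2 * ‖p‖ ^ 2 * funG ν (j + 1) (funL lhat ε (lam + ν ^ 2 / 2 * ‖p‖ ^ 2))| ≤
      C * (1 / Real.log (1 / ε)) * ‖p‖ ^ 2 := by
  obtain ⟨B, hB, hVB⟩ := exists_VHat_bound ρ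
  have hB0 : 0 ≤ B := by linarith
  have hlip := one_le_lipConst lhat ν
  refine ⟨lhat ^ 2 * ((B * (1 + 4 / ν ^ 4) + B * lipConst lhat ν * (8 / ν ^ 2) +
    (2 * B / ν ^ 2 + 1 + 4 / ν ^ 4)) * (4 * Real.pi)), by positivity,
    fun lam hlam ε h0 h1 j hj p => ?_⟩
  have hlog : 0 < Real.log (1 / ε) :=
    (Real.log_pos (by norm_num : (1 : ℝ) < 2)).trans_le (log_two_le_log_inv h0 h1)
  set F := resolventSymbol lhat ν lam ε j with hF
  set x₀ := lam + ν ^ 2 / 2 * ‖p‖ ^ 2 with hx₀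
  have hx₀p : 0 < x₀ := by positivity
  obtain ⟨hRi, hRv⟩ := radial_integral lhat ν hlhat hν h0 h1 hj hx₀p
  set f : ℝ → ℝ := fun a => damping lhat ν ε j (x₀ + ν ^ 2 / 2 * a ^ 2) /
    (x₀ + ν ^ 2 / 2 * a ^ 2) / (1 + ε ^ 2 * (x₀ + ν ^ 2 / 2 * a ^ 2)) with hf
  have hWi := integrable_cross_sq_div_mul (f := f) hRi p
  have hWv := integral_cross_sq_div_mul (f := f) hRi p
  -- The density of `momentumMeasure` is the `ENNReal.ofReal` of the quotient, hence the positive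
  -- part; using it here makes a proof of V̂_ε ≥ 0 unnecessary. Truncation at 0 preserves the
  -- bounds, since 1 is positive.
  set V : Plane → ℝ := fun q => max (VHat ρ ε q) 0 with hV
  have hVc : Continuous V := (VHat_continuous ρ ε).max continuous_const
  have hV0 : ∀ q : Plane, ε⁻¹ < ‖q‖ → V q = 0 := fun q hq => by
    simp only [hV]
    rw [VHat_eq_zero ρ ε q (by rwa [abs_of_pos h0]), max_self]
  have hV1 : ∀ q : Plane, |V q - 1| ≤ B * (ε * ‖q‖) := fun q => by
    have h := abs_max_sub_max_le_abs (VHat ρ ε q) 1 0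
    rw [max_eq_left (zero_le_one' ℝ)] at h
    exact h.trans (hVB ε h0 q).2
  have hVle : ∀ q : Plane, V q ≤ B := fun q => max_le (hVB ε h0 q).1 hB0
  have hVn : ∀ q : Plane, 0 ≤ V q := fun q => le_max_right _ _
  have hD : diagonalSymbol ρ ν ε F p =
      ∫ q : Plane, V q * (cross q p ^ 2 / ‖q‖ ^ 2) * F (ν ^ 2 / 2 * ‖q + p‖ ^ 2) := by
    unfold diagonalSymbol momentumMeasure
    rw [integral_withDensity_eq_integral_toReal_smul (density_measurable ρ ε)
      (Eventually.of_forall fun _ => ENNReal.ofReal_lt_top)]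
    refine integral_congr_ae (Eventually.of_forall fun q => ?_)
    simp only [ENNReal.toReal_ofReal', smul_eq_mul, hV]
    have hmax := max_div_div_right (sq_nonneg ‖q‖) (VHat ρ ε q) 0
    rw [zero_div] at hmax
    rw [hmax]
    ring
  have hDi : Integrable fun q : Plane =>
      V q * (cross q p ^ 2 / ‖q‖ ^ 2) * F (ν ^ 2 / 2 * ‖q + p‖ ^ 2) := by
    have hind : Integrable ((Metric.closedBall (0 : Plane) ε⁻¹).indicator
        fun _ => B * ‖p‖ ^ 2 * (1 / lam)) := by
      rw [integrable_indicator_iff Metric.isClosed_closedBall.measurableSet]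
      exact integrableOn_const measure_closedBall_lt_top.ne
    refine hind.mono' ?_ (Eventually.of_forall fun q => ?_)
    · refine ((hVc.measurable.mul ?_).mul
        (continuous_resolventSymbol_norm lhat ν ε hlam j p).measurable).aestronglyMeasurable
      unfold cross; fun_prop
    · by_cases hq : q ∈ Metric.closedBall (0 : Plane) ε⁻¹
      · have hFn := resolventSymbol_nonneg lhat ν ε hlam j
          (by positivity : 0 ≤ ν ^ 2 / 2 * ‖q + p‖ ^ 2)
        have hFle := (resolventSymbol_le lhat ν ε hlam j
          (by positivity : 0 ≤ ν ^ 2 / 2 * ‖q + p‖ ^ 2)).trans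
            (one_div_le_one_div_of_le hlam (le_add_of_nonneg_right (by positivity)))
        have := hVn q
        rw [indicator_of_mem hq, Real.norm_eq_abs, abs_of_nonneg (by positivity)]
        have := cross_sq_div_le q p
        have := hVle q
        gcongr
      · rw [indicator_of_notMem hq, hV0 q (by simpa using hq)]
        simp
  have hk1 := (integrable_schurKernel (Real.sqrt_nonneg lam) p).const_mul (B * (1 + 4 / ν ^ 4))
  have hk2 := (integrable_schurKernel (norm_nonneg p) p).const_mul
    (B * lipConst lhat ν * (8 / ν ^ 2))
  have hk3 := (integrable_schurKernel (inv_pos.2 h0).le (0 : Plane)).const_mul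
    (2 * B / ν ^ 2 + 1 + 4 / ν ^ 4)
  simp only [add_zero] at hk3
  have hmain : |(∫ q : Plane, V q * (cross q p ^ 2 / ‖q‖ ^ 2) * F (ν ^ 2 / 2 * ‖q + p‖ ^ 2)) -
      ∫ q : Plane, cross q p ^ 2 / ‖q‖ ^ 2 * f ‖q‖| ≤
      (B * (1 + 4 / ν ^ 4) + B * lipConst lhat ν * (8 / ν ^ 2) +
        (2 * B / ν ^ 2 + 1 + 4 / ν ^ 4)) * (4 * Real.pi) * ‖p‖ ^ 2 := by
    rw [← integral_sub hDi hWi, ← Real.norm_eq_abs]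
    refine (norm_integral_le_of_norm_le (((hk1.add hk2).add hk3).mul_const (‖p‖ ^ 2)) ?_).trans ?_
    · filter_upwards [compl_mem_ae_iff.2 (measure_singleton (μ := volume) (0 : Plane)),
        compl_mem_ae_iff.2 (measure_singleton (μ := volume) (-p))] with q hq hqp
      have hqp' : q + p ≠ 0 := fun h => hqp (eq_neg_of_add_eq_zero_left h)
      have := diagonal_integrand_le lhat ν hν hB h0 h1 hlam hj hq hqp' (hVle q) (hVn q) (hV1 q)
        (hV0 q)
      have e : x₀ + ν ^ 2 / 2 * ‖q‖ ^ 2 = lam + ν ^ 2 / 2 * (‖q‖ ^ 2 + ‖p‖ ^ 2) := by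
        rw [hx₀]; ring
      simp only [hf, e]
      exact this
    · have i1 := integral_schurKernel_le (Real.sqrt_nonneg lam) p
      have i2 := integral_schurKernel_le (norm_nonneg p) p
      have i3 := integral_schurKernel_le (inv_pos.2 h0).le (0 : Plane)
      simp only [add_zero] at i3
      rw [integral_mul_const, integral_add' (hk1.add hk2) hk3, integral_add' hk1 hk2,
        integral_const_mul, integral_const_mul, integral_const_mul]
      have m1 := mul_le_mul_of_nonneg_left i1 (by positivity : 0 ≤ B * (1 + 4 / ν ^ 4))
      have m2 := mul_le_mul_of_nonneg_left i2
        (by positivity : 0 ≤ B * lipConst lhat ν * (8 / ν ^ 2))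
      have m3 := mul_le_mul_of_nonneg_left i3
        (by positivity : 0 ≤ 2 * B / ν ^ 2 + 1 + 4 / ν ^ 4)
      refine mul_le_mul_of_nonneg_right ?_ (by positivity)
      linarith
  have hfv : lhat ^ 2 / Real.log (1 / ε) * ∫ q : Plane, cross q p ^ 2 / ‖q‖ ^ 2 * f ‖q‖ =
      2 / ν ^ 2 * ‖p‖ ^ 2 * funG ν (j + 1) (funL lhat ε x₀) := by
    rw [hWv, mul_left_comm, hRv]; ring
  rw [hD, ← hfv, ← mul_sub, abs_mul, abs_of_nonneg (by positivity)]
  refine (mul_le_mul_of_nonneg_left hmain (by positivity)).trans_eq ?_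
  ring

end DiagonalSymbol

/-! ### Integration on the Fock space -/

section FockIntegrals

variable (ρ : Mollifier) (ε : ℝ)

theorem insertNth_measurePreserving (n : ℕ) (i : Fin (n + 1)) :
    MeasurePreserving (fun z : Plane × (Fin n → Plane) => (i.insertNth z.1 z.2 :
      Fin (n + 1) → Plane))
      ((momentumMeasure ρ ε).prod (Measure.pi fun _ : Fin n => momentumMeasure ρ ε))
      (Measure.pi fun _ : Fin (n + 1) => momentumMeasure ρ ε) :=
  (measurePreserving_piFinSuccAbove (fun _ : Fin (n + 1) => momentumMeasure ρ ε) i).symm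

theorem insertNth_measurableEmbedding (n : ℕ) (i : Fin (n + 1)) :
    MeasurableEmbedding (fun z : Plane × (Fin n → Plane) => (i.insertNth z.1 z.2 :
      Fin (n + 1) → Plane)) :=
  (MeasurableEquiv.piFinSuccAbove (fun _ : Fin (n + 1) => Plane) i).symm.measurableEmbedding

/-- The factor n + 1 is the ratio (n+1)!/n! of the normalisations. -/
theorem lintegral_fock_succ (n : ℕ) (i : Fin (n + 1)) {k : (Fin (n + 1) → Plane) → ℝ≥0∞}
    (hk : Measurable k) :
    ∫⁻ p, k p ∂(fockMeasure ρ ε (n + 1)) =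
      (n + 1) * ∫⁻ r, ∫⁻ q, k (i.insertNth q r) ∂(momentumMeasure ρ ε) ∂(fockMeasure ρ ε n) := by
  have hm : Measurable fun z : Plane × (Fin n → Plane) => k (i.insertNth z.1 z.2) :=
    hk.comp (insertNth_measurableEmbedding n i).measurable
  unfold fockMeasure
  rw [lintegral_smul_measure, lintegral_smul_measure,
    ← (insertNth_measurePreserving ρ ε n i).lintegral_comp hk,
    lintegral_prod_symm _ hm.aemeasurable, Nat.factorial_succ]
  simp only [smul_eq_mul]
  push_cast
  ring

theorem integral_fock_succ (n : ℕ) (i : Fin (n + 1)) {k : (Fin (n + 1) → Plane) → ℂ}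
    (hk : Integrable k (fockMeasure ρ ε (n + 1))) :
    Integrable (fun r => ∫ q, k (i.insertNth q r) ∂(momentumMeasure ρ ε)) (fockMeasure ρ ε n) ∧
    ∫ p, k p ∂(fockMeasure ρ ε (n + 1)) =
      (n + 1) * ∫ r, ∫ q, k (i.insertNth q r) ∂(momentumMeasure ρ ε) ∂(fockMeasure ρ ε n) := by
  unfold fockMeasure at hk ⊢
  have h0 : ∀ m : ℕ, ((m.factorial : ℕ) : ℝ≥0∞) ≠ 0 := fun m => by
    exact_mod_cast m.factorial_ne_zero
  have hk' : Integrable k (Measure.pi fun _ : Fin (n + 1) => momentumMeasure ρ ε) :=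
    (integrable_smul_measure (h0 _) (ENNReal.natCast_ne_top _)).1 hk
  have hp : Integrable (fun z : Plane × (Fin n → Plane) => k (i.insertNth z.1 z.2))
      ((momentumMeasure ρ ε).prod (Measure.pi fun _ : Fin n => momentumMeasure ρ ε)) :=
    ((insertNth_measurePreserving ρ ε n i).integrable_comp_emb
      (insertNth_measurableEmbedding n i)).2 hk'
  refine ⟨(integrable_smul_measure (h0 _) (ENNReal.natCast_ne_top _)).2 hp.integral_prod_right, ?_⟩
  rw [integral_smul_measure, integral_smul_measure,
    ← (insertNth_measurePreserving ρ ε n i).integral_comp (insertNth_measurableEmbedding n i),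
    integral_prod_symm _ hp, Nat.factorial_succ]
  simp only [ENNReal.toReal_natCast, Complex.real_smul]
  push_cast
  ring

theorem lintegral_enorm_sq {α : Type*} [MeasurableSpace α] {μ : Measure α} (f : Lp ℂ 2 μ) :
    ∫⁻ a, ‖f a‖ₑ ^ 2 ∂μ = ENNReal.ofReal (‖f‖ ^ 2) := by
  have h := eLpNorm_nnreal_pow_eq_lintegral (μ := μ) (f := f) (p := 2) (by norm_num)
  simp only [NNReal.coe_ofNat, ENNReal.coe_ofNat] at h
  rw [← Lp.enorm_def, ← ofReal_norm] at h
  simp only [ENNReal.rpow_ofNat] at h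
  rw [← h, ENNReal.ofReal_pow (norm_nonneg _)]

/-- Cauchy–Schwarz in the shape of a Schur test: the integrand is only assumed to be dominated by
the geometric mean of two integrable majorants. -/
theorem norm_integral_le_of_sq_le {α : Type*} [MeasurableSpace α] {μ : Measure α} {f : α → ℂ}
    {k₁ k₂ : α → ℝ≥0∞} (hk₁ : Measurable k₁) (hk₂ : Measurable k₂) {a b c : ℝ} (ha : 0 ≤ a)
    (hb : 0 ≤ b) (hc : 0 ≤ c) (hf : ∀ x, ‖f x‖ₑ ^ 2 ≤ k₁ x * k₂ x)
    (h₁ : ∫⁻ x, k₁ x ∂μ ≤ ENNReal.ofReal (c * a ^ 2))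
    (h₂ : ∫⁻ x, k₂ x ∂μ ≤ ENNReal.ofReal (c * b ^ 2)) : ‖∫ x, f x ∂μ‖ ≤ c * a * b := by
  have hle : ∀ x, ‖f x‖ₑ ≤ ((fun x => k₁ x ^ (1 / 2 : ℝ)) * fun x => k₂ x ^ (1 / 2 : ℝ)) x := by
    intro x
    have h := ENNReal.rpow_le_rpow (hf x) (by norm_num : (0 : ℝ) ≤ 1 / 2)
    rw [ENNReal.mul_rpow_of_nonneg _ _ (by norm_num), ← ENNReal.rpow_natCast,
      ← ENNReal.rpow_mul] at h
    simpa using h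
  have hcs := ENNReal.lintegral_mul_le_Lp_mul_Lq μ Real.HolderConjugate.two_two
    (hk₁.pow_const (1 / 2 : ℝ)).aemeasurable (hk₂.pow_const (1 / 2 : ℝ)).aemeasurable
  simp only [← ENNReal.rpow_mul] at hcs
  norm_num at hcs
  have h3 : ‖∫ x, f x ∂μ‖ₑ ≤ ENNReal.ofReal (c * a * b) := by
    refine (enorm_integral_le_lintegral_enorm f).trans ((lintegral_mono hle).trans ?_)
    norm_num
    refine hcs.trans ((mul_le_mul' (ENNReal.rpow_le_rpow h₁ (by norm_num))
      (ENNReal.rpow_le_rpow h₂ (by norm_num))).trans_eq ?_)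
    rw [← ENNReal.mul_rpow_of_nonneg _ _ (by norm_num), ← ENNReal.ofReal_mul (by positivity),
      ENNReal.ofReal_rpow_of_nonneg (by positivity) (by norm_num), ← Real.sqrt_eq_rpow]
    congr 1
    rw [show c * a ^ 2 * (c * b ^ 2) = (c * a * b) ^ 2 by ring, Real.sqrt_sq (by positivity)]
  rw [← ofReal_norm] at h3
  exact (ENNReal.ofReal_le_ofReal_iff (by positivity)).1 h3

theorem lintegral_fock_norm_sum_sq (ν : ℝ) (hν : 0 < ν) (n : ℕ) (φ : Fock ρ ε n) :
    ∫⁻ p, ‖(φ : Lp ℂ 2 (fockMeasure ρ ε n)) p‖ₑ ^ 2 * ENNReal.ofReal (‖∑ i, p i‖ ^ 2)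
      ∂(fockMeasure ρ ε n) = ENNReal.ofReal (2 / ν ^ 2 * ‖sqrtNegL0 ρ ε ν n φ‖ ^ 2) := by
  have h := lintegral_enorm_sq (sqrtNegL0 ρ ε ν n φ : Lp ℂ 2 (fockMeasure ρ ε n))
  have hn : ‖(sqrtNegL0 ρ ε ν n φ : Lp ℂ 2 (fockMeasure ρ ε n))‖ = ‖sqrtNegL0 ρ ε ν n φ‖ := rfl
  rw [hn] at h
  rw [ENNReal.ofReal_mul (by positivity), ← h,
    ← lintegral_const_mul _ ((Lp.stronglyMeasurable _).enorm.pow_const 2)]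
  refine lintegral_congr_ae ?_
  filter_upwards [coeFn_diagOp ρ ε ν n Real.sqrt Real.continuous_sqrt.continuousOn φ] with p hp
  unfold sqrtNegL0
  rw [hp, enorm_mul, mul_pow, ← ofReal_norm (((√_ : ℝ) : ℂ)), Complex.norm_real, Real.norm_eq_abs,
    abs_of_nonneg (Real.sqrt_nonneg _), ← ENNReal.ofReal_pow (Real.sqrt_nonneg _),
    Real.sq_sqrt (by positivity), ← mul_assoc, ← ENNReal.ofReal_mul (by positivity), mul_comm]
  congr 2
  field_simp

theorem norm_integral_fock_le (ν : ℝ) (hν : 0 < ν) (n : ℕ) (φ₁ φ₂ : Fock ρ ε n)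
    (w : (Fin n → Plane) → ℂ) {K : ℝ} (hK : 0 ≤ K) (hw : ∀ p, ‖w p‖ ≤ K * ‖∑ i, p i‖ ^ 2) :
    ‖∫ p, inner ℂ ((φ₁ : Lp ℂ 2 (fockMeasure ρ ε n)) p) ((φ₂ : Lp ℂ 2 (fockMeasure ρ ε n)) p) * w p
      ∂(fockMeasure ρ ε n)‖ ≤
      K * (2 / ν ^ 2) * ‖sqrtNegL0 ρ ε ν n φ₁‖ * ‖sqrtNegL0 ρ ε ν n φ₂‖ := by
  have hm : ∀ φ : Fock ρ ε n, Measurable fun p =>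
      ‖(φ : Lp ℂ 2 (fockMeasure ρ ε n)) p‖ₑ ^ 2 * ENNReal.ofReal (‖∑ i, p i‖ ^ 2) := fun φ =>
    ((Lp.stronglyMeasurable _).enorm.pow_const 2).mul (by fun_prop)
  have hi : ∀ φ : Fock ρ ε n, ∫⁻ p, ENNReal.ofReal K *
      (‖(φ : Lp ℂ 2 (fockMeasure ρ ε n)) p‖ₑ ^ 2 * ENNReal.ofReal (‖∑ i, p i‖ ^ 2))
      ∂(fockMeasure ρ ε n) ≤ ENNReal.ofReal (K * (2 / ν ^ 2) * ‖sqrtNegL0 ρ ε ν n φ‖ ^ 2) :=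
    fun φ => by
      rw [lintegral_const_mul _ (hm φ), lintegral_fock_norm_sum_sq ρ ε ν hν,
        ← ENNReal.ofReal_mul hK, mul_assoc]
  refine norm_integral_le_of_sq_le ((hm φ₁).const_mul _) ((hm φ₂).const_mul _) (norm_nonneg _)
    (norm_nonneg _) (by positivity) (fun p => ?_) (hi φ₁) (hi φ₂)
  have hw' : ‖w p‖ₑ ≤ ENNReal.ofReal K * ENNReal.ofReal (‖∑ i, p i‖ ^ 2) := by
    rw [← ofReal_norm, ← ENNReal.ofReal_mul hK]
    exact ENNReal.ofReal_le_ofReal (hw p)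
  rw [RCLike.inner_apply, enorm_mul, enorm_mul, RCLike.enorm_conj, mul_pow, mul_pow]
  calc _ ≤ ‖(φ₂ : Lp ℂ 2 (fockMeasure ρ ε n)) p‖ₑ ^ 2 *
        ‖(φ₁ : Lp ℂ 2 (fockMeasure ρ ε n)) p‖ₑ ^ 2 *
        (ENNReal.ofReal K * ENNReal.ofReal (‖∑ i, p i‖ ^ 2)) ^ 2 := by gcongr
    _ = _ := by ring

end FockIntegrals

/-! ### The off-diagonal part of `A₊* F(-L₀) A₊` -/

section OffDiagonal

/-- Up to sign, x×P is also (P-x)×P, so both |x||P| and |P-x||P| bound it. The smaller of the two is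
the product divided by the maximum. -/
theorem abs_cross_mul_max_le (x P : Plane) :
    |cross x P| * max ‖x‖ ‖P - x‖ ≤ ‖x‖ * ‖P - x‖ * ‖P‖ := by
  have e1 : cross x P = cross x (P - x) := by simp [cross]; ring
  have e2 : cross x P = -cross (P - x) P := by simp [cross]; ring
  have hc : ∀ a b : Plane, |cross a b| ≤ ‖a‖ * ‖b‖ := fun a b =>
    abs_le_of_sq_le_sq ((cross_sq_le a b).trans_eq (by ring)) (by positivity)
  have h2 : |cross x P| ≤ ‖P - x‖ * ‖P‖ := by rw [e2, abs_neg]; exact hc _ _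
  rcases max_cases ‖x‖ ‖P - x‖ with ⟨h, _⟩ | ⟨h, _⟩ <;> rw [h]
  · calc _ ≤ ‖P - x‖ * ‖P‖ * ‖x‖ := by gcongr
      _ = _ := by ring
  · calc _ ≤ ‖x‖ * ‖P‖ * ‖P - x‖ := by gcongr; exact hc _ _
      _ = _ := by ring

/-- The weight of the Schur test for the off-diagonal part. -/
def schurWeight (x y P : Plane) : ℝ :=
  schurKernel ‖x‖ ‖P - x‖ + schurKernel ‖P - y‖ ‖y‖

theorem schurWeight_nonneg (x y P : Plane) : 0 ≤ schurWeight x y P :=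
  add_nonneg (schurKernel_nonneg (norm_nonneg _) (norm_nonneg _))
    (schurKernel_nonneg (norm_nonneg _) (norm_nonneg _))

/-- Here x = p_i and y = p_j are the two inserted momenta and P is the total momentum. The right
side separates the two kernels: |P-x| is the total momentum seen by the one lacking p_i and supplies
its (-L₀)^{1/2}, |x|² cancels the singular density, and the weight is integrable in x with the other
momenta fixed. The same holds with x and y exchanged. -/
theorem offDiagonal_le (ν : ℝ) (hν : 0 < ν) {lam s : ℝ} (hlam : 0 < lam) (x y P : Plane)
    (hs0 : 0 ≤ s) (hs : s ≤ 1 / (lam + ν ^ 2 / 2 * ‖P‖ ^ 2)) :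
    (cross x P * (s * cross y P)) ^ 2 ≤
      2 / ν ^ 2 * (‖x‖ ^ 2 * schurWeight x y P) * ‖P - x‖ ^ 2 *
        (2 / ν ^ 2 * (‖y‖ ^ 2 * schurWeight y x P) * ‖P - y‖ ^ 2) := by
  have hw1 := schurWeight_nonneg x y P
  have hw2 := schurWeight_nonneg y x P
  by_cases hz : cross x P * (s * cross y P) = 0
  · rw [hz, zero_pow two_ne_zero]; positivity
  have hcx : cross x P ≠ 0 := left_ne_zero_of_mul hz
  have hcy : cross y P ≠ 0 := right_ne_zero_of_mul (right_ne_zero_of_mul hz)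
  have hne : ∀ v : Plane, cross v P ≠ 0 → 0 < ‖v‖ ∧ 0 < ‖P - v‖ ∧ 0 < ‖P‖ := by
    intro v hv
    refine ⟨norm_pos_iff.2 fun h => hv ?_, norm_pos_iff.2 fun h => hv ?_,
      norm_pos_iff.2 fun h => hv ?_⟩
    · simp [h, cross]
    · rw [← sub_eq_zero.1 h]; simp [cross]; ring
    · simp [h, cross]
  obtain ⟨hx, ha, hP⟩ := hne x hcx
  obtain ⟨hy, hb, -⟩ := hne y hcy
  have h1 := abs_cross_mul_max_le x P
  have h2 := abs_cross_mul_max_le y P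
  have hs' : s ≤ 2 / (ν ^ 2 * ‖P‖ ^ 2) := by
    refine hs.trans ?_
    rw [div_le_div_iff₀ (by positivity) (by positivity)]
    nlinarith
  unfold schurWeight schurKernel
  rw [max_comm ‖P - y‖, max_comm ‖P - x‖]
  set X := ‖x‖
  set Y := ‖y‖
  set a := ‖P - x‖
  set b := ‖P - y‖
  set u := max X a
  set v := max Y b
  have hu : 0 < u := lt_max_of_lt_left hx
  have hv : 0 < v := lt_max_of_lt_left hy
  have n1 : |cross x P| ≤ X * a * ‖P‖ / u := (le_div_iff₀ hu).2 h1
  have n2 : |cross y P| ≤ Y * b * ‖P‖ / v := (le_div_iff₀ hv).2 h2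
  -- The mixed products in the expansion are exactly 1/u⁴ and 1/v⁴, and their sum already exceeds
  -- 1/(u²v²). This is why `schurWeight` has two summands.
  have hT : 1 / (u ^ 2 * v ^ 2) ≤ (a / (X * u ^ 2) + Y / (b * v ^ 2)) *
      (b / (Y * v ^ 2) + X / (a * u ^ 2)) := by
    have e : (a / (X * u ^ 2) + Y / (b * v ^ 2)) * (b / (Y * v ^ 2) + X / (a * u ^ 2)) =
        a * b / (X * Y * u ^ 2 * v ^ 2) + X * Y / (a * b * u ^ 2 * v ^ 2) +
        ((1 / u ^ 2) ^ 2 + (1 / v ^ 2) ^ 2) := by field_simp; ring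
    have e2 : 1 / (u ^ 2 * v ^ 2) = 1 / u ^ 2 * (1 / v ^ 2) := by field_simp
    rw [e, e2]
    have p1 : 0 ≤ a * b / (X * Y * u ^ 2 * v ^ 2) := by positivity
    have p2 : 0 ≤ X * Y / (a * b * u ^ 2 * v ^ 2) := by positivity
    nlinarith [sq_nonneg (1 / u ^ 2 - 1 / v ^ 2), sq_nonneg (1 / u ^ 2), sq_nonneg (1 / v ^ 2)]
  rw [← sq_abs, abs_mul, abs_mul, abs_of_nonneg hs0]
  calc (|cross x P| * (s * |cross y P|)) ^ 2
      ≤ (X * a * ‖P‖ / u * (2 / (ν ^ 2 * ‖P‖ ^ 2) * (Y * b * ‖P‖ / v))) ^ 2 := by gcongr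
    _ = (2 / ν ^ 2) ^ 2 * (X ^ 2 * a ^ 2 * Y ^ 2 * b ^ 2) * (1 / (u ^ 2 * v ^ 2)) := by
        field_simp
    _ ≤ (2 / ν ^ 2) ^ 2 * (X ^ 2 * a ^ 2 * Y ^ 2 * b ^ 2) *
        ((a / (X * u ^ 2) + Y / (b * v ^ 2)) * (b / (Y * v ^ 2) + X / (a * u ^ 2))) := by gcongr
    _ = _ := by ring

/-- The factor |q|² removes the singularity of the density, leaving Lebesgue measure times the
supremum of V̂_ε. -/
theorem lintegral_momentum_mul_le (ρ : Mollifier) {ε B : ℝ} (hB : 0 ≤ B)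
    (hV : ∀ q, VHat ρ ε q ≤ B) {T : Plane → ℝ} (hT : Measurable T) (hT0 : ∀ q, 0 ≤ T q) :
    ∫⁻ q, ENNReal.ofReal (‖q‖ ^ 2 * T q) ∂(momentumMeasure ρ ε) ≤
      ENNReal.ofReal B * ∫⁻ q, ENNReal.ofReal (T q) := by
  unfold momentumMeasure
  rw [lintegral_withDensity_eq_lintegral_mul _ (density_measurable ρ ε) (by fun_prop),
    ← lintegral_const_mul _ (by fun_prop)]
  refine lintegral_mono fun q => ?_
  have hq : 0 ≤ ‖q‖ ^ 2 * T q := mul_nonneg (by positivity) (hT0 q)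
  rw [Pi.mul_apply, ← ENNReal.ofReal_mul' hq, ← ENNReal.ofReal_mul hB]
  refine ENNReal.ofReal_le_ofReal ?_
  rcases eq_or_ne q 0 with rfl | h
  · simpa using mul_nonneg hB (hT0 0)
  · rw [← mul_assoc, div_mul_cancel₀ _ (by simpa using h)]
    exact mul_le_mul_of_nonneg_right (hV q) (hT0 q)

theorem schurKernel_measurable {α : Type*} [MeasurableSpace α] {f g : α → ℝ} (hf : Measurable f)
    (hg : Measurable g) : Measurable fun a => schurKernel (f a) (g a) := by
  unfold schurKernel; fun_prop

theorem schurWeight_insertNth (n : ℕ) (i : Fin (n + 1)) (k : Fin n) (q : Plane)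
    (r : Fin n → Plane) :
    schurWeight (i.insertNth (α := fun _ => Plane) q r i)
      (i.insertNth (α := fun _ => Plane) q r (i.succAbove k))
      (∑ l, i.insertNth (α := fun _ => Plane) q r l) =
      schurKernel ‖q + 0‖ ‖∑ l, r l‖ + schurKernel ‖q + (∑ l, r l - r k)‖ ‖r k‖ := by
  rw [Fin.sum_univ_succAbove _ i]
  simp only [Fin.insertNth_apply_same, Fin.insertNth_apply_succAbove, schurWeight,
    add_sub_cancel_left, add_zero, add_sub_assoc]

/-- The momentum p_i is integrated first. As j ≠ i, the momentum p_j and P - p_i stay fixed, so the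
weight is a sum of two translated kernels in p_i, of total mass at most 8π. The remaining integral
is the squared (-L₀)^{1/2}-seminorm of φ. -/
theorem lintegral_schurWeight_le (ρ : Mollifier) (ν : ℝ) (hν : 0 < ν) {ε B : ℝ} (hB : 0 ≤ B)
    (hV : ∀ q, VHat ρ ε q ≤ B) (n : ℕ) {i j : Fin (n + 1)} (hij : j ≠ i) (φ : Fock ρ ε n) :
    ∫⁻ p, ENNReal.ofReal (2 / ν ^ 2 * (‖p i‖ ^ 2 * schurWeight (p i) (p j) (∑ l, p l)) *
        ‖∑ l, p l - p i‖ ^ 2) * ‖(φ : Lp ℂ 2 (fockMeasure ρ ε n)) (i.removeNth p)‖ₑ ^ 2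
      ∂(fockMeasure ρ ε (n + 1)) ≤
      ENNReal.ofReal ((n + 1) * (2 / ν ^ 2) * (B * (8 * Real.pi)) * (2 / ν ^ 2) *
        ‖sqrtNegL0 ρ ε ν n φ‖ ^ 2) := by
  obtain ⟨k, rfl⟩ := Fin.exists_succAbove_eq hij
  have hmφ : Measurable fun r : Fin n → Plane =>
      ‖(φ : Lp ℂ 2 (fockMeasure ρ ε n)) r‖ₑ ^ 2 :=
    (Lp.stronglyMeasurable _).enorm.pow_const 2
  have hrem : Measurable fun p : Fin (n + 1) → Plane => i.removeNth p := by
    unfold Fin.removeNth; fun_prop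
  have hmW : Measurable fun p : Fin (n + 1) → Plane =>
      schurWeight (p i) (p (i.succAbove k)) (∑ l, p l) := by
    unfold schurWeight
    exact (schurKernel_measurable (by fun_prop) (by fun_prop)).add
      (schurKernel_measurable (by fun_prop) (by fun_prop))
  have hmφ' : Measurable fun p : Fin (n + 1) → Plane =>
      ‖(φ : Lp ℂ 2 (fockMeasure ρ ε n)) (i.removeNth p)‖ₑ ^ 2 := hmφ.comp hrem
  rw [lintegral_fock_succ ρ ε n i (by fun_prop)]
  have hinner : ∀ r : Fin n → Plane, ∫⁻ q, ENNReal.ofReal (2 / ν ^ 2 *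
      (‖i.insertNth (α := fun _ => Plane) q r i‖ ^ 2 *
        schurWeight (i.insertNth (α := fun _ => Plane) q r i)
          (i.insertNth (α := fun _ => Plane) q r (i.succAbove k))
          (∑ l, i.insertNth (α := fun _ => Plane) q r l)) *
        ‖∑ l, i.insertNth (α := fun _ => Plane) q r l -
          i.insertNth (α := fun _ => Plane) q r i‖ ^ 2) *
      ‖(φ : Lp ℂ 2 (fockMeasure ρ ε n)) (i.removeNth (i.insertNth (α := fun _ => Plane) q r))‖ₑ ^ 2
        ∂(momentumMeasure ρ ε) ≤
      ENNReal.ofReal (2 / ν ^ 2 * (B * (8 * Real.pi))) *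
        (‖(φ : Lp ℂ 2 (fockMeasure ρ ε n)) r‖ₑ ^ 2 * ENNReal.ofReal (‖∑ l, r l‖ ^ 2)) := by
    intro r
    set T : Plane → ℝ := fun q =>
      schurKernel ‖q + 0‖ ‖∑ l, r l‖ + schurKernel ‖q + (∑ l, r l - r k)‖ ‖r k‖ with hT
    have hTm : Measurable T :=
      (schurKernel_measurable (by fun_prop) (by fun_prop)).add
        (schurKernel_measurable (by fun_prop) (by fun_prop))
    have hT0 : ∀ q, 0 ≤ T q := fun q =>
      add_nonneg (schurKernel_nonneg (norm_nonneg _) (norm_nonneg _))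
        (schurKernel_nonneg (norm_nonneg _) (norm_nonneg _))
    have hTi : ∫⁻ q, ENNReal.ofReal (T q) ≤ ENNReal.ofReal (8 * Real.pi) := by
      have e : ∀ q, ENNReal.ofReal (T q) = ENNReal.ofReal (schurKernel ‖q + 0‖ ‖∑ l, r l‖) +
          ENNReal.ofReal (schurKernel ‖q + (∑ l, r l - r k)‖ ‖r k‖) := fun q =>
        ENNReal.ofReal_add (schurKernel_nonneg (norm_nonneg _) (norm_nonneg _))
          (schurKernel_nonneg (norm_nonneg _) (norm_nonneg _))
      simp only [e]
      rw [lintegral_add_left (schurKernel_measurable (by fun_prop) (by fun_prop)).ennreal_ofReal]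
      refine (add_le_add (lintegral_schurKernel_le (norm_nonneg _) _)
        (lintegral_schurKernel_le (norm_nonneg _) _)).trans_eq ?_
      rw [← ENNReal.ofReal_add (by positivity) (by positivity)]
      congr 1; ring
    simp only [schurWeight_insertNth]
    simp only [Fin.insertNth_apply_same, Fin.removeNth_insertNth, Fin.sum_univ_succAbove _ i,
      Fin.insertNth_apply_succAbove, add_sub_cancel_left]
    have e : ∀ q : Plane, ENNReal.ofReal (2 / ν ^ 2 * (‖q‖ ^ 2 * T q) * ‖∑ l, r l‖ ^ 2) *
        ‖(φ : Lp ℂ 2 (fockMeasure ρ ε n)) r‖ₑ ^ 2 = ENNReal.ofReal (2 / ν ^ 2) *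
        (ENNReal.ofReal (‖∑ l, r l‖ ^ 2) * ‖(φ : Lp ℂ 2 (fockMeasure ρ ε n)) r‖ₑ ^ 2) *
        ENNReal.ofReal (‖q‖ ^ 2 * T q) := fun q => by
      rw [ENNReal.ofReal_mul' (by positivity), ENNReal.ofReal_mul (by positivity)]
      ring
    change ∫⁻ q, ENNReal.ofReal (2 / ν ^ 2 * (‖q‖ ^ 2 * T q) * ‖∑ l, r l‖ ^ 2) *
        ‖(φ : Lp ℂ 2 (fockMeasure ρ ε n)) r‖ₑ ^ 2 ∂(momentumMeasure ρ ε) ≤ _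
    simp only [e]
    rw [lintegral_const_mul _ (by fun_prop)]
    refine (mul_le_mul_right ((lintegral_momentum_mul_le ρ hB hV hTm hT0).trans
      (mul_le_mul_right hTi _)) _).trans_eq ?_
    rw [ENNReal.ofReal_mul (by positivity : 0 ≤ 2 / ν ^ 2), ENNReal.ofReal_mul hB]
    ring
  refine (mul_le_mul_right (lintegral_mono hinner) _).trans_eq ?_
  rw [lintegral_const_mul _ (by fun_prop), lintegral_fock_norm_sum_sq ρ ε ν hν,
    ← ENNReal.ofReal_mul (by positivity)]
  have hn : ((n : ℝ≥0∞) + 1) = ENNReal.ofReal (n + 1) := by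
    rw [ENNReal.ofReal_add (by positivity) (by norm_num)]; simp
  rw [hn, ← ENNReal.ofReal_mul (by positivity)]
  congr 1; ring

end OffDiagonal

/-! ### The form of `A₊* F(-L₀) A₊` -/

section Form

variable (ρ : Mollifier) (ε ν : ℝ)

/-- Multiplication by `F((ν²/2)|p₁ + ⋯ + p_n|²)` on `L²`, without symmetry. -/
def mulOp (n : ℕ) (F : ℝ → ℝ) (hF : ContinuousOn F (Ici 0)) :
    Lp ℂ 2 (fockMeasure ρ ε n) →L[ℂ] Lp ℂ 2 (fockMeasure ρ ε n) :=
  pullMul id (Measure.QuasiMeasurePreserving.id _)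
    (fun p : Fin n → Plane => ((F (kinetic ν p) : ℝ) : ℂ))
    (diag_measurable ν n hF).aestronglyMeasurable (diag_bound ρ ε ν n hF)

theorem coeFn_mulOp (n : ℕ) (F : ℝ → ℝ) (hF : ContinuousOn F (Ici 0))
    (f : Lp ℂ 2 (fockMeasure ρ ε n)) :
    mulOp ρ ε ν n F hF f =ᵐ[fockMeasure ρ ε n] fun p => ((F (kinetic ν p) : ℝ) : ℂ) * f p :=
  coeFn_pullMul id (Measure.QuasiMeasurePreserving.id _) _ _ _ f

theorem coe_diagOp (n : ℕ) (F : ℝ → ℝ) (hF : ContinuousOn F (Ici 0)) (φ : Fock ρ ε n) :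
    (diagOp ρ ε ν n F hF φ : Lp ℂ 2 (fockMeasure ρ ε n)) = mulOp ρ ε ν n F hF φ := rfl

theorem coe_aPlus (lhat : ℝ) (n : ℕ) (φ : Fock ρ ε n) :
    (aPlus ρ lhat ε n φ : Lp ℂ 2 (fockMeasure ρ ε (n + 1))) =
      ((-(1 / (n + 1) * (lhat / √(Real.log (1 / ε)))) : ℝ) : ℂ) • ∑ i, insertOp ρ ε n i φ := by
  change aPlusFull ρ lhat ε n φ = _
  simp [aPlusFull]

theorem integrand_insertOp (n : ℕ) (F : ℝ → ℝ) (hF : ContinuousOn F (Ici 0)) (i j : Fin (n + 1))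
    (f g : Lp ℂ 2 (fockMeasure ρ ε n)) :
    (fun p => inner ℂ (insertOp ρ ε n i f p)
      (mulOp ρ ε ν (n + 1) F hF (insertOp ρ ε n j g) p)) =ᵐ[fockMeasure ρ ε (n + 1)]
    fun p => inner ℂ (f (i.removeNth p)) (g (j.removeNth p)) *
      ((cross (p i) (∑ l, p l) * (F (kinetic ν p) * cross (p j) (∑ l, p l)) : ℝ) : ℂ) := by
  have h : ∀ (i : Fin (n + 1)) (f : Lp ℂ 2 (fockMeasure ρ ε n)),
      insertOp ρ ε n i f =ᵐ[fockMeasure ρ ε (n + 1)] fun p =>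
        ((cross (p i) (∑ l, p l) : ℝ) : ℂ) * f (i.removeNth p) := fun i f =>
    coeFn_pullMul _ _ _ _ _ _
  filter_upwards [h i f, h j g, coeFn_mulOp ρ ε ν (n + 1) F hF (insertOp ρ ε n j g)]
    with p h1 h2 h3
  rw [h3, h1, h2, RCLike.inner_apply, RCLike.inner_apply, map_mul, Complex.conj_ofReal]
  push_cast
  ring

theorem inner_insertOp (n : ℕ) (F : ℝ → ℝ) (hF : ContinuousOn F (Ici 0)) (i j : Fin (n + 1))
    (f g : Lp ℂ 2 (fockMeasure ρ ε n)) :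
    inner ℂ (insertOp ρ ε n i f) (mulOp ρ ε ν (n + 1) F hF (insertOp ρ ε n j g)) =
    ∫ p, inner ℂ (f (i.removeNth p)) (g (j.removeNth p)) *
      ((cross (p i) (∑ l, p l) * (F (kinetic ν p) * cross (p j) (∑ l, p l)) : ℝ) : ℂ)
      ∂(fockMeasure ρ ε (n + 1)) := by
  rw [L2.inner_def]
  exact integral_congr_ae (integrand_insertOp ρ ε ν n F hF i j f g)

/-- When both sides insert the same variable, φ₁ and φ₂ do not depend on it. Integrating it out
leaves a multiplication operator in the total momentum, since q×(q+p) = q×p. -/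
theorem inner_insertOp_self (n : ℕ) (F : ℝ → ℝ) (hF : ContinuousOn F (Ici 0)) (i : Fin (n + 1))
    (f g : Lp ℂ 2 (fockMeasure ρ ε n)) :
    Integrable (fun r => inner ℂ (f r) (g r) * (diagonalSymbol ρ ν ε F (∑ l, r l) : ℂ))
      (fockMeasure ρ ε n) ∧
    inner ℂ (insertOp ρ ε n i f) (mulOp ρ ε ν (n + 1) F hF (insertOp ρ ε n i g)) =
      (n + 1) * ∫ r, inner ℂ (f r) (g r) * (diagonalSymbol ρ ν ε F (∑ l, r l) : ℂ)
        ∂(fockMeasure ρ ε n) := by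
  have hint := (L2.integrable_inner (𝕜 := ℂ) (insertOp ρ ε n i f)
    (mulOp ρ ε ν (n + 1) F hF (insertOp ρ ε n i g))).congr
    (integrand_insertOp ρ ε ν n F hF i i f g)
  have hE : ∀ r : Fin n → Plane, ∫ q, (inner ℂ (f (i.removeNth (i.insertNth (α := fun _ => Plane) q r)))
      (g (i.removeNth (i.insertNth (α := fun _ => Plane) q r))) *
      ((cross (i.insertNth (α := fun _ => Plane) q r i)
        (∑ l, i.insertNth (α := fun _ => Plane) q r l) *
        (F (kinetic ν (i.insertNth (α := fun _ => Plane) q r)) *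
        cross (i.insertNth (α := fun _ => Plane) q r i)
          (∑ l, i.insertNth (α := fun _ => Plane) q r l)) : ℝ) : ℂ)) ∂(momentumMeasure ρ ε) =
      inner ℂ (f r) (g r) * (diagonalSymbol ρ ν ε F (∑ l, r l) : ℂ) := by
    intro r
    simp only [kinetic, Fin.sum_univ_succAbove _ i, Fin.insertNth_apply_same,
      Fin.insertNth_apply_succAbove, Fin.removeNth_insertNth, cross_add_self_left]
    rw [integral_const_mul, integral_complex_ofReal]
    unfold diagonalSymbol
    congr 3
    ext q
    ring
  have h := integral_fock_succ ρ ε n i hint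
  simp only [hE] at h
  rw [inner_insertOp]
  exact h

theorem diagOp_diagOp (n : ℕ) {F F' : ℝ → ℝ} (hF : ContinuousOn F (Ici 0))
    (hF' : ContinuousOn F' (Ici 0)) (φ : Fock ρ ε n) :
    diagOp ρ ε ν n F hF (diagOp ρ ε ν n F' hF' φ) =
      diagOp ρ ε ν n (fun t => F t * F' t) (hF.mul hF') φ := by
  refine Subtype.ext (Lp.ext ?_)
  filter_upwards [coeFn_diagOp ρ ε ν n F hF (diagOp ρ ε ν n F' hF' φ),
    coeFn_diagOp ρ ε ν n F' hF' φ, 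
      coeFn_diagOp ρ ε ν n (fun t => F t * F' t) (hF.mul hF') φ] with p h1 h2 h3
  rw [h1, h2, h3]
  push_cast
  ring

theorem diagOp_congr (n : ℕ) {F F' : ℝ → ℝ} (hF : ContinuousOn F (Ici 0))
    (hF' : ContinuousOn F' (Ici 0)) (h : ∀ t, 0 ≤ t → F t = F' t) (φ : Fock ρ ε n) :
    diagOp ρ ε ν n F hF φ = diagOp ρ ε ν n F' hF' φ := by
  refine Subtype.ext (Lp.ext ?_)
  filter_upwards [coeFn_diagOp ρ ε ν n F hF φ, coeFn_diagOp ρ ε ν n F' hF' φ] with p h1 h2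
  rw [h1, h2, h _ (by positivity)]

theorem integrand_diagOp (n : ℕ) {F : ℝ → ℝ} (hF : ContinuousOn F (Ici 0)) (φ₁ φ₂ : Fock ρ ε n) :
    (fun p => inner ℂ ((φ₁ : Lp ℂ 2 (fockMeasure ρ ε n)) p)
      ((diagOp ρ ε ν n F hF φ₂ : Lp ℂ 2 (fockMeasure ρ ε n)) p)) =ᵐ[fockMeasure ρ ε n]
    fun p => inner ℂ ((φ₁ : Lp ℂ 2 (fockMeasure ρ ε n)) p)
      ((φ₂ : Lp ℂ 2 (fockMeasure ρ ε n)) p) * ((F (ν ^ 2 / 2 * ‖∑ i, p i‖ ^ 2) : ℝ) : ℂ) := by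
  filter_upwards [coeFn_diagOp ρ ε ν n F hF φ₂] with p h
  rw [h, RCLike.inner_apply, RCLike.inner_apply]
  ring

theorem inner_diagOp (n : ℕ) {F : ℝ → ℝ} (hF : ContinuousOn F (Ici 0)) (φ₁ φ₂ : Fock ρ ε n) :
    Integrable (fun p => inner ℂ ((φ₁ : Lp ℂ 2 (fockMeasure ρ ε n)) p)
      ((φ₂ : Lp ℂ 2 (fockMeasure ρ ε n)) p) * ((F (ν ^ 2 / 2 * ‖∑ i, p i‖ ^ 2) : ℝ) : ℂ))
      (fockMeasure ρ ε n) ∧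
    inner ℂ φ₁ (diagOp ρ ε ν n F hF φ₂) = ∫ p, inner ℂ ((φ₁ : Lp ℂ 2 (fockMeasure ρ ε n)) p)
      ((φ₂ : Lp ℂ 2 (fockMeasure ρ ε n)) p) * ((F (ν ^ 2 / 2 * ‖∑ i, p i‖ ^ 2) : ℝ) : ℂ)
      ∂(fockMeasure ρ ε n) := by
  refine ⟨(L2.integrable_inner (𝕜 := ℂ) (φ₁ : Lp ℂ 2 (fockMeasure ρ ε n))
    (diagOp ρ ε ν n F hF φ₂ : Lp ℂ 2 (fockMeasure ρ ε n))).congr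
      (integrand_diagOp ρ ε ν n hF φ₁ φ₂), ?_⟩
  rw [Submodule.coe_inner, L2.inner_def]
  exact integral_congr_ae (integrand_diagOp ρ ε ν n hF φ₁ φ₂)

theorem norm_inner_insertOp_le (hν : 0 < ν) {B : ℝ} (hB : 0 ≤ B) (hV : ∀ q, VHat ρ ε q ≤ B)
    (n : ℕ) {lam : ℝ} (hlam : 0 < lam) {F : ℝ → ℝ} (hF : ContinuousOn F (Ici 0))
    (hF0 : ∀ t, 0 ≤ t → 0 ≤ F t) (hF1 : ∀ t, 0 ≤ t → F t ≤ 1 / (lam + t)) {i j : Fin (n + 1)}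
    (hij : i ≠ j) (φ₁ φ₂ : Fock ρ ε n) :
    ‖inner ℂ (insertOp ρ ε n i φ₁) (mulOp ρ ε ν (n + 1) F hF (insertOp ρ ε n j φ₂))‖ ≤
      (n + 1) * (2 / ν ^ 2) * (B * (8 * Real.pi)) * (2 / ν ^ 2) * ‖sqrtNegL0 ρ ε ν n φ₁‖ *
        ‖sqrtNegL0 ρ ε ν n φ₂‖ := by
  have hmφ : ∀ (i : Fin (n + 1)) (φ : Fock ρ ε n), Measurable fun p : Fin (n + 1) → Plane =>
      ‖(φ : Lp ℂ 2 (fockMeasure ρ ε n)) (i.removeNth p)‖ₑ ^ 2 := fun i φ =>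
    ((Lp.stronglyMeasurable _).enorm.pow_const 2).comp
      (by unfold Fin.removeNth; fun_prop : Measurable fun p : Fin (n + 1) → Plane => i.removeNth p)
  have hmW : ∀ i j : Fin (n + 1), Measurable fun p : Fin (n + 1) → Plane =>
      schurWeight (p i) (p j) (∑ l, p l) := fun i j => by
    unfold schurWeight
    exact (schurKernel_measurable (by fun_prop) (by fun_prop)).add
      (schurKernel_measurable (by fun_prop) (by fun_prop))
  have hm : ∀ (i j : Fin (n + 1)) (φ : Fock ρ ε n), Measurable fun p : Fin (n + 1) → Plane =>
      ENNReal.ofReal (2 / ν ^ 2 * (‖p i‖ ^ 2 * schurWeight (p i) (p j) (∑ l, p l)) *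
        ‖∑ l, p l - p i‖ ^ 2) * ‖(φ : Lp ℂ 2 (fockMeasure ρ ε n)) (i.removeNth p)‖ₑ ^ 2 := by
    intro i j φ
    have h1 := hmφ i φ
    have h2 := hmW i j
    fun_prop
  rw [inner_insertOp]
  refine norm_integral_le_of_sq_le (hm i j φ₁) (hm j i φ₂) (norm_nonneg _) (norm_nonneg _)
    (by positivity) (fun p => ?_) (lintegral_schurWeight_le ρ ν hν hB hV n hij.symm φ₁)
    (lintegral_schurWeight_le ρ ν hν hB hV n hij φ₂)
  have hk := kinetic_nonneg ν p
  have hpt := offDiagonal_le ν hν hlam (p i) (p j) (∑ l, p l) (hF0 _ hk) (hF1 _ hk)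
  set c := cross (p i) (∑ l, p l) * (F (kinetic ν p) * cross (p j) (∑ l, p l))
  have hc : ‖(c : ℂ)‖ₑ ^ 2 = ENNReal.ofReal (c ^ 2) := by
    rw [← ofReal_norm, Complex.norm_real, Real.norm_eq_abs, ← ENNReal.ofReal_pow (abs_nonneg _),
      sq_abs]
  have hw := schurWeight_nonneg (p i) (p j) (∑ l, p l)
  have hle := ENNReal.ofReal_le_ofReal hpt
  rw [ENNReal.ofReal_mul (by positivity)] at hle
  rw [RCLike.inner_apply, enorm_mul, enorm_mul, RCLike.enorm_conj, mul_pow, mul_pow, hc]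
  refine (mul_le_mul_right hle _).trans_eq ?_
  ring

/-- The minus sign reflects L₀ = -(-L₀). The symbol is returned as an abstract function known by its
values, which keeps the later integral identities short. -/
theorem inner_opG_opL0 (lhat : ℝ) {lam : ℝ} (hlam : 0 < lam) (j n : ℕ) (φ₁ φ₂ : Fock ρ ε n) :
    ∃ Gs : ℝ → ℝ, (∀ t, Gs t = funG ν j (funL lhat ε (lam + t)) * t) ∧
    Integrable (fun p => inner ℂ ((φ₁ : Lp ℂ 2 (fockMeasure ρ ε n)) p)
      ((φ₂ : Lp ℂ 2 (fockMeasure ρ ε n)) p) * ((Gs (ν ^ 2 / 2 * ‖∑ i, p i‖ ^ 2) : ℝ) : ℂ))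
      (fockMeasure ρ ε n) ∧
    inner ℂ φ₁ ((((4 / ν ^ 4 : ℝ) : ℂ) •
      (opG ρ lhat ν hlam ε j n).comp (opL0 ρ ε ν n)) φ₂) =
      -(((4 / ν ^ 4 : ℝ) : ℂ) * ∫ p, inner ℂ ((φ₁ : Lp ℂ 2 (fockMeasure ρ ε n)) p)
        ((φ₂ : Lp ℂ 2 (fockMeasure ρ ε n)) p) * ((Gs (ν ^ 2 / 2 * ‖∑ i, p i‖ ^ 2) : ℝ) : ℂ)
        ∂(fockMeasure ρ ε n)) := by
  have hGc : ContinuousOn (fun t => funG ν j (funL lhat ε (lam + t)) * id t) (Ici 0) :=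
    (funG_funL_continuousOn ν lhat ε hlam j).mul continuousOn_id
  obtain ⟨hGi, hGv⟩ := inner_diagOp ρ ε ν n hGc φ₁ φ₂
  refine ⟨_, fun t => rfl, hGi, ?_⟩
  have e : (((4 / ν ^ 4 : ℝ) : ℂ) • (opG ρ lhat ν hlam ε j n).comp (opL0 ρ ε ν n)) φ₂ =
      -(((4 / ν ^ 4 : ℝ) : ℂ) • diagOp ρ ε ν n _ hGc φ₂) := by
    rw [smul_apply, ContinuousLinearMap.comp_apply, opL0, neg_apply, map_neg, smul_neg]
    unfold opG negL0
    rw [diagOp_diagOp]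
  have e2 : inner ℂ φ₁ (((4 / ν ^ 4 : ℝ) : ℂ) • diagOp ρ ε ν n _ hGc φ₂) =
      ((4 / ν ^ 4 : ℝ) : ℂ) * inner ℂ φ₁ (diagOp ρ ε ν n _ hGc φ₂) := by
    rw [Submodule.coe_inner, Submodule.coe_smul, inner_smul_right, ← Submodule.coe_inner]
  rw [e, inner_neg_right, e2, hGv]
  rfl

set_option maxHeartbeats 1000000 in
-- Diagonal insertions carry the main term and off-diagonal ones are pure error. The constant is
-- uniform in λ and j and grows linearly in n.
theorem exists_form_bound (lhat : ℝ) (hlhat : 0 < lhat) (hν : 0 < ν) :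
    ∃ C : ℝ, 0 ≤ C ∧ ∀ (lam : ℝ) (hlam : 0 < lam) (ε : ℝ), 0 < ε → ε < 1 / 2 →
      ∀ n j : ℕ, 1 ≤ j → ∀ φ₁ φ₂ : Fock ρ ε n,
      ‖inner ℂ (aPlus ρ lhat ε n φ₁) (diagOp ρ ε ν (n + 1) (resolventSymbol lhat ν lam ε j)
          (continuousOn_resolventSymbol lhat ν ε hlam j) (aPlus ρ lhat ε n φ₂)) +
        inner ℂ φ₁ ((((4 / ν ^ 4 : ℝ) : ℂ) •
          (opG ρ lhat ν hlam ε (j + 1) n).comp (opL0 ρ ε ν n)) φ₂)‖ ≤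
      C * (n + 1) * (1 / Real.log (1 / ε)) * ‖sqrtNegL0 ρ ε ν n φ₁‖ *
        ‖sqrtNegL0 ρ ε ν n φ₂‖ := by
  obtain ⟨B, hB, hVB⟩ := exists_VHat_bound ρ
  obtain ⟨C₁, hC₁, hD⟩ := exists_diagonalSymbol_bound ρ lhat ν hlhat hν
  have hB0 : 0 ≤ B := by linarith
  refine ⟨C₁ * (2 / ν ^ 2) + lhat ^ 2 * ((2 / ν ^ 2) * (B * (8 * Real.pi)) * (2 / ν ^ 2)),
    by positivity, fun lam hlam ε h0 h1 n j hj φ₁ φ₂ => ?_⟩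
  have hlog : 0 < Real.log (1 / ε) :=
    (Real.log_pos (by norm_num : (1 : ℝ) < 2)).trans_le (log_two_le_log_inv h0 h1)
  set F := resolventSymbol lhat ν lam ε j
  have hF := continuousOn_resolventSymbol lhat ν ε hlam j
  set N := ‖sqrtNegL0 ρ ε ν n φ₁‖ * ‖sqrtNegL0 ρ ε ν n φ₂‖ with hN
  have hN0 : 0 ≤ N := by positivity
  set K := (2 / ν ^ 2) * (B * (8 * Real.pi)) * (2 / ν ^ 2) with hK
  have hK0 : 0 ≤ K := by positivity
  set c : ℝ := -(1 / (n + 1) * (lhat / √(Real.log (1 / ε)))) with hc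
  -- There are n + 1 diagonal pairs, each contributing (n+1) Z. The combinatorial factor (n+1)² is
  -- thus exactly cancelled by the 1/(n+1) in each A₊.
  have hc2 : c ^ 2 * (n + 1) ^ 2 = lhat ^ 2 / Real.log (1 / ε) := by
    rw [hc, neg_sq, mul_pow, div_pow, div_pow, Real.sq_sqrt hlog.le]
    field_simp
  set T : Fin (n + 1) → Fin (n + 1) → ℂ := fun i j => inner ℂ (insertOp ρ ε n i φ₁)
    (mulOp ρ ε ν (n + 1) F hF (insertOp ρ ε n j φ₂)) with hT
  set f : (Fin n → Plane) → ℂ := fun p => inner ℂ ((φ₁ : Lp ℂ 2 (fockMeasure ρ ε n)) p)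
    ((φ₂ : Lp ℂ 2 (fockMeasure ρ ε n)) p) with hf
  set Z : ℂ := ∫ r, f r * (diagonalSymbol ρ ν ε F (∑ l, r l) : ℂ) ∂(fockMeasure ρ ε n) with hZ
  have hZi : Integrable (fun r => f r * (diagonalSymbol ρ ν ε F (∑ l, r l) : ℂ))
      (fockMeasure ρ ε n) := (inner_insertOp_self ρ ε ν n F hF 0 φ₁ φ₂).1
  have hTii : ∀ i, T i i = (n + 1) * Z := fun i => (inner_insertOp_self ρ ε ν n F hF i φ₁ φ₂).2
  have hTij : ∀ i l, i ≠ l → ‖T i l‖ ≤ (n + 1) * K * N := fun i l hij => by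
    refine (norm_inner_insertOp_le ρ ε ν hν hB0 (fun q => (hVB ε h0 q).1) n hlam hF
      (fun t ht => resolventSymbol_nonneg lhat ν ε hlam j ht)
      (fun t ht => resolventSymbol_le lhat ν ε hlam j ht) hij φ₁ φ₂).trans_eq ?_
    rw [hK, hN]; ring
  have hA : inner ℂ (aPlus ρ lhat ε n φ₁) (diagOp ρ ε ν (n + 1) F hF (aPlus ρ lhat ε n φ₂)) =
      (c : ℂ) ^ 2 * ∑ i, ∑ j, T i j := by
    rw [Submodule.coe_inner, coe_diagOp, coe_aPlus, coe_aPlus, map_smul, inner_smul_left,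
      inner_smul_right, map_sum, sum_inner, Complex.conj_ofReal, ← mul_assoc, ← sq]
    simp only [inner_sum, hT, hc]
  have hsum : (c : ℂ) ^ 2 * ∑ i, ∑ j, T i j = ((lhat ^ 2 / Real.log (1 / ε) : ℝ) : ℂ) * Z +
      (c : ℂ) ^ 2 * ∑ i, ∑ j, (T i j - if i = j then (n + 1) * Z else 0) := by
    have e : ∑ i : Fin (n + 1), ∑ j : Fin (n + 1), (if i = j then ((n : ℂ) + 1) * Z else 0) =
        (n + 1) ^ 2 * Z := by
      simp; ring
    simp only [Finset.sum_sub_distrib]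
    rw [e, ← hc2]
    push_cast
    ring
  have hoff : ‖(c : ℂ) ^ 2 * ∑ i, ∑ j, (T i j - if i = j then ((n : ℂ) + 1) * Z else 0)‖ ≤
      lhat ^ 2 / Real.log (1 / ε) * ((n + 1) * K * N) := by
    rw [norm_mul, norm_pow, Complex.norm_real, Real.norm_eq_abs, sq_abs, ← hc2, mul_assoc (c ^ 2)]
    refine mul_le_mul_of_nonneg_left ?_ (sq_nonneg _)
    -- After subtraction the diagonal entries vanish, so one bound serves for all (n+1)² pairs.
    have hle : ∀ i j, ‖T i j - if i = j then ((n : ℂ) + 1) * Z else 0‖ ≤ (n + 1) * K * N := by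
      intro i j
      by_cases h : i = j
      · subst h
        rw [if_pos rfl, hTii, sub_self, norm_zero]
        positivity
      · rw [if_neg h, sub_zero]
        exact hTij i j h
    refine (norm_sum_le_of_le _ fun i _ => norm_sum_le_of_le _ fun j _ => hle i j).trans_eq ?_
    simp
    ring
  obtain ⟨Gs, hGs, hGi, hG⟩ := inner_opG_opL0 ρ ε ν lhat hlam (j + 1) n φ₁ φ₂
  have hmain : ((lhat ^ 2 / Real.log (1 / ε) : ℝ) : ℂ) * Z - ((4 / ν ^ 4 : ℝ) : ℂ) *
      ∫ p, f p * ((Gs (ν ^ 2 / 2 * ‖∑ i, p i‖ ^ 2) : ℝ) : ℂ) ∂(fockMeasure ρ ε n) =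
      ∫ p, f p * ((lhat ^ 2 / Real.log (1 / ε) * diagonalSymbol ρ ν ε F (∑ l, p l) -
        4 / ν ^ 4 * Gs (ν ^ 2 / 2 * ‖∑ i, p i‖ ^ 2) : ℝ) : ℂ) ∂(fockMeasure ρ ε n) := by
    rw [hZ, ← integral_const_mul, ← integral_const_mul,
      ← integral_sub (hZi.const_mul _) (hGi.const_mul _)]
    congr 1; ext p; push_cast; ring
  have hdiag := norm_integral_fock_le ρ ε ν hν n φ₁ φ₂
    (fun p => ((lhat ^ 2 / Real.log (1 / ε) * diagonalSymbol ρ ν ε F (∑ l, p l) -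
        4 / ν ^ 4 * Gs (ν ^ 2 / 2 * ‖∑ i, p i‖ ^ 2) : ℝ) : ℂ))
    (K := C₁ * (1 / Real.log (1 / ε))) (by positivity) (fun p => by
      rw [Complex.norm_real, Real.norm_eq_abs]
      refine le_trans (le_of_eq ?_) (hD lam hlam ε h0 h1 j hj (∑ l, p l))
      congr 2
      rw [hGs]
      field_simp
      ring)
  rw [hA, hsum, hG, add_right_comm, ← sub_eq_add_neg, hmain]
  refine (norm_add_le _ _).trans ((add_le_add hdiag hoff).trans ?_)
  have e1 : C₁ * (1 / Real.log (1 / ε)) * (2 / ν ^ 2) * ‖sqrtNegL0 ρ ε ν n φ₁‖ *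
      ‖sqrtNegL0 ρ ε ν n φ₂‖ = C₁ * (2 / ν ^ 2) * (1 / Real.log (1 / ε)) * N * 1 := by
    rw [hN]; ring
  have e2 : (C₁ * (2 / ν ^ 2) + lhat ^ 2 * K) * (n + 1) * (1 / Real.log (1 / ε)) *
      ‖sqrtNegL0 ρ ε ν n φ₁‖ * ‖sqrtNegL0 ρ ε ν n φ₂‖ =
      C₁ * (2 / ν ^ 2) * (1 / Real.log (1 / ε)) * N * (n + 1) +
      lhat ^ 2 / Real.log (1 / ε) * ((n + 1) * K * N) := by rw [hN]; ring
  rw [e1, e2]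
  gcongr
  have : (0 : ℝ) ≤ n := n.cast_nonneg
  linarith

end Form

/-! ### Positive operators on a Hilbert space -/

section Hilbert

open scoped ComplexOrder in
-- In the C*-algebra of bounded operators, anything above the strictly positive element λ·1 is
-- invertible.
theorem isUnit_smul_id_add {E : Type*} [NormedAddCommGroup E] [InnerProductSpace ℂ E]
    [CompleteSpace E] {lam : ℝ} (hlam : 0 < lam) {P : E →L[ℂ] E} (hP : P.IsPositive) :
    IsUnit ((lam : ℂ) • ContinuousLinearMap.id ℂ E + P) := by
  have h1 : IsStrictlyPositive ((lam : ℂ) • (1 : E →L[ℂ] E)) :=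
    IsStrictlyPositive.smul (by exact_mod_cast hlam) isStrictlyPositive_one
  refine CStarAlgebra.isUnit_of_le ((lam : ℂ) • (1 : E →L[ℂ] E)) ?_ h1
  exact le_add_of_nonneg_right ((ContinuousLinearMap.nonneg_iff_isPositive P).2 hP)

variable {E : Type*} [NormedAddCommGroup E] [InnerProductSpace ℂ E]

theorem apply_ringInverse {T : E →L[ℂ] E} (hu : IsUnit T) (x : E) : T (Ring.inverse T x) = x :=
  congrArg (fun S : E →L[ℂ] E => S x) (Ring.mul_inverse_cancel T hu)

theorem ringInverse_apply {T : E →L[ℂ] E} (hu : IsUnit T) (x : E) : Ring.inverse T (T x) = x :=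
  congrArg (fun S : E →L[ℂ] E => S x) (Ring.inverse_mul_cancel T hu)

theorem inner_ringInverse_comm {T : E →L[ℂ] E} (hT : T.IsPositive) (hu : IsUnit T) (x y : E) :
    inner ℂ (Ring.inverse T x) y = inner ℂ x (Ring.inverse T y) := by
  have h : inner ℂ (T (Ring.inverse T x)) (Ring.inverse T y) =
      inner ℂ (Ring.inverse T x) (T (Ring.inverse T y)) := hT.1 _ _
  rw [apply_ringInverse hu, apply_ringInverse hu] at h
  exact h.symm

theorem isPositive_ringInverse {T : E →L[ℂ] E} (hT : T.IsPositive) (hu : IsUnit T) :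
    (Ring.inverse T).IsPositive := by
  rw [ContinuousLinearMap.isPositive_iff]
  refine ⟨fun x y => inner_ringInverse_comm hT hu x y, fun x => ?_⟩
  rw [inner_ringInverse_comm hT hu]
  have h := hT.inner_nonneg_left (Ring.inverse T x)
  rwa [apply_ringInverse hu] at h

/-- The second resolvent identity, in weak form. -/
theorem inner_ringInverse_eq {T : E →L[ℂ] E} (hT : T.IsPositive) (hu : IsUnit T) {a w s e : E}
    (hs : T s = w + e) :
    inner ℂ a (Ring.inverse T w) = inner ℂ a s - inner ℂ (Ring.inverse T a) e := by
  have h : s = Ring.inverse T w + Ring.inverse T e := by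
    rw [← map_add, ← hs, ringInverse_apply hu]
  rw [inner_ringInverse_comm hT hu, h, inner_add_right]
  ring

/-- An energy estimate: for a solution v of Tv = w it is applied with X = (λ-L₀)^{1/2} v and Y =
(λ-L₀)^{-1/2} w. -/
theorem norm_le_of_inner_eq {v w X Y : E} (h : inner ℂ X Y = inner ℂ v w)
    (hX : ‖X‖ ^ 2 ≤ (inner ℂ v w).re) : ‖X‖ ≤ ‖Y‖ := by
  have h1 : ‖X‖ ^ 2 ≤ ‖X‖ * ‖Y‖ := by
    rw [← h] at hX
    exact hX.trans ((Complex.re_le_norm _).trans (norm_inner_le_norm _ _))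
  by_contra! hlt
  have := norm_nonneg Y
  nlinarith

end Hilbert

/-! ### Diagonal operators and the operators `H_j` -/

section OperatorsH

variable (ρ : Mollifier) (ε ν : ℝ)

theorem inner_diagOp_comm (n : ℕ) {F : ℝ → ℝ} (hF : ContinuousOn F (Ici 0))
    (φ₁ φ₂ : Fock ρ ε n) :
    inner ℂ (diagOp ρ ε ν n F hF φ₁) φ₂ = inner ℂ φ₁ (diagOp ρ ε ν n F hF φ₂) := by
  rw [Submodule.coe_inner, Submodule.coe_inner, L2.inner_def, L2.inner_def]
  refine integral_congr_ae ?_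
  filter_upwards [coeFn_diagOp ρ ε ν n F hF φ₁, coeFn_diagOp ρ ε ν n F hF φ₂] with p h1 h2
  rw [h1, h2, RCLike.inner_apply, RCLike.inner_apply, map_mul, Complex.conj_ofReal]
  ring

theorem norm_diagOp_le (n : ℕ) {F F' : ℝ → ℝ} (hF : ContinuousOn F (Ici 0))
    (hF' : ContinuousOn F' (Ici 0)) (h : ∀ t, 0 ≤ t → |F t| ≤ |F' t|) (φ : Fock ρ ε n) :
    ‖diagOp ρ ε ν n F hF φ‖ ≤ ‖diagOp ρ ε ν n F' hF' φ‖ := by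
  change ‖(diagOp ρ ε ν n F hF φ : Lp ℂ 2 (fockMeasure ρ ε n))‖ ≤
    ‖(diagOp ρ ε ν n F' hF' φ : Lp ℂ 2 (fockMeasure ρ ε n))‖
  refine Lp.norm_le_norm_of_ae_le ?_
  filter_upwards [coeFn_diagOp ρ ε ν n F hF φ, coeFn_diagOp ρ ε ν n F' hF' φ] with p h1 h2
  rw [h1, h2, norm_mul, norm_mul, Complex.norm_real, Complex.norm_real]
  exact mul_le_mul_of_nonneg_right (h _ (by positivity)) (norm_nonneg _)

theorem continuousOn_sqrt_of_continuousOn {F : ℝ → ℝ} (hF : ContinuousOn F (Ici 0)) :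
    ContinuousOn (fun t => √(F t)) (Ici 0) := Real.continuous_sqrt.comp_continuousOn hF

theorem inner_diagOp_self (n : ℕ) {F : ℝ → ℝ} (hF : ContinuousOn F (Ici 0))
    (h0 : ∀ t, 0 ≤ t → 0 ≤ F t) (φ : Fock ρ ε n) :
    inner ℂ φ (diagOp ρ ε ν n F hF φ) =
      ((‖diagOp ρ ε ν n (fun t => √(F t)) (continuousOn_sqrt_of_continuousOn hF) φ‖ ^ 2 : ℝ) :
        ℂ) := by
  have hc := continuousOn_sqrt_of_continuousOn hF
  have e : diagOp ρ ε ν n F hF φ =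
      diagOp ρ ε ν n (fun t => √(F t)) hc (diagOp ρ ε ν n (fun t => √(F t)) hc φ) := by
    rw [diagOp_diagOp]
    exact diagOp_congr ρ ε ν n hF (hc.mul hc) (fun t ht => (Real.mul_self_sqrt (h0 t ht)).symm) φ
  rw [e, ← inner_diagOp_comm, Complex.ofReal_pow]
  exact inner_self_eq_norm_sq_to_K (𝕜 := ℂ) (E := Fock ρ ε n) _

theorem isPositive_diagOp (n : ℕ) {F : ℝ → ℝ} (hF : ContinuousOn F (Ici 0))
    (h0 : ∀ t, 0 ≤ t → 0 ≤ F t) : (diagOp ρ ε ν n F hF).IsPositive := by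
  refine ⟨fun φ₁ φ₂ => inner_diagOp_comm ρ ε ν n hF φ₁ φ₂, fun φ => ?_⟩
  rw [ContinuousLinearMap.reApplyInnerSelf_apply, inner_diagOp_comm,
    inner_diagOp_self ρ ε ν n hF h0]
  change 0 ≤ ((‖_‖ ^ 2 : ℝ) : ℂ).re
  rw [Complex.ofReal_re]
  positivity

/-- Positivity propagates: H_j ≥ 0 makes λ - L₀ + H_j positive and invertible, its inverse is
positive, and conjugation by A₊ gives H_{j+1} ≥ 0. All chaoses are treated together because each
step raises n by one. -/
theorem isPositive_opH_and_isUnit (lhat : ℝ) {lam : ℝ} (hlam : 0 < lam) {j : ℕ} (hj : 1 ≤ j) :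
    ∀ n : ℕ, (opH ρ lhat ν lam ε j n).IsPositive ∧
      ((lam : ℂ) • ContinuousLinearMap.id ℂ (Fock ρ ε n) - opL0 ρ ε ν n +
        opH ρ lhat ν lam ε j n).IsPositive ∧
      IsUnit ((lam : ℂ) • ContinuousLinearMap.id ℂ (Fock ρ ε n) - opL0 ρ ε ν n +
        opH ρ lhat ν lam ε j n) := by
  have key : ∀ i n : ℕ, (opH ρ lhat ν lam ε i n).IsPositive →
      (opH ρ lhat ν lam ε i n).IsPositive ∧
      ((lam : ℂ) • ContinuousLinearMap.id ℂ (Fock ρ ε n) - opL0 ρ ε ν n +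
        opH ρ lhat ν lam ε i n).IsPositive ∧
      IsUnit ((lam : ℂ) • ContinuousLinearMap.id ℂ (Fock ρ ε n) - opL0 ρ ε ν n +
        opH ρ lhat ν lam ε i n) := by
    intro i n hH
    have hL : (negL0 ρ ε ν n).IsPositive :=
      isPositive_diagOp ρ ε ν n continuousOn_id fun t ht => ht
    have e : (lam : ℂ) • ContinuousLinearMap.id ℂ (Fock ρ ε n) - opL0 ρ ε ν n +
        opH ρ lhat ν lam ε i n = (lam : ℂ) • ContinuousLinearMap.id ℂ (Fock ρ ε n) +
        (negL0 ρ ε ν n + opH ρ lhat ν lam ε i n) := by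
      rw [opL0, sub_neg_eq_add, add_assoc]
    have hid : ((lam : ℂ) • ContinuousLinearMap.id ℂ (Fock ρ ε n)).IsPositive :=
      ContinuousLinearMap.isPositive_id.smul_of_nonneg (by
        rw [Complex.le_def]; simpa using hlam.le)
    rw [e]
    exact ⟨hH, hid.add (hL.add hH), isUnit_smul_id_add hlam (hL.add hH)⟩
  induction j, hj using Nat.le_induction with
  | base => exact fun n => key 1 n ContinuousLinearMap.isPositive_zero
  | succ j hj ih =>
    intro n
    refine key (j + 1) n ?_
    obtain ⟨k, rfl⟩ : ∃ k, j = k + 1 := ⟨j - 1, by omega⟩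
    obtain ⟨-, hp, hu⟩ := ih (n + 1)
    exact (isPositive_ringInverse hp hu).adjoint_conj (aPlus ρ lhat ε n)

theorem opH_succ (lhat lam : ℝ) {j : ℕ} (hj : 1 ≤ j) (n : ℕ) :
    opH ρ lhat ν lam ε (j + 1) n = (ContinuousLinearMap.adjoint (aPlus ρ lhat ε n)).comp
      ((Ring.inverse ((lam : ℂ) • ContinuousLinearMap.id ℂ (Fock ρ ε (n + 1)) -
        opL0 ρ ε ν (n + 1) + opH ρ lhat ν lam ε j (n + 1))).comp (aPlus ρ lhat ε n)) := by
  obtain ⟨k, rfl⟩ : ∃ k, j = k + 1 := ⟨j - 1, by omega⟩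
  rfl

theorem continuousOn_inv_sqrt {lam : ℝ} (hlam : 0 < lam) :
    ContinuousOn (fun t => 1 / √(lam + t)) (Ici 0) :=
  continuousOn_const.div (by fun_prop) fun t ht => by
    have : (0 : ℝ) ≤ t := ht
    positivity

/-- The graph norm of any operator above `λ - L₀` controls its resolvent. -/
theorem norm_sqrtNegL0_ringInverse_le (lhat : ℝ) {lam : ℝ} (hlam : 0 < lam) {j : ℕ} (hj : 1 ≤ j)
    (n : ℕ) (w : Fock ρ ε n) :
    ‖sqrtNegL0 ρ ε ν n (Ring.inverse ((lam : ℂ) • ContinuousLinearMap.id ℂ (Fock ρ ε n) -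
      opL0 ρ ε ν n + opH ρ lhat ν lam ε j n) w)‖ ≤
      ‖diagOp ρ ε ν n (fun t => 1 / √(lam + t)) (continuousOn_inv_sqrt hlam) w‖ := by
  obtain ⟨hH, hp, hu⟩ := isPositive_opH_and_isUnit ρ ε ν lhat hlam hj n
  set T := (lam : ℂ) • ContinuousLinearMap.id ℂ (Fock ρ ε n) - opL0 ρ ε ν n +
    opH ρ lhat ν lam ε j n with hT
  set v := Ring.inverse T w with hv
  have hTv : T v = w := apply_ringInverse hu w
  have hcX : ContinuousOn (fun t => lam + t) (Ici 0) := by fun_prop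
  have hX0 : ∀ t : ℝ, 0 ≤ t → 0 ≤ lam + t := fun t ht => by linarith
  have hcs := continuousOn_sqrt_of_continuousOn hcX
  have h1 : ‖sqrtNegL0 ρ ε ν n v‖ ≤ ‖diagOp ρ ε ν n (fun t => √(lam + t)) hcs v‖ := by
    refine norm_diagOp_le ρ ε ν n _ _ (fun t ht => ?_) v
    rw [abs_of_nonneg (Real.sqrt_nonneg _), abs_of_nonneg (Real.sqrt_nonneg _)]
    exact Real.sqrt_le_sqrt (by linarith)
  -- The pairing ⟨v, w⟩ = ⟨v, (λ-L₀)v⟩ + ⟨v, H_j v⟩ dominates ‖(λ-L₀)^{1/2} v‖² because H_j ≥ 0.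
  refine h1.trans (norm_le_of_inner_eq (v := v) (w := w) ?_ ?_)
  · rw [inner_diagOp_comm, diagOp_diagOp]
    congr 1
    refine Subtype.ext (Lp.ext ?_)
    filter_upwards [coeFn_diagOp ρ ε ν n (fun t => √(lam + t) * (1 / √(lam + t)))
      (hcs.mul (continuousOn_inv_sqrt hlam)) w] with p h
    have : √(lam + ν ^ 2 / 2 * ‖∑ i, p i‖ ^ 2) ≠ 0 := by positivity
    rw [h, mul_one_div_cancel this, Complex.ofReal_one, one_mul]
  · have e1 : T v = diagOp ρ ε ν n (fun t => lam + t) hcX v + opH ρ lhat ν lam ε j n v := by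
      have : (lam : ℂ) • v + negL0 ρ ε ν n v = diagOp ρ ε ν n (fun t => lam + t) hcX v := by
        refine Subtype.ext (Lp.ext ?_)
        filter_upwards [coeFn_diagOp ρ ε ν n (fun t => lam + t) hcX v,
          coeFn_diagOp ρ ε ν n id continuousOn_id v,
          Lp.coeFn_add ((lam : ℂ) • (v : Lp ℂ 2 (fockMeasure ρ ε n)))
            (negL0 ρ ε ν n v : Lp ℂ 2 (fockMeasure ρ ε n)),
          Lp.coeFn_smul (lam : ℂ) (v : Lp ℂ 2 (fockMeasure ρ ε n))] with p a1 a2 a3 a4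
        rw [a1]
        refine a3.trans ?_
        unfold negL0
        rw [Pi.add_apply, a4, a2, Pi.smul_apply, smul_eq_mul, id]
        push_cast
        ring
      rw [← this, hT]
      simp [opL0]
    have e2 := inner_diagOp_self ρ ε ν n hcX hX0 v
    have e3 := hH.re_inner_nonneg_right v
    rw [← hTv, e1, inner_add_right, Complex.add_re, e2, Complex.ofReal_re]
    exact le_add_of_nonneg_right e3

/-- The counterpart for S_j of the bound for the true resolvent, here by comparing symbols: √t/(λ+t)
≤ 1/√(λ+t). -/
theorem norm_sqrtNegL0_resolventSymbol_le (lhat : ℝ) {lam : ℝ} (hlam : 0 < lam) (j n : ℕ)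
    (w : Fock ρ ε n) :
    ‖sqrtNegL0 ρ ε ν n (diagOp ρ ε ν n (resolventSymbol lhat ν lam ε j)
      (continuousOn_resolventSymbol lhat ν ε hlam j) w)‖ ≤
      ‖diagOp ρ ε ν n (fun t => 1 / √(lam + t)) (continuousOn_inv_sqrt hlam) w‖ := by
  unfold sqrtNegL0
  rw [diagOp_diagOp]
  refine norm_diagOp_le ρ ε ν n _ _ (fun t ht => ?_) w
  have h0 := resolventSymbol_nonneg lhat ν ε hlam j ht
  have hp : 0 < √(lam + t) := Real.sqrt_pos.2 (by linarith)
  rw [abs_of_nonneg (by positivity), abs_of_nonneg (by positivity), le_div_iff₀ hp]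
  calc √t * resolventSymbol lhat ν lam ε j t * √(lam + t)
      ≤ √(lam + t) * (1 / (lam + t)) * √(lam + t) := by
        gcongr
        · linarith
        · exact resolventSymbol_le lhat ν ε hlam j ht
    _ = √(lam + t) ^ 2 * (1 / (lam + t)) := by ring
    _ = 1 := by
        rw [Real.sq_sqrt (by linarith)]
        exact mul_one_div_cancel (by linarith)

/-- This is T_j S_j = 1 + E_j S_j: the approximate resolvent fails to invert T_j exactly by the
operator that the induction controls. -/
theorem apply_resolventSymbol (lhat : ℝ) {lam : ℝ} (hlam : 0 < lam) (j n : ℕ) (w : Fock ρ ε n) :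
    ((lam : ℂ) • ContinuousLinearMap.id ℂ (Fock ρ ε n) - opL0 ρ ε ν n +
      opH ρ lhat ν lam ε j n) (diagOp ρ ε ν n (resolventSymbol lhat ν lam ε j)
        (continuousOn_resolventSymbol lhat ν ε hlam j) w) =
    w + (opH ρ lhat ν lam ε j n + ((4 / ν ^ 4 : ℝ) : ℂ) •
      (opG ρ lhat ν hlam ε j n).comp (opL0 ρ ε ν n))
        (diagOp ρ ε ν n (resolventSymbol lhat ν lam ε j)
          (continuousOn_resolventSymbol lhat ν ε hlam j) w) := by
  set s := diagOp ρ ε ν n (resolventSymbol lhat ν lam ε j)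
    (continuousOn_resolventSymbol lhat ν ε hlam j) w with hs
  have key : ((lam : ℂ) • s + negL0 ρ ε ν n s) + ((4 / ν ^ 4 : ℝ) : ℂ) •
      opG ρ lhat ν hlam ε j n (negL0 ρ ε ν n s) = w := by
    refine Subtype.ext (Lp.ext ?_)
    filter_upwards [coeFn_diagOp ρ ε ν n _ (continuousOn_resolventSymbol lhat ν ε hlam j) w,
      coeFn_diagOp ρ ε ν n id continuousOn_id s,
      coeFn_diagOp ρ ε ν n _ (funG_funL_continuousOn ν lhat ε hlam j) (negL0 ρ ε ν n s),
      Lp.coeFn_add ((lam : ℂ) • (s : Lp ℂ 2 (fockMeasure ρ ε n)) +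
        (negL0 ρ ε ν n s : Lp ℂ 2 (fockMeasure ρ ε n))) (((4 / ν ^ 4 : ℝ) : ℂ) •
          (opG ρ lhat ν hlam ε j n (negL0 ρ ε ν n s) : Lp ℂ 2 (fockMeasure ρ ε n))),
      Lp.coeFn_add ((lam : ℂ) • (s : Lp ℂ 2 (fockMeasure ρ ε n)))
        (negL0 ρ ε ν n s : Lp ℂ 2 (fockMeasure ρ ε n)),
      Lp.coeFn_smul (lam : ℂ) (s : Lp ℂ 2 (fockMeasure ρ ε n)),
      Lp.coeFn_smul ((4 / ν ^ 4 : ℝ) : ℂ)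
        (opG ρ lhat ν hlam ε j n (negL0 ρ ε ν n s) : Lp ℂ 2 (fockMeasure ρ ε n))]
      with p a1 a2 a3 a4 a5 a6 a7
    refine a4.trans ?_
    rw [Pi.add_apply, a5, a7, Pi.add_apply, a6, Pi.smul_apply, Pi.smul_apply]
    unfold opG negL0 at *
    rw [a3, a2, hs, a1]
    set t := ν ^ 2 / 2 * ‖∑ i, p i‖ ^ 2
    have ht : 0 ≤ t := by positivity
    have hg := one_le_one_add_funG ν j (funL_nonneg lhat ε (by linarith : 0 < lam + t))
    have hd : lam + t * (1 + 4 / ν ^ 4 * funG ν j (funL lhat ε (lam + t))) ≠ 0 := by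
      have : 0 ≤ t * (1 + 4 / ν ^ 4 * funG ν j (funL lhat ε (lam + t))) := by positivity
      linarith
    have hone : (lam + t * (1 + 4 / ν ^ 4 * funG ν j (funL lhat ε (lam + t)))) *
        resolventSymbol lhat ν lam ε j t = 1 := mul_one_div_cancel hd
    have hone' := congrArg (fun x : ℝ => (x : ℂ)) hone
    push_cast at hone'
    simp only [smul_eq_mul, id]
    push_cast
    linear_combination (w : Lp ℂ 2 (fockMeasure ρ ε n)) p * hone'
  simp only [opL0, add_apply, neg_apply, smul_apply, ContinuousLinearMap.comp_apply,
    ContinuousLinearMap.id_apply, map_neg, smul_neg, sub_neg_eq_add]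
  clear_value s
  rw [← key]
  abel

end OperatorsH

/-! ### The a priori bound on `aPlus` and the induction on `j`. -/

section Main

variable (ρ : Mollifier) (lhat ν : ℝ)

set_option maxHeartbeats 1000000 in
-- The squared left side is the form of A₊*(λ-L₀)⁻¹A₊. By `exists_form_bound` it is (4/ν⁴)
-- G_2(L^ε)(-L₀) up to a controlled error, and G_2(L^ε) ≤ L^ε is bounded uniformly in ε.
theorem exists_norm_inv_sqrt_aPlus_le (hlhat : 0 < lhat) (hν : 0 < ν) {lam : ℝ} (hlam : 0 < lam)
    (n : ℕ) : ∃ K : ℝ, 0 ≤ K ∧ ∀ ε : ℝ, 0 < ε → ε < 1 / 2 → ∀ φ : Fock ρ ε n,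
      ‖diagOp ρ ε ν (n + 1) (fun t => 1 / √(lam + t)) (continuousOn_inv_sqrt hlam)
        (aPlus ρ lhat ε n φ)‖ ≤ K * ‖sqrtNegL0 ρ ε ν n φ‖ := by
  obtain ⟨C, hC, hform⟩ := exists_form_bound ρ ν lhat hlhat hν
  have hl2 := Real.log_pos (by norm_num : (1 : ℝ) < 2)
  set M := Real.pi * lhat ^ 2 * (Real.log (1 + 1 / lam) / (2 * Real.log 2) + 1) with hM
  have hM0 : 0 ≤ M := by
    have : 0 ≤ Real.log (1 + 1 / lam) := Real.log_nonneg (by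
      have : 0 ≤ 1 / lam := by positivity
      linarith)
    positivity
  set K2 := C * (n + 1) * (1 / Real.log 2) + 4 / ν ^ 4 * (M * (ν ^ 2 / 2) * (2 / ν ^ 2)) with hK2
  have hK20 : 0 ≤ K2 := by positivity
  refine ⟨√K2, Real.sqrt_nonneg _, fun ε h0 h1 φ => ?_⟩
  have hlog := log_two_le_log_inv h0 h1
  set s := ‖sqrtNegL0 ρ ε ν n φ‖ with hs
  have hs0 : 0 ≤ s := norm_nonneg _
  set w := aPlus ρ lhat ε n φ with hw
  -- For index 1 the function G_1 vanishes, so the resolvent symbol is exactly 1/(λ+t).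
  have hcont := continuousOn_resolventSymbol lhat ν ε hlam 1
  have hq := inner_diagOp_self ρ ε ν (n + 1) hcont
    (fun t ht => resolventSymbol_nonneg lhat ν ε hlam 1 ht) w
  have hn : ‖diagOp ρ ε ν (n + 1) (fun t => 1 / √(lam + t)) (continuousOn_inv_sqrt hlam) w‖ ≤
      ‖diagOp ρ ε ν (n + 1) (fun t => √(resolventSymbol lhat ν lam ε 1 t))
        (continuousOn_sqrt_of_continuousOn hcont) w‖ := by
    refine norm_diagOp_le ρ ε ν (n + 1) _ _ (fun t ht => ?_) w
    simp [resolventSymbol, funG_one]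
  have hf := hform lam hlam ε h0 h1 n 1 le_rfl φ φ
  rw [← hw, hq] at hf
  obtain ⟨Gs, hGs, hGi, hG⟩ := inner_opG_opL0 ρ ε ν lhat hlam (1 + 1) n φ φ
  have hdiag := norm_integral_fock_le ρ ε ν hν n φ φ
    (fun p => ((Gs (ν ^ 2 / 2 * ‖∑ i, p i‖ ^ 2) : ℝ) : ℂ)) (K := M * (ν ^ 2 / 2))
    (by positivity) (fun p => by
      set t := ν ^ 2 / 2 * ‖∑ i, p i‖ ^ 2 with ht
      have ht0 : 0 ≤ t := by positivity
      have hL := funL_nonneg lhat ε (by linarith : 0 < lam + t)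
      have hg := (le_abs_self _).trans (abs_funG_le ν (by norm_num : 1 ≤ 1 + 1) hL)
      have hgl := hg.trans (funL_le lhat h0 h1 hlam (le_add_of_nonneg_right ht0))
      have hg0 := funG_nonneg ν (1 + 1) hL
      rw [Complex.norm_real, Real.norm_eq_abs, hGs, abs_of_nonneg (by positivity),
        mul_assoc, ← ht]
      gcongr)
  have hG' : ‖inner ℂ φ ((((4 / ν ^ 4 : ℝ) : ℂ) •
      (opG ρ lhat ν hlam ε (1 + 1) n).comp (opL0 ρ ε ν n)) φ)‖ ≤
      4 / ν ^ 4 * (M * (ν ^ 2 / 2) * (2 / ν ^ 2) * s * s) := by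
    rw [hG, norm_neg, norm_mul, Complex.norm_real, Real.norm_eq_abs,
      abs_of_nonneg (by positivity : 0 ≤ 4 / ν ^ 4)]
    exact mul_le_mul_of_nonneg_left hdiag (by positivity)
  set D := ‖diagOp ρ ε ν (n + 1) (fun t => √(resolventSymbol lhat ν lam ε 1 t))
        (continuousOn_sqrt_of_continuousOn hcont) w‖ with hD
  have h3 : D ^ 2 ≤ K2 * s ^ 2 := by
    have h4 := norm_sub_le (((D ^ 2 : ℝ) : ℂ) + inner ℂ φ ((((4 / ν ^ 4 : ℝ) : ℂ) •
      (opG ρ lhat ν hlam ε (1 + 1) n).comp (opL0 ρ ε ν n)) φ)) (inner ℂ φ ((((4 / ν ^ 4 : ℝ) : ℂ) •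
      (opG ρ lhat ν hlam ε (1 + 1) n).comp (opL0 ρ ε ν n)) φ))
    rw [add_sub_cancel_right, Complex.norm_real, Real.norm_eq_abs,
      abs_of_nonneg (by positivity)] at h4
    refine h4.trans ((add_le_add hf hG').trans ?_)
    have h5 : C * (n + 1) * (1 / Real.log (1 / ε)) * s * s ≤
        C * (n + 1) * (1 / Real.log 2) * s * s := by gcongr
    rw [hK2]
    linarith
  refine hn.trans ?_
  rw [← Real.sqrt_sq hs0, ← Real.sqrt_mul hK20]
  exact Real.le_sqrt_of_sq_le h3

set_option maxHeartbeats 1000000 in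
-- The quantifier over n stays inside the induction on j, since the step for n uses the hypothesis
-- for n + 1. The constants depend on n, j and λ, while the rate 1/log(1/ε) is the same throughout.
theorem exists_opH_bound (hlhat : 0 < lhat) (hν : 0 < ν) {lam : ℝ} (hlam : 0 < lam) {j : ℕ}
    (hj : 1 ≤ j) : ∀ n : ℕ, ∃ C : ℝ, 0 ≤ C ∧ ∀ ε : ℝ, 0 < ε → ε < 1 / 2 → ∀ φ₁ φ₂ : Fock ρ ε n,
      ‖inner ℂ φ₁ ((opH ρ lhat ν lam ε j n + ((4 / ν ^ 4 : ℝ) : ℂ) •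
        (opG ρ lhat ν hlam ε j n).comp (opL0 ρ ε ν n)) φ₂)‖ ≤
      C * (1 / Real.log (1 / ε)) * ‖sqrtNegL0 ρ ε ν n φ₁‖ * ‖sqrtNegL0 ρ ε ν n φ₂‖ := by
  induction j, hj using Nat.le_induction with
  | base =>
    refine fun n => ⟨0, le_rfl, fun ε h0 h1 φ₁ φ₂ => ?_⟩
    obtain ⟨Gs, hGs, -, hG⟩ := inner_opG_opL0 ρ ε ν lhat hlam 1 n φ₁ φ₂
    have hH : opH ρ lhat ν lam ε 1 n = 0 := rfl
    have hGs0 : ∀ t, Gs t = 0 := fun t => by rw [hGs, funG_one, zero_mul]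
    rw [hH, zero_add, hG]
    simp [hGs0]
  | succ j hj ih =>
    intro n
    obtain ⟨C, hC, hform⟩ := exists_form_bound ρ ν lhat hlhat hν
    obtain ⟨C', hC', hE⟩ := ih (n + 1)
    obtain ⟨K, hK, hA⟩ := exists_norm_inv_sqrt_aPlus_le ρ lhat ν hlhat hν hlam n
    refine ⟨C * (n + 1) + C' * K ^ 2, by positivity, fun ε h0 h1 φ₁ φ₂ => ?_⟩
    have hlog : 0 < Real.log (1 / ε) :=
      (Real.log_pos (by norm_num : (1 : ℝ) < 2)).trans_le (log_two_le_log_inv h0 h1)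
    obtain ⟨-, hp, hu⟩ := isPositive_opH_and_isUnit ρ ε ν lhat hlam hj (n + 1)
    set w₁ := aPlus ρ lhat ε n φ₁ with hw₁
    set w₂ := aPlus ρ lhat ε n φ₂ with hw₂
    have happ := apply_resolventSymbol ρ ε ν lhat hlam j (n + 1) w₂
    -- Splits the form of H_{j+1} into the explicit form of S_j, treated by `hform`, and a remainder
    -- with E_j between T_j⁻¹A₊φ₁ and S_jA₊φ₂. In the remainder the induction hypothesis gives the
    -- rate and each side costs a factor K.
    have hres := inner_ringInverse_eq hp hu (a := w₁) happ
    have hf := hform lam hlam ε h0 h1 n j hj φ₁ φ₂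
    have b1 := (norm_sqrtNegL0_ringInverse_le ρ ε ν lhat hlam hj (n + 1) w₁).trans (hA ε h0 h1 φ₁)
    have b2 := (norm_sqrtNegL0_resolventSymbol_le ρ ε ν lhat hlam j (n + 1) w₂).trans
      (hA ε h0 h1 φ₂)
    have hEs := hE ε h0 h1 (Ring.inverse ((lam : ℂ) • ContinuousLinearMap.id ℂ
      (Fock ρ ε (n + 1)) - opL0 ρ ε ν (n + 1) + opH ρ lhat ν lam ε j (n + 1)) w₁)
      (diagOp ρ ε ν (n + 1) (resolventSymbol lhat ν lam ε j)
        (continuousOn_resolventSymbol lhat ν ε hlam j) w₂)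
    have hadj : inner ℂ φ₁ (opH ρ lhat ν lam ε (j + 1) n φ₂) = inner ℂ w₁
        (Ring.inverse ((lam : ℂ) • ContinuousLinearMap.id ℂ (Fock ρ ε (n + 1)) -
          opL0 ρ ε ν (n + 1) + opH ρ lhat ν lam ε j (n + 1)) w₂) := by
      rw [opH_succ ρ ε ν lhat lam hj]
      exact ContinuousLinearMap.adjoint_inner_right (aPlus ρ lhat ε n) φ₁ _
    rw [add_apply, inner_add_right, hadj, hres, sub_add_eq_add_sub]
    refine (norm_sub_le _ _).trans ((add_le_add hf hEs).trans ?_)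
    set s₁ := ‖sqrtNegL0 ρ ε ν n φ₁‖
    set s₂ := ‖sqrtNegL0 ρ ε ν n φ₂‖
    have h3 := mul_le_mul b1 b2 (norm_nonneg _) (mul_nonneg hK (norm_nonneg _))
    have h4 := mul_le_mul_of_nonneg_left h3 (by positivity : 0 ≤ C' * (1 / Real.log (1 / ε)))
    rw [mul_assoc (C' * (1 / Real.log (1 / ε)))]
    refine (add_le_add le_rfl h4).trans_eq ?_
    ring

theorem tendsto_inv_log_inv : Tendsto (fun ε : ℝ => 1 / Real.log (1 / ε)) (𝓝[>] 0) (𝓝 0) := by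
  simp only [one_div]
  exact (Real.tendsto_log_atTop.comp tendsto_inv_nhdsGT_zero).inv_tendsto_atTop

end Main

end WeakCoupling

end

theorem proposition3p1 (ρ : Mollifier) (lhat ν : ℝ) (hlhat : 0 < lhat) (hν : 0 < ν) :
    -- the properties of the functions `G_j` on `[0, ∞)`
    (∀ j : ℕ, 1 ≤ j →
      ContDiffOn ℝ 2 (funG ν j) (Ici 0) ∧ funG ν j 0 = 0 ∧
      ∀ x : ℝ, 0 ≤ x →
        0 ≤ funG ν j x ∧ |funG ν j x| ≤ x ∧
        |derivWithin (funG ν j) (Ici 0) x| ≤ 1 ∧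
        |iteratedDerivWithin 2 (funG ν j) (Ici 0) x| ≤ 4 / ν ^ 4) ∧
    -- the inverses in the recursion that defines the operators `H_j` exist
    (∀ lam : ℝ, 0 < lam → ∀ ε : ℝ, 0 < ε → ε < 1 / 2 → ∀ n j : ℕ, 1 ≤ n → 1 ≤ j →
      IsUnit ((lam : ℂ) • ContinuousLinearMap.id ℂ (Fock ρ ε n) - opL0 ρ ε ν n +
        opH ρ lhat ν lam ε j n)) ∧
    -- the approximation of `H_j`
    ∃ δ : ℝ → ℝ, Tendsto δ (𝓝[>] 0) (𝓝 0) ∧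
      ∀ (lam : ℝ) (hlam : 0 < lam) (n j : ℕ), 1 ≤ n → 1 ≤ j →
        ∃ C : ℝ, ∀ ε : ℝ, 0 < ε → ε < 1 / 2 → ∀ φ₁ φ₂ : Fock ρ ε n,
          ‖inner ℂ φ₁ ((opH ρ lhat ν lam ε j n +
              ((4 / ν ^ 4 : ℝ) : ℂ) •
                (opG ρ lhat ν hlam ε j n).comp (opL0 ρ ε ν n)) φ₂)‖ ≤
            C * δ ε * ‖sqrtNegL0 ρ ε ν n φ₁‖ * ‖sqrtNegL0 ρ ε ν n φ₂‖ := by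
  refine ⟨fun j hj => ⟨contDiffOn_funG ν hj, funG_zero_right ν j, fun x hx =>
    ⟨funG_nonneg ν j hx, abs_funG_le ν hj hx, abs_derivWithin_funG_le ν hj hx,
      abs_iteratedDerivWithin_funG_le ν hj hx⟩⟩,
    fun lam hlam ε _ _ n j _ hj => (isPositive_opH_and_isUnit ρ ε ν lhat hlam hj n).2.2,
    -- The rate δ is 1/log(1/ε); all dependence on n, j and λ sits in C.
    fun ε => 1 / Real.log (1 / ε), tendsto_inv_log_inv, fun lam hlam n j _ hj => ?_⟩
  obtain ⟨C, -, h⟩ := exists_opH_bound ρ lhat ν hlhat hν hlam hj n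
  exact ⟨C, h⟩
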